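/- A finite simple stochastic game (SSG) is a finite directed graph $(V,\to)$ in which every vertex has a successor, with a partition $V=V_\top\cup V_\bot\cup V_P$ into vertices of player Max, vertices of player Min and random vertices, and a rational probability distribution on the outgoing edges of each random vertex. A strategy of a player assigns to every history (finite nonempty word of vertices) ending in one of the player's vertices a probability distribution on the outgoing edges of that vertex. A start vertex $s$ and strategies $\sigma$ of Max and $\pi$ of Min determine a probability measure $\mathbb{P}^{\sigma,\pi}_s$ on runs $w=w(0)w(1)\cdots$ with $w(0)=s$. For a measurable set $O$ of runs let $\mathrm{Val}^{O}(s)=\sup_\sigma\inf_\pi \mathbb{P}^{\sigma,\pi}_s(O)$. For a reward function $r:V\to\{-1,0,1\}$ consider the three limit objectives $$\Big\{w : \liminf_{n\to\infty}\sum_{i=0}^{n} r(w(i))=-\infty\Big\},\qquad \Big\{w : \liminf_{n\to\infty}\sum_{i=0}^{n} r(w(i))=+\infty\Big\},\qquad \Big\{w : \liminf_{n\to\infty}\frac1n\sum_{i=0}^{n-1} r(w(i))>0\Big\}.$$ Condon's quantitative reachability problem is: given a finite SSG $\mathcal{H}$ and vertices $s,t$ of $\mathcal{H}$, decide whether $\mathrm{Val}^{\mathrm{Reach}(t)}(s)\ge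 \tfrac12$, where $\mathrm{Reach}(t)=\{w : \exists i\ge 0,\ w(i)=t\}$. **Proposition.** Let $O$ be any of the three limit objectives. Then Condon's quantitative reachability problem is reducible by a polynomial-time many-one reduction to the following promise problem: given a finite SSG $\mathcal{G}$, a vertex $s$ and a reward function $r$, such that $\mathrm{Val}^{O}(s)=1$ or $\mathrm{Val}^{O}(s)=0$, decide which is the case. That is, there is a function $(\mathcal{H},s,t)\mapsto(\mathcal{G},s',r)$, computable by a Turing machine in time polynomial in the length of the encoding of $(\mathcal{H},s,t)$ (probabilities being written as fractions in binary), such that in $\mathcal{G}$ one has $\mathrm{Val}^{O}(s')=1$ if $\mathrm{Val}^{\mathrm{Reach}(t)}(s)\ge\tfrac12$ in $\mathcal{H}$, and $\mathrm{Val}^{O}(s')=0$ otherwise. -/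

import Mathlib

open scoped ENNReal NNReal NNRat
open MeasureTheory ProbabilityTheory Filter

namespace SSGames

/-! ### Simple stochastic games -/

/-- The class of a vertex: it belongs to player Max, to player Min, or is random. -/
inductive Owner
  | max
  | min
  | random
  deriving DecidableEq

instance : Fintype Owner where
  elems := {Owner.max, Owner.min, Owner.random}
  complete := by rintro (_ | _ | _) <;> decide

/-- A finite simple stochastic game on the vertex set `V`: a directed graph in which every vertex
has a successor, a partition of the vertices, and for each random vertex a rational probability
distribution on its outgoing edges.  The probability assignment is extended by zero to all other
pairs of vertices. -/
structure SSG (V : Type) [Fintype V] where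
  /-- the partition of the vertices -/
  owner : V → Owner
  /-- `u ∈ succ v` means that there is an edge from `v` to `u` -/
  succ : V → Finset V
  succ_nonempty : ∀ v, (succ v).Nonempty
  /-- the probability assignment -/
  prob : V → V → ℚ≥0
  prob_sum : ∀ v, owner v = Owner.random → ∑ u, prob v u = 1
  prob_eq_zero : ∀ v u, owner v ≠ Owner.random ∨ u ∉ succ v → prob v u = 0

/-- Histories of length `n + 1`: nonempty words `w(0) ⋯ w(n)` of vertices. -/
abbrev History (V : Type) (n : ℕ) : Type := Finset.Iic n → V

/-- The last vertex of a history. -/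
def History.last {V : Type} {n : ℕ} (h : History V n) : V := h ⟨n, Finset.mem_Iic.2 le_rfl⟩

namespace SSG

variable {V : Type} [Fintype V]

/-- A (history dependent, randomized) strategy of the player `o`: to every history that ends in a
vertex of this player it assigns a probability distribution on the successors of that vertex.
The values at the other histories are irrelevant. -/
structure Strategy (G : SSG V) (o : Owner) where
  /-- the distribution of the next vertex -/
  move : (n : ℕ) → History V n → PMF V
  mem_succ : ∀ n (h : History V n), G.owner h.last = o →
    ∀ u ∈ (move n h).support, u ∈ G.succ h.last

/-- The distribution of the successor of a random vertex. -/
noncomputable def randomMove (G : SSG V) (v : V) (hv : G.owner v = Owner.random) : PMF V :=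
  PMF.ofFintype (fun u => (((G.prob v u : ℚ≥0) : ℝ≥0) : ℝ≥0∞)) (by
    rw [← ENNReal.ofNNReal_finsetSum, ← NNRat.cast_sum, G.prob_sum v hv]
    simp)

/-- The distribution of the next vertex after the history `h`, when Max plays `σ` and Min
plays `π`. -/
noncomputable def nextMove (G : SSG V) (σ : G.Strategy Owner.max) (π : G.Strategy Owner.min)
    {n : ℕ} (h : History V n) : PMF V :=
  match hv : G.owner h.last with
  | Owner.max => σ.move n h
  | Owner.min => π.move n h
  | Owner.random => G.randomMove h.last hv

variable [MeasurableSpace V] [DiscreteMeasurableSpace V]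

/-- `nextMove` as a Markov kernel from histories of length `n + 1` to vertices. -/
noncomputable def stepKernel (G : SSG V) (σ : G.Strategy Owner.max) (π : G.Strategy Owner.min)
    (n : ℕ) : Kernel (History V n) V where
  toFun h := (G.nextMove σ π h).toMeasure
  measurable' := measurable_of_countable _

instance (G : SSG V) (σ : G.Strategy Owner.max) (π : G.Strategy Owner.min) (n : ℕ) :
    IsMarkovKernel (G.stepKernel σ π n) :=
  ⟨fun h => PMF.toMeasure.isProbabilityMeasure (G.nextMove σ π h)⟩

/-- The probability measure on runs determined by the initial vertex `s` and the strategies `σ`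
and `π`.  It lives on all sequences of vertices and is carried by the infinite paths of the
graph that start in `s`. -/
noncomputable def runMeasure (G : SSG V) (σ : G.Strategy Owner.max) (π : G.Strategy Owner.min)
    (s : V) : Measure (ℕ → V) :=
  Kernel.traj (X := fun _ => V) (G.stepKernel σ π) 0 (fun _ => s)

/-- The value of the game at `s` for the objective `O`. -/
noncomputable def value (G : SSG V) (O : Set (ℕ → V)) (s : V) : ℝ≥0∞ :=
  ⨆ σ : G.Strategy Owner.max, ⨅ π : G.Strategy Owner.min, G.runMeasure σ π s O

end SSG

/-! ### Objectives -/

/-- The runs that visit `t`. -/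
def reach {V : Type} (t : V) : Set (ℕ → V) := {w | ∃ i, w i = t}

/-- The three limit objectives. -/
inductive LimitObjective
  | liminfEqBot
  | liminfEqTop
  | meanPos

/-- The runs that satisfy a limit objective with respect to the reward function `r`, whose values
are `-1`, `0` or `1`. -/
noncomputable def LimitObjective.runs {V : Type} (r : V → SignType) :
    LimitObjective → Set (ℕ → V)
  | liminfEqBot =>
      {w | liminf (fun n : ℕ =>
        ((∑ i ∈ Finset.range (n + 1), ((r (w i) : SignType) : ℝ) : ℝ) : EReal)) atTop = ⊥}
  | liminfEqTop =>
      {w | liminf (fun n : ℕ =>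
        ((∑ i ∈ Finset.range (n + 1), ((r (w i) : SignType) : ℝ) : ℝ) : EReal)) atTop = ⊤}
  | meanPos =>
      {w | 0 < liminf (fun n : ℕ =>
        (((∑ i ∈ Finset.range n, ((r (w i) : SignType) : ℝ)) / (n : ℝ) : ℝ) : EReal)) atTop}

/-! ### Promise problems and polynomial time reductions -/

/-- A promise problem whose instances are written as words over a finite alphabet. -/
structure PromiseProblem where
  /-- the instances -/
  Inst : Type
  /-- the alphabet -/
  Alphabet : Type
  finite_alphabet : Finite Alphabet
  /-- the encoding of instances by words -/
  encode : Inst → List Alphabet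
  encode_injective : Function.Injective encode
  /-- the yes-instances -/
  yes : Set Inst
  /-- the no-instances -/
  no : Set Inst
  disjoint_yes_no : Disjoint yes no

/-- Polynomial time many-one reducibility between promise problems: a function computed by a Turing
machine in polynomial time maps yes-instances to yes-instances and no-instances to no-instances. -/
def PolyTimeReducible (A B : PromiseProblem) : Prop :=
  ∃ f : A.Inst → B.Inst, Nonempty (Turing.TM2ComputableInPolyTime A.encode B.encode f) ∧
    (∀ x ∈ A.yes, f x ∈ B.yes) ∧ (∀ x ∈ A.no, f x ∈ B.no)

/-! ### Encoding of games -/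

/-- The alphabet used to write down games. -/
inductive Sym
  | owner (o : Owner)
  | flag (b : Bool)
  | reward (z : SignType)
  | bit (b : Bool)
  | slash
  | endCell
  | endRow
  deriving DecidableEq, Fintype

/-- The entry of the adjacency matrix for a pair of vertices: is there an edge, and which
probability does it have?  The numerator and the denominator are written in binary, with the
least significant bit first. -/
def encodeCell (c : Bool × ℚ≥0) : List Sym :=
  Sym.flag c.1 :: (c.2.num.bits.map Sym.bit ++
    Sym.slash :: (c.2.den.bits.map Sym.bit ++ [Sym.endCell]))

/-- A row of the adjacency matrix, preceded by three symbols that describe the vertex. -/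
def encodeRow {n : ℕ} (d : (Sym × Sym × Sym) × (Fin n → Bool × ℚ≥0)) : List Sym :=
  d.1.1 :: d.1.2.1 :: d.1.2.2 ::
    ((List.finRange n).flatMap (fun u => encodeCell (d.2 u)) ++ [Sym.endRow])

/-- A game is written as its adjacency matrix, row by row.  Each vertex carries its owner and two
further labels. -/
def encodeGame {n : ℕ} (G : SSG (Fin n)) (label : Fin n → Sym × Sym) : List Sym :=
  (List.finRange n).flatMap (fun v =>
    encodeRow ((Sym.owner (G.owner v), label v), fun u => (decide (u ∈ G.succ v), G.prob v u)))

/-- An encoding is self-delimiting if a word is recognized from any text that starts with it. -/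
def SelfDelimiting {α : Type} (e : α → List Sym) : Prop :=
  ∀ x y l l', e x ++ l = e y ++ l' → x = y ∧ l = l'

theorem SelfDelimiting.flatMap {α β : Type} {e : α → List Sym} (he : SelfDelimiting e)
    (L : List β) (x y : β → α) (l l' : List Sym)
    (h : L.flatMap (fun b => e (x b)) ++ l = L.flatMap (fun b => e (y b)) ++ l') :
    (∀ b ∈ L, x b = y b) ∧ l = l' := by
  induction L with
  | nil => simpa using h
  | cons b L ih =>
    simp only [List.flatMap_cons, List.append_assoc] at h
    obtain ⟨h1, h2⟩ := he _ _ _ _ h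
    obtain ⟨h3, h4⟩ := ih h2
    exact ⟨by simpa [h1] using h3, h4⟩

theorem bits_append_inj {z : Sym} (hz : ∀ b, z ≠ Sym.bit b) (a b : List Bool) (l l' : List Sym)
    (h : a.map Sym.bit ++ z :: l = b.map Sym.bit ++ z :: l') : a = b ∧ l = l' := by
  induction a generalizing b with
  | nil =>
    cases b with
    | nil => simpa using h
    | cons y b => simp at h; exact absurd h.1 (hz y)
  | cons x a ih =>
    cases b with
    | nil => simp at h; exact absurd h.1.symm (hz x)
    | cons y b =>
      simp only [List.map_cons, List.cons_append, List.cons.injEq, Sym.bit.injEq] at h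
      obtain ⟨h1, h2⟩ := ih b h.2
      exact ⟨by rw [h.1, h1], h2⟩

theorem bits_inj {a b : ℕ} (h : a.bits = b.bits) : a = b := by
  have key : ∀ n : ℕ, Nat.ofDigits 2 (n.bits.map (fun b => cond b 1 0)) = n := fun n => by
    rw [← Nat.digits_two_eq_bits, Nat.ofDigits_digits]
  rw [← key a, h, key b]

theorem selfDelimiting_encodeCell : SelfDelimiting encodeCell := by
  rintro ⟨a, p⟩ ⟨b, q⟩ l l' h
  simp only [encodeCell, List.cons_append, List.append_assoc, List.nil_append, List.cons.injEq,
    Sym.flag.injEq] at h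
  obtain ⟨h0, h⟩ := h
  obtain ⟨h1, h⟩ := bits_append_inj (by simp) _ _ _ _ h
  obtain ⟨h2, h⟩ := bits_append_inj (by simp) _ _ _ _ h
  exact ⟨by rw [h0, NNRat.ext_num_den (bits_inj h1) (bits_inj h2)], h⟩

theorem selfDelimiting_encodeRow (n : ℕ) : SelfDelimiting (encodeRow (n := n)) := by
  rintro ⟨⟨a, b, c⟩, x⟩ ⟨⟨a', b', c'⟩, y⟩ l l' h
  simp only [encodeRow, List.cons_append, List.append_assoc, List.nil_append,
    List.cons.injEq] at h
  obtain ⟨h1, h2, h3, h⟩ := h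
  obtain ⟨h4, h⟩ := selfDelimiting_encodeCell.flatMap _ x y _ _ h
  have hxy : x = y := funext fun u => h4 u (List.mem_finRange u)
  subst h1 h2 h3 hxy
  simpa using h

theorem count_encodeCell (c : Bool × ℚ≥0) : (encodeCell c).count Sym.endRow = 0 := by
  rw [List.count_eq_zero]
  simp [encodeCell]

theorem count_encodeGame {n : ℕ} (G : SSG (Fin n)) (label : Fin n → Sym × Sym)
    (hl : ∀ v, (label v).1 ≠ Sym.endRow ∧ (label v).2 ≠ Sym.endRow) :
    (encodeGame G label).count Sym.endRow = n := by
  have h : ∀ v, List.count Sym.endRow (encodeRow ((Sym.owner (G.owner v), label v),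
      fun u => (decide (u ∈ G.succ v), G.prob v u))) = 1 := by
    intro v
    simp only [encodeRow, List.count_cons, List.count_append, List.count_flatMap]
    simp [count_encodeCell, (hl v).1, (hl v).2, Function.comp_def]
  rw [encodeGame, List.count_flatMap]
  simp [Function.comp_def, h]

theorem SSG.ext' {V : Type} [Fintype V] {G H : SSG V} (h1 : G.owner = H.owner)
    (h2 : G.succ = H.succ) (h3 : G.prob = H.prob) : G = H := by
  cases G
  cases H
  simp_all

theorem encodeGame_inj {n : ℕ} {G H : SSG (Fin n)} {k l : Fin n → Sym × Sym}
    (h : encodeGame G k = encodeGame H l) : G = H ∧ k = l := by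
  obtain ⟨h1, -⟩ := (selfDelimiting_encodeRow n).flatMap (List.finRange n)
    (fun v => ((Sym.owner (G.owner v), k v), fun u => (decide (u ∈ G.succ v), G.prob v u)))
    (fun v => ((Sym.owner (H.owner v), l v), fun u => (decide (u ∈ H.succ v), H.prob v u)))
    [] [] (by simpa [encodeGame] using h)
  simp only [List.mem_finRange, Prod.mk.injEq, Sym.owner.injEq, funext_iff, forall_const,
    decide_eq_decide] at h1
  refine ⟨SSG.ext' (funext fun v => (h1 v).1.1) (funext fun v => ?_)
    (funext fun v => funext fun u => ((h1 v).2 u).2), funext fun v => (h1 v).1.2⟩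
  ext u
  exact ((h1 v).2 u).1

/-! ### The two computational problems -/

/-- An instance of the quantitative reachability problem: a game, an initial vertex and a target
vertex. -/
structure ReachInstance where
  /-- the number of vertices -/
  n : ℕ
  /-- the game -/
  game : SSG (Fin n)
  /-- the initial vertex -/
  start : Fin n
  /-- the target vertex -/
  target : Fin n

/-- An instance is written as the game, with the initial and the target vertex marked. -/
def ReachInstance.encode (x : ReachInstance) : List Sym :=
  encodeGame x.game (fun v =>
    (Sym.flag (decide (v = x.start)), Sym.flag (decide (v = x.target))))

theorem ReachInstance.encode_injective : Function.Injective ReachInstance.encode := by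
  rintro ⟨n, G, s, t⟩ ⟨m, H, s', t'⟩ h
  have hn : n = m := by
    have h' := congrArg (List.count Sym.endRow) h
    rw [ReachInstance.encode, ReachInstance.encode, count_encodeGame _ _ (by simp),
      count_encodeGame _ _ (by simp)] at h'
    exact h'
  subst hn
  obtain ⟨h1, h2⟩ := encodeGame_inj h
  have h3 := congrFun h2 s
  have h4 := congrFun h2 t
  simp at h1 h3 h4
  rw [h1, h3.1, h4.2]

/-- Condon's quantitative reachability problem: is the value of reaching the target at
least `1/2`? -/
noncomputable def condonProblem : PromiseProblem where
  Inst := ReachInstance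
  Alphabet := Sym
  finite_alphabet := inferInstance
  encode := ReachInstance.encode
  encode_injective := ReachInstance.encode_injective
  yes := {x | 1 / 2 ≤ x.game.value (reach x.target) x.start}
  no := {x | ¬ 1 / 2 ≤ x.game.value (reach x.target) x.start}
  disjoint_yes_no := Set.disjoint_left.2 fun _ h h' => h' h

/-- A game with rewards on the vertices and an initial vertex. -/
structure RewardInstance where
  /-- the number of vertices -/
  n : ℕ
  /-- the game -/
  game : SSG (Fin n)
  /-- the initial vertex -/
  start : Fin n
  /-- the reward function -/
  reward : Fin n → SignType

/-- An instance is written as the game, with the initial vertex marked and the reward of each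
vertex noted. -/
def RewardInstance.encode (x : RewardInstance) : List Sym :=
  encodeGame x.game (fun v => (Sym.flag (decide (v = x.start)), Sym.reward (x.reward v)))

theorem RewardInstance.encode_injective : Function.Injective RewardInstance.encode := by
  rintro ⟨n, G, s, r⟩ ⟨m, H, s', r'⟩ h
  have hn : n = m := by
    have h' := congrArg (List.count Sym.endRow) h
    rw [RewardInstance.encode, RewardInstance.encode, count_encodeGame _ _ (by simp),
      count_encodeGame _ _ (by simp)] at h'
    exact h'
  subst hn
  obtain ⟨h1, h2⟩ := encodeGame_inj h
  have h3 := congrFun h2 s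
  have h4 : r = r' := funext fun v => by simpa using congrArg Prod.snd (congrFun h2 v)
  simp at h1 h3
  rw [h1, h3.1, h4]

/-- The problem to decide which of the values `1` and `0` a game with the limit objective `O` has,
under the promise that its value is one of the two. -/
noncomputable def zeroOneProblem (O : LimitObjective) : PromiseProblem where
  Inst := RewardInstance
  Alphabet := Sym
  finite_alphabet := inferInstance
  encode := RewardInstance.encode
  encode_injective := RewardInstance.encode_injective
  yes := {x | x.game.value (O.runs x.reward) x.start = 1}
  no := {x | x.game.value (O.runs x.reward) x.start = 0}
  disjoint_yes_no := Set.disjoint_left.2 fun _ h h' => one_ne_zero (h.symm.trans h')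

end SSGames

/-! ### One-step probabilities and expectations of a play. -/

namespace SSGames

namespace SSG

variable {V : Type} [Fintype V]

/-! Write `e = coin L = 2 ^ (-L)`, with `L` the length of the encoded input. The reduced game plays
`G` from `s` over and over. Before each visit of a vertex the round is stopped with probability `e ^
2`, which counts as a loss (reward `-1` at `bad`); reaching `t` unstopped is a win (reward `1` at
`good`). Each round is preceded by a coin that awards an immediate win with probability `e`. If `x`
is the value of reaching `t` in the stopped game, the expected reward of an optimally played round
is `bias = 2 * e + 2 * (1 - e) * x - 1`.

The sign of `bias` decides everything. A suitable potential spreads the expected reward of a round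
over its moves, so that one player can, by a positional strategy, force a drift bounded away from
`0` at every step (`drift_reduced`). An exponential supermartingale turns this into almost sure
linear growth of the partial sums (`ae_linear_growth`), which settles all three objectives at once,
up to negating the rewards for `liminfEqBot`.

It remains to see that `bias` is positive if the reachability value is at least `1/2` and negative
otherwise. By Cramer's rule `x` is a quotient of integer polynomials in `e ^ 2`, so `bias` is, up to
a denominator, an integer polynomial in `e`. The sum of the absolute values of its coefficients is
at most `gapBound`, which is less than `2 ^ L`; hence it has no zero in `(0, 2 ^ (-L)]`
(`bias_ne_zero`), and by continuity its sign there is that of `bias` for arbitrarily small `e`. If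
the value is less than `1/2`, this sign is negative because `x` never exceeds the value
(`bias_neg_of_value_lt`). If the value is at least `1/2`, stopping may push `x` below `1/2`, but
being rational in `e ^ 2` it loses only `O(e ^ 2)`, which the gain `e` of the coin outweighs
(`bias_pos_of_le_value`). This is why the coin has probability `e` and stopping has probability `e ^
2`.

The reduction is computed by an explicit stack machine that reads the input backwards, builds the
output from its end, and uses a copy of the input as a unary counter for `L`. Its time bound is
quadratic (`runs_encode`). -/

theorem nextMove_of_max (G : SSG V) (σ : G.Strategy Owner.max) (π : G.Strategy Owner.min) {n : ℕ}
    (h : History V n) (hv : G.owner h.last = Owner.max) : G.nextMove σ π h = σ.move n h := by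
  unfold nextMove
  split <;> simp_all

theorem nextMove_of_min (G : SSG V) (σ : G.Strategy Owner.max) (π : G.Strategy Owner.min) {n : ℕ}
    (h : History V n) (hv : G.owner h.last = Owner.min) : G.nextMove σ π h = π.move n h := by
  unfold nextMove
  split <;> simp_all

theorem nextMove_of_random (G : SSG V) (σ : G.Strategy Owner.max) (π : G.Strategy Owner.min)
    {n : ℕ} (h : History V n) (hv : G.owner h.last = Owner.random) (u : V) :
    G.nextMove σ π h u = (((G.prob h.last u : ℚ≥0) : ℝ≥0) : ℝ≥0∞) := by
  unfold nextMove
  split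
  · simp_all
  · simp_all
  · rfl

theorem nextMove_eq_zero (G : SSG V) (σ : G.Strategy Owner.max) (π : G.Strategy Owner.min)
    {n : ℕ} (h : History V n) {u : V} (hu : u ∉ G.succ h.last) : G.nextMove σ π h u = 0 := by
  rcases hv : G.owner h.last with _ | _ | _
  · rw [G.nextMove_of_max σ π h hv]
    by_contra h0
    exact hu (σ.mem_succ n h hv u ((PMF.mem_support_iff _ _).2 h0))
  · rw [G.nextMove_of_min σ π h hv]
    by_contra h0
    exact hu (π.mem_succ n h hv u ((PMF.mem_support_iff _ _).2 h0))
  · rw [G.nextMove_of_random σ π h hv, G.prob_eq_zero _ _ (Or.inr hu)]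
    simp

/-- The probabilities of the next move, as real numbers. -/
noncomputable def nextProb (G : SSG V) (σ : G.Strategy Owner.max) (π : G.Strategy Owner.min)
    {n : ℕ} (h : History V n) (u : V) : ℝ := (G.nextMove σ π h u).toReal

theorem nextProb_nonneg (G : SSG V) (σ : G.Strategy Owner.max) (π : G.Strategy Owner.min)
    {n : ℕ} (h : History V n) (u : V) : 0 ≤ G.nextProb σ π h u := ENNReal.toReal_nonneg

theorem ofReal_nextProb (G : SSG V) (σ : G.Strategy Owner.max) (π : G.Strategy Owner.min)
    {n : ℕ} (h : History V n) (u : V) : ENNReal.ofReal (G.nextProb σ π h u) = G.nextMove σ π h u :=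
  ENNReal.ofReal_toReal (PMF.apply_ne_top _ _)

theorem sum_nextProb (G : SSG V) (σ : G.Strategy Owner.max) (π : G.Strategy Owner.min)
    {n : ℕ} (h : History V n) : ∑ u, G.nextProb σ π h u = 1 := by
  unfold nextProb
  rw [← ENNReal.toReal_sum (fun u _ => PMF.apply_ne_top _ _),
    ← tsum_fintype (L := SummationFilter.unconditional V), PMF.tsum_coe]
  rfl

theorem nextProb_of_random (G : SSG V) (σ : G.Strategy Owner.max) (π : G.Strategy Owner.min)
    {n : ℕ} (h : History V n) (hv : G.owner h.last = Owner.random) (u : V) :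
    G.nextProb σ π h u = (G.prob h.last u : ℝ) := by
  rw [nextProb, G.nextMove_of_random σ π h hv, ENNReal.coe_toReal]
  norm_cast

theorem nextProb_eq_zero (G : SSG V) (σ : G.Strategy Owner.max) (π : G.Strategy Owner.min)
    {n : ℕ} (h : History V n) {u : V} (hu : u ∉ G.succ h.last) : G.nextProb σ π h u = 0 := by
  rw [nextProb, G.nextMove_eq_zero σ π h hu]
  rfl

theorem sum_nextMove_mul_ofReal (G : SSG V) (σ : G.Strategy Owner.max)
    (π : G.Strategy Owner.min) {n : ℕ} (h : History V n) {g : V → ℝ} (hg : ∀ u, 0 ≤ g u) :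
    ∑ u, G.nextMove σ π h u * ENNReal.ofReal (g u) =
      ENNReal.ofReal (∑ u, G.nextProb σ π h u * g u) := by
  rw [ENNReal.ofReal_sum_of_nonneg
    (fun u _ => mul_nonneg (G.nextProb_nonneg σ π h u) (hg u))]
  refine Finset.sum_congr rfl fun u _ => ?_
  rw [ENNReal.ofReal_mul (G.nextProb_nonneg σ π h u), G.ofReal_nextProb]

/-- The strategy that always moves to the successor given by `c`. -/
noncomputable def positional (G : SSG V) (o : Owner) (c : V → V) (hc : ∀ v, c v ∈ G.succ v) :
    G.Strategy o where
  move _ h := PMF.pure (c h.last)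
  mem_succ n h _ u hu := by
    rw [PMF.mem_support_pure_iff] at hu
    exact hu ▸ hc _

section

variable (G : SSG V) (σ : G.Strategy Owner.max) (π : G.Strategy Owner.min) {n : ℕ}
  (h : History V n) (g : V → ℝ) (a : ℝ)

theorem le_sum_nextProb (hg : ∀ u ∈ G.succ h.last, a ≤ g u) :
    a ≤ ∑ u, G.nextProb σ π h u * g u := by
  rw [← one_mul a, ← G.sum_nextProb σ π h, Finset.sum_mul]
  refine Finset.sum_le_sum fun u _ => ?_
  by_cases hu : u ∈ G.succ h.last
  · exact mul_le_mul_of_nonneg_left (hg u hu) (G.nextProb_nonneg σ π h u)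
  · simp [G.nextProb_eq_zero σ π h hu]

theorem sum_nextProb_le (hg : ∀ u ∈ G.succ h.last, g u ≤ a) :
    ∑ u, G.nextProb σ π h u * g u ≤ a := by
  have := G.le_sum_nextProb σ π h (fun u => - g u) (-a) (fun u hu => neg_le_neg (hg u hu))
  simpa using this

theorem sum_nextProb_positional_max (c : V → V) (hc : ∀ v, c v ∈ G.succ v)
    (hv : G.owner h.last = Owner.max) :
    ∑ u, G.nextProb (G.positional Owner.max c hc) π h u * g u = g (c h.last) := by
  classical
  simp only [nextProb, G.nextMove_of_max _ π h hv, positional, PMF.pure_apply]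
  rw [Finset.sum_eq_single (c h.last)] <;> simp +contextual

theorem sum_nextProb_positional_min (c : V → V) (hc : ∀ v, c v ∈ G.succ v)
    (hv : G.owner h.last = Owner.min) :
    ∑ u, G.nextProb σ (G.positional Owner.min c hc) h u * g u = g (c h.last) := by
  classical
  simp only [nextProb, G.nextMove_of_min σ _ h hv, positional, PMF.pure_apply]
  rw [Finset.sum_eq_single (c h.last)] <;> simp +contextual

theorem sum_nextProb_random (hv : G.owner h.last = Owner.random) :
    ∑ u, G.nextProb σ π h u * g u = ∑ u, (G.prob h.last u : ℝ) * g u := by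
  simp only [G.nextProb_of_random σ π h hv]

end

/-! ### Integration over runs, one move at a time. -/

variable [MeasurableSpace V] [DiscreteMeasurableSpace V]

instance (G : SSG V) (σ : G.Strategy Owner.max) (π : G.Strategy Owner.min) (s : V) :
    IsProbabilityMeasure (G.runMeasure σ π s) := by
  unfold runMeasure
  infer_instance

/-- The history of length `n + 1` of a run. -/
abbrev prefixOf {V : Type} (n : ℕ) (w : ℕ → V) : History V n := Preorder.frestrictLe n w

/-- A function of runs that is determined by the history of length `n + 1`. -/
def Adapted {V α : Type} (n : ℕ) (f : (ℕ → V) → α) : Prop :=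
  ∀ w w', (∀ i ≤ n, w i = w' i) → f w = f w'

/-- A run that extends a history. -/
def extend {V : Type} {n : ℕ} (h : History V n) : ℕ → V :=
  fun i => h ⟨min i n, Finset.mem_Iic.2 (min_le_right _ _)⟩

theorem extend_prefixOf {V : Type} {n i : ℕ} (w : ℕ → V) (hi : i ≤ n) :
    extend (prefixOf n w) i = w i := by
  simp [extend, prefixOf, Preorder.frestrictLe, hi]

theorem Adapted.apply_extend {V α : Type} {n : ℕ} {f : (ℕ → V) → α} (hf : Adapted n f)
    (w : ℕ → V) : f (extend (prefixOf n w)) = f w :=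
  hf _ _ fun _ hi => extend_prefixOf w hi

theorem Adapted.measurable {α : Type} [MeasurableSpace α] {n : ℕ} {f : (ℕ → V) → α}
    (hf : Adapted n f) : Measurable f := by
  have h : f = (fun h : History V n => f (extend h)) ∘ prefixOf n :=
    funext fun w => (hf.apply_extend w).symm
  rw [h]
  exact (measurable_of_countable _).comp (Preorder.measurable_frestrictLe n)

/-- The tower property: the joint law of the history and the next vertex is the composition product
of the law of the history with `stepKernel`. It replaces conditional expectations throughout. -/
theorem lintegral_succ (G : SSG V) (σ : G.Strategy Owner.max) (π : G.Strategy Owner.min) (s : V)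
    {n : ℕ} {f : (ℕ → V) → ℝ≥0∞} (hf : Adapted (n + 1) f) :
    ∫⁻ w, f w ∂(G.runMeasure σ π s) =
      ∫⁻ w, ∑ u, G.nextMove σ π (prefixOf n w) u * f (Function.update w (n + 1) u)
        ∂(G.runMeasure σ π s) := by
  let F : History V n × V → ℝ≥0∞ := fun p => f (Function.update (extend p.1) (n + 1) p.2)
  have hF : Measurable F := measurable_of_countable _
  have key : ∀ (w : ℕ → V) (u : V), F (prefixOf n w, u) = f (Function.update w (n + 1) u) := by
    intro w u
    refine hf _ _ fun i hi => ?_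
    rcases Nat.lt_or_ge n i with h | h
    · obtain rfl : i = n + 1 := by omega
      simp
    · rw [Function.update_of_ne (by omega), Function.update_of_ne (by omega),
        extend_prefixOf w h]
  have h1 : ∀ w : ℕ → V, f w = F (prefixOf n w, w (n + 1)) := fun w => by
    rw [key, Function.update_eq_self]
  have h2 := Kernel.partialTraj_compProd_eq_map_traj (X := fun _ => V) (κ := G.stepKernel σ π)
    (Nat.zero_le n)
    (x₀ := fun _ => s)
  have hm : Measurable (fun x : ℕ → V => (prefixOf n x, x (n + 1))) := by
    unfold prefixOf
    fun_prop
  have hp : Measurable (prefixOf (V := V) n) := Preorder.measurable_frestrictLe n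
  calc ∫⁻ w, f w ∂(G.runMeasure σ π s)
      = ∫⁻ w, F (prefixOf n w, w (n + 1)) ∂(G.runMeasure σ π s) := by simp_rw [← h1]
    _ = ∫⁻ p, F p ∂((G.runMeasure σ π s).map (fun x => (prefixOf n x, x (n + 1)))) :=
        (lintegral_map hF hm).symm
    _ = ∫⁻ h, ∫⁻ u, F (h, u) ∂(G.stepKernel σ π n h)
          ∂(Kernel.partialTraj (X := fun _ => V) (G.stepKernel σ π) 0 n (fun _ => s)) := by
        rw [← Measure.lintegral_compProd hF, h2]
        rfl
    _ = ∫⁻ h, ∑ u, G.nextMove σ π h u * F (h, u)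
          ∂(Kernel.partialTraj (X := fun _ => V) (G.stepKernel σ π) 0 n (fun _ => s)) := by
        refine lintegral_congr fun h => ?_
        change ∫⁻ u, F (h, u) ∂((G.nextMove σ π h).toMeasure) = _
        rw [lintegral_fintype]
        refine Finset.sum_congr rfl fun u _ => ?_
        rw [PMF.toMeasure_apply_singleton _ _ (measurableSet_singleton u), mul_comm]
    _ = ∫⁻ w, ∑ u, G.nextMove σ π (prefixOf n w) u * F (prefixOf n w, u)
          ∂(G.runMeasure σ π s) := by
        rw [← Kernel.traj_map_frestrictLe_apply (X := fun _ => V) (κ := G.stepKernel σ π)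
          0 n (fun _ => s)]
        exact lintegral_map (measurable_of_countable _) hp
    _ = _ := by simp_rw [key]

theorem lintegral_zero (G : SSG V) (σ : G.Strategy Owner.max) (π : G.Strategy Owner.min) (s : V)
    {f : (ℕ → V) → ℝ≥0∞} (hf : Adapted 0 f) :
    ∫⁻ w, f w ∂(G.runMeasure σ π s) = f (fun _ => s) := by
  have hp : Measurable (prefixOf (V := V) 0) := Preorder.measurable_frestrictLe 0
  calc ∫⁻ w, f w ∂(G.runMeasure σ π s)
      = ∫⁻ w, f (extend (prefixOf 0 w)) ∂(G.runMeasure σ π s) := by simp_rw [hf.apply_extend]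
    _ = ∫⁻ h, f (extend h)
          ∂(Kernel.partialTraj (X := fun _ => V) (G.stepKernel σ π) 0 0 (fun _ => s)) := by
        rw [← Kernel.traj_map_frestrictLe_apply (X := fun _ => V) (κ := G.stepKernel σ π)
          0 0 (fun _ => s)]
        exact (lintegral_map (f := fun h : History V 0 => f (extend h))
          (measurable_of_countable _) hp).symm
    _ = _ := by
        rw [Kernel.partialTraj_self, Kernel.id_apply,
          lintegral_dirac' _ (measurable_of_countable _)]
        rfl

/-- Only the bound on expectations is needed, so the supermartingale property is required pointwise,
for every history, reachable or not. -/
theorem lintegral_le_of_supermartingale (G : SSG V) (σ : G.Strategy Owner.max)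
    (π : G.Strategy Owner.min) (s : V) {f : ℕ → (ℕ → V) → ℝ≥0∞} (hf : ∀ n, Adapted n (f n))
    (hstep : ∀ n w, ∑ u, G.nextMove σ π (prefixOf n w) u *
      f (n + 1) (Function.update w (n + 1) u) ≤ f n w) (n : ℕ) :
    ∫⁻ w, f n w ∂(G.runMeasure σ π s) ≤ f 0 (fun _ => s) := by
  induction n with
  | zero => rw [G.lintegral_zero σ π s (hf 0)]
  | succ n ih =>
    rw [G.lintegral_succ σ π s (hf (n + 1))]
    exact (lintegral_mono fun w => hstep n w).trans ih

theorem le_lintegral_of_submartingale (G : SSG V) (σ : G.Strategy Owner.max)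
    (π : G.Strategy Owner.min) (s : V) {f : ℕ → (ℕ → V) → ℝ≥0∞} (hf : ∀ n, Adapted n (f n))
    (hstep : ∀ n w, f n w ≤ ∑ u, G.nextMove σ π (prefixOf n w) u *
      f (n + 1) (Function.update w (n + 1) u)) (n : ℕ) :
    f 0 (fun _ => s) ≤ ∫⁻ w, f n w ∂(G.runMeasure σ π s) := by
  induction n with
  | zero => rw [G.lintegral_zero σ π s (hf 0)]
  | succ n ih =>
    rw [G.lintegral_succ σ π s (hf (n + 1))]
    exact ih.trans (lintegral_mono fun w => hstep n w)

end SSG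

end SSGames

namespace SSGames

namespace SSG

variable {V : Type} [Fintype V] [MeasurableSpace V] [DiscreteMeasurableSpace V]

/-! ### Reaching a target -/

theorem measurableSet_visited (t : V) (n : ℕ) : MeasurableSet {w : ℕ → V | ∃ i ≤ n, w i = t} := by
  have : {w : ℕ → V | ∃ i ≤ n, w i = t} = ⋃ i, ⋃ (_ : i ≤ n), (fun w : ℕ → V => w i) ⁻¹' {t} := by
    ext w
    simp
  rw [this]
  exact MeasurableSet.iUnion fun i => MeasurableSet.iUnion fun _ =>
    measurable_pi_apply i (measurableSet_singleton t)

open Classical in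
/-- A process that has the value `1` once `t` was visited. -/
noncomputable def stopped (t : V) (g : ℕ → V → ℝ) (n : ℕ) (w : ℕ → V) : ℝ :=
  if ∃ i ≤ n, w i = t then 1 else g n (w n)

omit [Fintype V] [MeasurableSpace V] [DiscreteMeasurableSpace V] in
theorem adapted_stopped (t : V) (g : ℕ → V → ℝ) (n : ℕ) : Adapted n (stopped t g n) := by
  intro w w' h
  have h1 : (∃ i ≤ n, w i = t) ↔ ∃ i ≤ n, w' i = t :=
    exists_congr fun i => and_congr_right fun hi => by rw [h i hi]
  unfold stopped
  by_cases hv : ∃ i ≤ n, w i = t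
  · rw [if_pos hv, if_pos (h1.1 hv)]
  · rw [if_neg hv, if_neg fun h2 => hv (h1.2 h2), h n le_rfl]

omit [Fintype V] [MeasurableSpace V] [DiscreteMeasurableSpace V] in
theorem stopped_update_of_visited {t : V} (g : ℕ → V → ℝ) {n : ℕ} {w : ℕ → V}
    (h : ∃ i ≤ n, w i = t) (u : V) : stopped t g (n + 1) (Function.update w (n + 1) u) = 1 := by
  obtain ⟨i, hi, hw⟩ := h
  exact if_pos ⟨i, by omega, by rw [Function.update_of_ne (by omega), hw]⟩

omit [Fintype V] [MeasurableSpace V] [DiscreteMeasurableSpace V] in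
open Classical in
theorem stopped_update_of_not_visited {t : V} (g : ℕ → V → ℝ) {n : ℕ} {w : ℕ → V}
    (h : ¬ ∃ i ≤ n, w i = t) (u : V) :
    stopped t g (n + 1) (Function.update w (n + 1) u) = if u = t then 1 else g (n + 1) u := by
  have h1 : (∃ i ≤ n + 1, Function.update w (n + 1) u i = t) ↔ u = t := by
    constructor
    · rintro ⟨i, hi, hw⟩
      rcases Nat.lt_or_ge n i with h2 | h2
      · obtain rfl : i = n + 1 := by omega
        simpa using hw
      · rw [Function.update_of_ne (by omega)] at hw
        exact absurd ⟨i, h2, hw⟩ h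
    · rintro rfl
      exact ⟨n + 1, le_rfl, by simp⟩
  simp only [stopped, h1, Function.update_self]

omit [Fintype V] [MeasurableSpace V] [DiscreteMeasurableSpace V] in
theorem stopped_nonneg {t : V} {g : ℕ → V → ℝ} (hg : ∀ n u, 0 ≤ g n u) (n : ℕ) (w : ℕ → V) :
    0 ≤ stopped t g n w := by
  unfold stopped
  split_ifs
  · exact zero_le_one
  · exact hg _ _

/-- The process `β ^ n * x (w n)`, frozen at `1` once `t` is visited, is a submartingale. Before the
visit it is at most `β ^ n`, so its expectation is at most the probability of reaching `t` plus `β ^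
n`; let `n` tend to infinity. The strict discount excludes strategies that keep `x` high forever
without reaching `t`. -/
theorem le_runMeasure_reach (G : SSG V) (σ : G.Strategy Owner.max) (π : G.Strategy Owner.min)
    (s t : V) {x : V → ℝ} {β : ℝ} (hx0 : ∀ v, 0 ≤ x v) (hx1 : ∀ v, x v ≤ 1) (hβ0 : 0 ≤ β)
    (hβ1 : β < 1)
    (hstep : ∀ n (h : History V n), h.last ≠ t →
      x h.last ≤ β * ∑ u, G.nextProb σ π h u * x u) :
    ENNReal.ofReal (x s) ≤ G.runMeasure σ π s (reach t) := by
  classical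
  let g : ℕ → V → ℝ := fun n v => β ^ n * x v
  have hg : ∀ n u, 0 ≤ g n u := fun n u => mul_nonneg (pow_nonneg hβ0 n) (hx0 u)
  have hg1 : ∀ n u, g n u ≤ 1 := fun n u =>
    mul_le_one₀ (pow_le_one₀ hβ0 hβ1.le) (hx0 u) (hx1 u)
  have hsub := G.le_lintegral_of_submartingale σ π s
    (f := fun n w => ENNReal.ofReal (stopped t g n w))
    (fun n w w' h => by simp only [adapted_stopped t g n w w' h]) (fun n w => by
      rw [G.sum_nextMove_mul_ofReal σ π (prefixOf n w) (fun u => stopped_nonneg hg _ _)]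
      refine ENNReal.ofReal_le_ofReal ?_
      by_cases hv : ∃ i ≤ n, w i = t
      · simp only [stopped_update_of_visited g hv, mul_one, G.sum_nextProb]
        exact (if_pos hv).le
      · simp only [stopped_update_of_not_visited g hv]
        have hwt : (prefixOf n w).last ≠ t := fun h => hv ⟨n, le_rfl, h⟩
        calc stopped t g n w = β ^ n * x (prefixOf n w).last := if_neg hv
          _ ≤ β ^ n * (β * ∑ u, G.nextProb σ π (prefixOf n w) u * x u) :=
            mul_le_mul_of_nonneg_left (hstep n _ hwt) (pow_nonneg hβ0 n)
          _ = ∑ u, G.nextProb σ π (prefixOf n w) u * g (n + 1) u := by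
            simp only [g, Finset.mul_sum]
            exact Finset.sum_congr rfl fun u _ => by ring
          _ ≤ _ := by
            refine Finset.sum_le_sum fun u _ =>
              mul_le_mul_of_nonneg_left ?_ (G.nextProb_nonneg σ π _ u)
            split_ifs
            · exact hg1 _ _
            · exact le_rfl)
  have hbound : ∀ n, ENNReal.ofReal (x s) ≤
      G.runMeasure σ π s (reach t) + ENNReal.ofReal (β ^ n) := by
    intro n
    calc ENNReal.ofReal (x s) ≤ ENNReal.ofReal (stopped t g 0 (fun _ => s)) := by
          refine ENNReal.ofReal_le_ofReal ?_
          unfold stopped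
          split_ifs
          · exact hx1 s
          · simp [g]
      _ ≤ ∫⁻ w, ENNReal.ofReal (stopped t g n w) ∂(G.runMeasure σ π s) := hsub n
      _ ≤ ∫⁻ w, (({w : ℕ → V | ∃ i ≤ n, w i = t}.indicator 1 w) + ENNReal.ofReal (β ^ n))
            ∂(G.runMeasure σ π s) := by
          refine lintegral_mono fun w => ?_
          by_cases hv : ∃ i ≤ n, w i = t
          · simp [stopped, hv]
          · simp only [stopped, hv, if_false]
            refine (ENNReal.ofReal_le_ofReal ?_).trans le_add_self
            exact mul_le_of_le_one_right (pow_nonneg hβ0 n) (hx1 _)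
      _ = G.runMeasure σ π s {w | ∃ i ≤ n, w i = t} + ENNReal.ofReal (β ^ n) := by
          rw [lintegral_add_right _ measurable_const,
            lintegral_indicator_one (measurableSet_visited t n), lintegral_const, measure_univ,
            mul_one]
      _ ≤ _ := by
          gcongr
          rintro w ⟨i, -, hi⟩
          exact ⟨i, hi⟩
  have hlim : Tendsto (fun n : ℕ => G.runMeasure σ π s (reach t) + ENNReal.ofReal (β ^ n)) atTop
      (nhds (G.runMeasure σ π s (reach t) + ENNReal.ofReal 0)) :=
    (ENNReal.tendsto_ofReal (tendsto_pow_atTop_nhds_zero_of_lt_one hβ0 hβ1)).const_add _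
  simpa using ge_of_tendsto' hlim hbound

/-- Here the stopped process `x (w n)` is a supermartingale that dominates the indicator of a visit
up to time `n`; no discount is needed for an upper bound. -/
theorem runMeasure_reach_le (G : SSG V) (σ : G.Strategy Owner.max) (π : G.Strategy Owner.min)
    (s t : V) {x : V → ℝ} (hx0 : ∀ v, 0 ≤ x v) (hxt : 1 ≤ x t)
    (hstep : ∀ n (h : History V n), h.last ≠ t → ∑ u, G.nextProb σ π h u * x u ≤ x h.last) :
    G.runMeasure σ π s (reach t) ≤ ENNReal.ofReal (x s) := by
  classical
  let g : ℕ → V → ℝ := fun _ v => x v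
  have hg : ∀ n u, 0 ≤ g n u := fun n u => hx0 u
  have hsup := G.lintegral_le_of_supermartingale σ π s
    (f := fun n w => ENNReal.ofReal (stopped t g n w))
    (fun n w w' h => by simp only [adapted_stopped t g n w w' h]) (fun n w => by
      rw [G.sum_nextMove_mul_ofReal σ π (prefixOf n w) (fun u => stopped_nonneg hg _ _)]
      refine ENNReal.ofReal_le_ofReal ?_
      by_cases hv : ∃ i ≤ n, w i = t
      · simp only [stopped_update_of_visited g hv, mul_one, G.sum_nextProb]
        exact (if_pos hv).ge
      · simp only [stopped_update_of_not_visited g hv]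
        have hwt : (prefixOf n w).last ≠ t := fun h => hv ⟨n, le_rfl, h⟩
        calc _ ≤ ∑ u, G.nextProb σ π (prefixOf n w) u * x u := by
              refine Finset.sum_le_sum fun u _ =>
                mul_le_mul_of_nonneg_left ?_ (G.nextProb_nonneg σ π _ u)
              split_ifs with hu
              · exact hu ▸ hxt
              · exact le_rfl
          _ ≤ x (prefixOf n w).last := hstep n _ hwt
          _ = stopped t g n w := (if_neg hv).symm)
  have hbound : ∀ n, G.runMeasure σ π s {w | ∃ i ≤ n, w i = t} ≤ ENNReal.ofReal (x s) := by
    intro n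
    calc G.runMeasure σ π s {w | ∃ i ≤ n, w i = t}
        = ∫⁻ w, {w : ℕ → V | ∃ i ≤ n, w i = t}.indicator 1 w ∂(G.runMeasure σ π s) :=
          (lintegral_indicator_one (measurableSet_visited t n)).symm
      _ ≤ ∫⁻ w, ENNReal.ofReal (stopped t g n w) ∂(G.runMeasure σ π s) := by
          refine lintegral_mono fun w => ?_
          by_cases hv : ∃ i ≤ n, w i = t <;> simp [stopped, hv]
      _ ≤ ENNReal.ofReal (stopped t g 0 (fun _ => s)) := hsup n
      _ ≤ _ := by
          refine ENNReal.ofReal_le_ofReal ?_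
          unfold stopped
          split_ifs with h
          · obtain ⟨i, -, rfl⟩ := h
            exact hxt
          · exact le_rfl
  have hU : reach t = ⋃ n : ℕ, {w : ℕ → V | ∃ i ≤ n, w i = t} := by
    ext w
    simp only [reach, Set.mem_ofPred_eq, Set.mem_iUnion]
    exact ⟨fun ⟨i, hi⟩ => ⟨i, i, le_rfl, hi⟩, fun ⟨_, i, _, hi⟩ => ⟨i, hi⟩⟩
  have hmono : Monotone fun n : ℕ => {w : ℕ → V | ∃ i ≤ n, w i = t} :=
    fun m n hmn w ⟨i, hi, hw⟩ => ⟨i, hi.trans hmn, hw⟩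
  rw [hU, hmono.measure_iUnion]
  exact iSup_le hbound

/-! ### Positive drift -/

/-- An exponential moment argument. With `S n` the partial sums of `ρ`, the increments of `S n + φ
(w n)` are bounded and have mean at least `c`, so for small `l` the process `exp (-l * (S n + φ (w
n)) + n * l * c / 2)` is a supermartingale. Multiplied by `q ^ n` its expectations are summable,
hence it tends to `0` almost surely, which bounds `S n` from below linearly. -/
theorem ae_linear_growth (G : SSG V) (σ : G.Strategy Owner.max) (π : G.Strategy Owner.min) (s : V)
    (ρ φ : V → ℝ) {c : ℝ} (hc : 0 < c)
    (hstep : ∀ n (h : History V n),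
      c ≤ ∑ u, G.nextProb σ π h u * (ρ h.last + φ u - φ h.last)) :
    ∀ᵐ w ∂(G.runMeasure σ π s), ∃ a > 0, ∀ᶠ n : ℕ in atTop,
      a * n ≤ ∑ i ∈ Finset.range n, ρ (w i) := by
  obtain ⟨B, hB⟩ : ∃ B : ℝ, ∀ p : V × V, |ρ p.1 + φ p.2 - φ p.1| ≤ B :=
    (Set.finite_range fun p : V × V => |ρ p.1 + φ p.2 - φ p.1|).bddAbove.imp
      fun B h p => h ⟨p, rfl⟩
  obtain ⟨C, hC⟩ : ∃ C : ℝ, ∀ v, φ v ≤ C :=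
    (Set.finite_range φ).bddAbove.imp fun B h p => h ⟨p, rfl⟩
  have hcB : c ≤ B := (hstep 0 fun _ => s).trans
    (G.sum_nextProb_le σ π _ _ B fun u _ => (le_abs_self _).trans (hB (_, u)))
  have hB0 : 0 < B := hc.trans_le hcB
  -- This choice makes the quadratic error `l ^ 2 * B ^ 2` in `exp (-y) ≤ 1 - y + y ^ 2` equal to
  -- half of the linear gain `l * c`.
  set l : ℝ := c / (2 * B ^ 2) with hl
  have hl0 : 0 < l := by positivity
  have hlB : l * B ≤ 1 := by
    rw [hl, div_mul_eq_mul_div, div_le_one (by positivity)]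
    nlinarith
  have hlc : l ^ 2 * B ^ 2 = l * c / 2 := by
    rw [hl]
    field_simp
  let S : ℕ → (ℕ → V) → ℝ := fun n w => ∑ i ∈ Finset.range n, ρ (w i)
  let F : ℕ → (ℕ → V) → ℝ := fun n w => Real.exp (-l * (S n w + φ (w n)) + n * (l * c / 2))
  have hS : ∀ n (w : ℕ → V) u, S (n + 1) (Function.update w (n + 1) u) = S n w + ρ (w n) := by
    intro n w u
    simp only [S]
    rw [Finset.sum_range_succ, Function.update_of_ne (by omega)]
    congr 1
    refine Finset.sum_congr rfl fun i hi => ?_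
    rw [Function.update_of_ne (by have := Finset.mem_range.1 hi; omega)]
  have hF : ∀ n, Adapted n (F n) := by
    intro n w w' h
    have : S n w = S n w' := Finset.sum_congr rfl fun i hi => by
      rw [h i (Finset.mem_range.1 hi).le]
    simp only [F, this, h n le_rfl]
  have hsup := G.lintegral_le_of_supermartingale σ π s (f := fun n w => ENNReal.ofReal (F n w))
    (fun n w w' h => by simp only [hF n w w' h]) (fun n w => by
      rw [G.sum_nextMove_mul_ofReal σ π (prefixOf n w)
        (g := fun u => F (n + 1) (Function.update w (n + 1) u)) (fun u => (Real.exp_pos _).le)]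
      refine ENNReal.ofReal_le_ofReal ?_
      set Y : V → ℝ := fun u => ρ (w n) + φ u - φ (w n) with hY
      have h1 : ∀ u, F (n + 1) (Function.update w (n + 1) u) =
          F n w * (Real.exp (l * c / 2) * Real.exp (-l * Y u)) := by
        intro u
        simp only [F, hS, Function.update_self, ← Real.exp_add, hY]
        congr 1
        push_cast
        ring
      have h2 : ∀ u, Real.exp (-l * Y u) ≤ 1 - l * Y u + l * c / 2 := by
        intro u
        have hYB : |l * Y u| ≤ l * B := by
          rw [abs_mul, abs_of_pos hl0]
          exact mul_le_mul_of_nonneg_left (hB (w n, u)) hl0.le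
        have h3 := Real.abs_exp_sub_one_sub_id_le (x := -l * Y u) (by
          rw [neg_mul, abs_neg]
          exact hYB.trans hlB)
        have h4 := (abs_le.1 h3).2
        have h5 : (-l * Y u) ^ 2 ≤ l ^ 2 * B ^ 2 := by
          rw [← sq_abs, neg_mul, abs_neg, ← mul_pow]
          exact pow_le_pow_left₀ (abs_nonneg _) hYB 2
        linarith
      have h6 : ∑ u, G.nextProb σ π (prefixOf n w) u * Real.exp (-l * Y u) ≤
          Real.exp (-(l * c / 2)) := by
        calc _ ≤ ∑ u, G.nextProb σ π (prefixOf n w) u * (1 - l * Y u + l * c / 2) :=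
              Finset.sum_le_sum fun u _ =>
                mul_le_mul_of_nonneg_left (h2 u) (G.nextProb_nonneg σ π _ u)
          _ = (1 + l * c / 2) * ∑ u, G.nextProb σ π (prefixOf n w) u -
                l * ∑ u, G.nextProb σ π (prefixOf n w) u * Y u := by
              simp only [Finset.mul_sum, ← Finset.sum_sub_distrib]
              exact Finset.sum_congr rfl fun u _ => by ring
          _ ≤ (1 + l * c / 2) - l * c := by
              rw [G.sum_nextProb, mul_one]
              exact sub_le_sub_left (mul_le_mul_of_nonneg_left (hstep n (prefixOf n w)) hl0.le) _
          _ ≤ _ := by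
              have := Real.add_one_le_exp (-(l * c / 2))
              linarith
      calc _ = F n w * (Real.exp (l * c / 2) *
            ∑ u, G.nextProb σ π (prefixOf n w) u * Real.exp (-l * Y u)) := by
            simp only [h1, Finset.mul_sum]
            exact Finset.sum_congr rfl fun u _ => by ring
        _ ≤ F n w * (Real.exp (l * c / 2) * Real.exp (-(l * c / 2))) := by
            have := (Real.exp_pos (-l * (S n w + φ (w n)) + n * (l * c / 2))).le
            have := (Real.exp_pos (l * c / 2)).le
            gcongr
        _ = F n w := by rw [← Real.exp_add]; simp)
  -- Half of the available rate `l * c / 2` is given up to obtain a convergent geometric series.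
  set q : ℝ := Real.exp (-(l * c / 4)) with hq
  have hq0 : 0 < q := Real.exp_pos _
  have hq1 : q < 1 := Real.exp_lt_one_iff.2 (by have := mul_pos hl0 hc; linarith)
  let D : ℕ → (ℕ → V) → ℝ≥0∞ := fun n w => ENNReal.ofReal q ^ n * ENNReal.ofReal (F n w)
  have hD : ∀ n, Measurable (D n) := fun n =>
    Adapted.measurable (n := n) fun w w' h => by simp only [D, hF n w w' h]
  have hint : ∫⁻ w, ∑' n, D n w ∂(G.runMeasure σ π s) ≠ ⊤ := by
    rw [lintegral_tsum fun n => (hD n).aemeasurable]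
    refine ne_top_of_le_ne_top ?_ (ENNReal.tsum_le_tsum (g := fun n =>
      ENNReal.ofReal q ^ n * ENNReal.ofReal (F 0 fun _ => s)) fun n => ?_)
    · rw [ENNReal.tsum_mul_right, ENNReal.tsum_geometric]
      refine ENNReal.mul_ne_top (ENNReal.inv_ne_top.2 ?_) ENNReal.ofReal_ne_top
      rw [Ne, tsub_eq_zero_iff_le, not_le]
      exact ENNReal.ofReal_lt_one.2 hq1
    · simp only [D]
      rw [lintegral_const_mul' _ _ (ENNReal.pow_ne_top ENNReal.ofReal_ne_top)]
      exact mul_le_mul_right (hsup n) _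
  filter_upwards [ae_lt_top (Measurable.tsum hD) hint] with w hw
  have h0 := (ENNReal.tendsto_atTop_zero_of_tsum_ne_top hw.ne).eventually
    (eventually_lt_nhds (show (0 : ℝ≥0∞) < 1 from zero_lt_one))
  -- A term less than `1` means `c / 4 * n < S n + φ (w n)`. From `n ≥ 8 * C / c` on, `φ ≤ C ≤ c / 8
  -- * n`, which leaves `c / 8 * n` for the sum.
  refine ⟨c / 8, by positivity, ?_⟩
  obtain ⟨N, hN⟩ := exists_nat_ge (8 * C / c)
  filter_upwards [h0, eventually_ge_atTop N] with n hn hnN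
  have hn' : q ^ n * F n w < 1 := by
    rw [← ENNReal.ofReal_lt_one, ENNReal.ofReal_mul (by positivity),
      ENNReal.ofReal_pow hq0.le]
    exact hn
  have h7 : q ^ n * F n w = Real.exp (l * (c / 4 * n - (S n w + φ (w n)))) := by
    simp only [hq, F]
    rw [← Real.exp_nat_mul, ← Real.exp_add]
    congr 1
    ring
  rw [h7, Real.exp_lt_one_iff] at hn'
  have h8 : c / 4 * n - (S n w + φ (w n)) < 0 := by
    by_contra hcon
    exact absurd hn' (not_lt.2 (mul_nonneg hl0.le (not_lt.1 hcon)))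
  have h9 : 8 * C ≤ n * c := by
    rw [← div_le_iff₀ hc]
    exact hN.trans (by exact_mod_cast hnN)
  have h10 := hC (w n)
  change c / 8 * n ≤ S n w
  linarith

end SSG

end SSGames

namespace SSGames

namespace SSG

variable {V : Type} [Fintype V]

/-! ### Discounted reachability values -/

/-- The optimal expectation of `x` after one move. -/
noncomputable def bellman (G : SSG V) (x : V → ℝ) (v : V) : ℝ :=
  match G.owner v with
  | Owner.max => (G.succ v).sup' (G.succ_nonempty v) x
  | Owner.min => (G.succ v).inf' (G.succ_nonempty v) x
  | Owner.random => ∑ u, (G.prob v u : ℝ) * x u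

section bellman

variable (G : SSG V) (x : V → ℝ) {v : V}

theorem bellman_of_max (hv : G.owner v = Owner.max) :
    G.bellman x v = (G.succ v).sup' (G.succ_nonempty v) x := by
  unfold bellman
  split <;> simp_all

theorem bellman_of_min (hv : G.owner v = Owner.min) :
    G.bellman x v = (G.succ v).inf' (G.succ_nonempty v) x := by
  unfold bellman
  split <;> simp_all

theorem bellman_of_random (hv : G.owner v = Owner.random) :
    G.bellman x v = ∑ u, (G.prob v u : ℝ) * x u := by
  unfold bellman
  split <;> simp_all

theorem sum_prob_real (hv : G.owner v = Owner.random) : ∑ u, (G.prob v u : ℝ) = 1 := by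
  rw [← NNRat.cast_sum, G.prob_sum v hv, NNRat.cast_one]

/-- Monotonicity and compatibility with constants in one inequality; bounds, nonexpansiveness in the
supremum norm and continuity of `bellman` follow from it. -/
theorem bellman_le_bellman_add {x y : V → ℝ} {d : ℝ} (h : ∀ u, x u ≤ y u + d) (v : V) :
    G.bellman x v ≤ G.bellman y v + d := by
  rcases hv : G.owner v with _ | _ | _
  · rw [G.bellman_of_max x hv, G.bellman_of_max y hv]
    refine Finset.sup'_le _ _ fun u hu => (h u).trans ?_
    gcongr
    exact Finset.le_sup' y hu
  · rw [G.bellman_of_min x hv, G.bellman_of_min y hv, ← sub_le_iff_le_add]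
    refine Finset.le_inf' _ _ fun u hu => ?_
    rw [sub_le_iff_le_add]
    exact (Finset.inf'_le x hu).trans (h u)
  · rw [G.bellman_of_random x hv, G.bellman_of_random y hv]
    calc ∑ u, (G.prob v u : ℝ) * x u ≤ ∑ u, (G.prob v u : ℝ) * (y u + d) := by
          gcongr with u
          exact h u
      _ = _ := by
          simp only [mul_add, Finset.sum_add_distrib, ← Finset.sum_mul, G.sum_prob_real hv, one_mul]

theorem bellman_const (a : ℝ) (v : V) : G.bellman (fun _ => a) v = a := by
  rcases hv : G.owner v with _ | _ | _
  · rw [G.bellman_of_max _ hv, Finset.sup'_const]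
  · rw [G.bellman_of_min _ hv, Finset.inf'_const]
  · rw [G.bellman_of_random _ hv, ← Finset.sum_mul, G.sum_prob_real hv, one_mul]

theorem bellman_le {x : V → ℝ} {a : ℝ} (h : ∀ u, x u ≤ a) (v : V) : G.bellman x v ≤ a := by
  have := G.bellman_le_bellman_add (x := x) (y := fun _ => a) (d := 0) (by simpa using h) v
  simpa [bellman_const] using this

theorem le_bellman {x : V → ℝ} {a : ℝ} (h : ∀ u, a ≤ x u) (v : V) : a ≤ G.bellman x v := by
  have := G.bellman_le_bellman_add (x := fun _ => a) (y := x) (d := 0) (by simpa using h) v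
  simpa [bellman_const] using this

theorem abs_bellman_sub_le {x y : V → ℝ} {d : ℝ} (h : ∀ u, |x u - y u| ≤ d) (v : V) :
    |G.bellman x v - G.bellman y v| ≤ d := by
  rw [abs_sub_le_iff]
  constructor
  · rw [sub_le_iff_le_add']
    exact G.bellman_le_bellman_add (fun u => by have := (abs_sub_le_iff.1 (h u)).1; linarith) v
  · rw [sub_le_iff_le_add']
    exact G.bellman_le_bellman_add (fun u => by have := (abs_sub_le_iff.1 (h u)).2; linarith) v

theorem continuous_bellman (v : V) : Continuous fun x => G.bellman x v := by
  refine LipschitzWith.continuous (K := 1) (LipschitzWith.of_dist_le_mul fun x y => ?_)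
  rw [NNReal.coe_one, one_mul, Real.dist_eq]
  exact G.abs_bellman_sub_le (fun u => by rw [← Real.dist_eq]; exact dist_le_pi_dist x y u) v

/-- A choice of optimal moves with respect to `x`. -/
theorem exists_selection : ∃ c : V → V, (∀ v, c v ∈ G.succ v) ∧
    ∀ v, G.owner v ≠ Owner.random → G.bellman x v = x (c v) := by
  have : ∀ v, ∃ u ∈ G.succ v, G.owner v ≠ Owner.random → G.bellman x v = x u := by
    intro v
    rcases hv : G.owner v with _ | _ | _
    · obtain ⟨u, hu, h⟩ := Finset.exists_mem_eq_sup' (G.succ_nonempty v) x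
      exact ⟨u, hu, fun _ => (G.bellman_of_max x hv).trans h⟩
    · obtain ⟨u, hu, h⟩ := Finset.exists_mem_eq_inf' (G.succ_nonempty v) x
      exact ⟨u, hu, fun _ => (G.bellman_of_min x hv).trans h⟩
    · obtain ⟨u, hu⟩ := G.succ_nonempty v
      exact ⟨u, hu, fun h => absurd rfl h⟩
  choose c hc hc' using this
  exact ⟨c, hc, hc'⟩

theorem bellman_le_sum_nextProb {c : V → V} (hc : ∀ v, c v ∈ G.succ v)
    (hcx : ∀ v, G.owner v ≠ Owner.random → G.bellman x v = x (c v)) (π : G.Strategy Owner.min)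
    {n : ℕ} (h : History V n) :
    G.bellman x h.last ≤ ∑ u, G.nextProb (G.positional Owner.max c hc) π h u * x u := by
  rcases hv : G.owner h.last with _ | _ | _
  · rw [G.sum_nextProb_positional_max π h x c hc hv, hcx _ (by simp [hv])]
  · rw [G.bellman_of_min x hv]
    exact G.le_sum_nextProb _ _ h x _ fun u hu => Finset.inf'_le x hu
  · rw [G.bellman_of_random x hv, G.sum_nextProb_random _ _ h x hv]

theorem sum_nextProb_le_bellman {c : V → V} (hc : ∀ v, c v ∈ G.succ v)
    (hcx : ∀ v, G.owner v ≠ Owner.random → G.bellman x v = x (c v)) (σ : G.Strategy Owner.max)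
    {n : ℕ} (h : History V n) :
    ∑ u, G.nextProb σ (G.positional Owner.min c hc) h u * x u ≤ G.bellman x h.last := by
  rcases hv : G.owner h.last with _ | _ | _
  · rw [G.bellman_of_max x hv]
    exact G.sum_nextProb_le _ _ h x _ fun u hu => Finset.le_sup' x hu
  · rw [G.sum_nextProb_positional_min σ h x c hc hv, hcx _ (by simp [hv])]
  · rw [G.bellman_of_random x hv, G.sum_nextProb_random _ _ h x hv]

end bellman

variable [DecidableEq V]

/-- `x` is the vector of the values of reaching `t` when the game is stopped with
probability `1 - β` before each visit of a vertex. -/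
def IsDiscountedValue (G : SSG V) (t : V) (β : ℝ) (x : V → ℝ) : Prop :=
  ∀ v, x v = β * (if v = t then 1 else G.bellman x v)

theorem exists_isDiscountedValue (G : SSG V) (t : V) {β : ℝ} (h0 : 0 ≤ β) (h1 : β < 1) :
    ∃ x, G.IsDiscountedValue t β x := by
  let f : (V → ℝ) → V → ℝ := fun x v => β * (if v = t then 1 else G.bellman x v)
  have hf : ContractingWith ⟨β, h0⟩ f := by
    refine ⟨h1, LipschitzWith.of_dist_le_mul fun x y => ?_⟩
    have hd : 0 ≤ β * dist x y := mul_nonneg h0 dist_nonneg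
    refine (dist_pi_le_iff hd).2 fun v => ?_
    rw [Real.dist_eq, ← mul_sub, abs_mul, abs_of_nonneg h0]
    refine mul_le_mul_of_nonneg_left ?_ h0
    split_ifs
    · simp
    · exact G.abs_bellman_sub_le (fun u => by rw [← Real.dist_eq]; exact dist_le_pi_dist x y u) v
  exact ⟨hf.fixedPoint, fun v => (congrFun hf.fixedPoint_isFixedPt v).symm⟩

/-- At a vertex where `x` is minimal, a negative value would be strictly raised by the factor `β`.
-/
theorem IsDiscountedValue.nonneg {G : SSG V} {t : V} {β : ℝ} (h0 : 0 ≤ β) (h1 : β < 1)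
    {x : V → ℝ} (hx : G.IsDiscountedValue t β x) (v : V) : 0 ≤ x v := by
  have : Nonempty V := ⟨v⟩
  obtain ⟨m, hm⟩ := Finite.exists_min x
  refine le_trans ?_ (hm v)
  by_contra hneg
  have h2 : x m ≤ if m = t then 1 else G.bellman x m := by
    split_ifs
    · linarith
    · exact G.le_bellman hm m
  have h3 := mul_le_mul_of_nonneg_left h2 h0
  rw [← hx m] at h3
  nlinarith

theorem IsDiscountedValue.le_one {G : SSG V} {t : V} {β : ℝ} (h0 : 0 ≤ β) (h1 : β < 1)
    {x : V → ℝ} (hx : G.IsDiscountedValue t β x) (v : V) : x v ≤ 1 := by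
  have : Nonempty V := ⟨v⟩
  obtain ⟨m, hm⟩ := Finite.exists_max x
  refine le_trans (hm v) ?_
  by_contra hgt
  have h2 : (if m = t then 1 else G.bellman x m) ≤ x m := by
    split_ifs
    · linarith
    · exact G.bellman_le hm m
  have h3 := mul_le_mul_of_nonneg_left h2 h0
  rw [← hx m] at h3
  nlinarith

/-- At a vertex `m` of largest deviation the two equations give `|x m - y m| ≤ β * |x m - y m| + |β
- γ|`, because `bellman` is nonexpansive. This provides uniqueness and continuity in the discount
factor. -/
theorem IsDiscountedValue.abs_sub_le {G : SSG V} {t : V} {β γ : ℝ} (hβ0 : 0 ≤ β) (hβ1 : β < 1)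
    (hγ0 : 0 ≤ γ) (hγ1 : γ < 1) {x y : V → ℝ} (hx : G.IsDiscountedValue t β x)
    (hy : G.IsDiscountedValue t γ y) (v : V) : |x v - y v| ≤ |β - γ| / (1 - β) := by
  have : Nonempty V := ⟨v⟩
  obtain ⟨m, hm⟩ := Finite.exists_max fun v => |x v - y v|
  refine le_trans (hm v) ?_
  set z : ℝ := if m = t then 1 else G.bellman y m with hz
  have hz1 : |z| ≤ 1 := by
    rw [hz, abs_le]
    split_ifs
    · norm_num
    · exact ⟨by linarith [G.le_bellman (fun u => hy.nonneg hγ0 hγ1 u) m],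
        G.bellman_le (fun u => hy.le_one hγ0 hγ1 u) m⟩
  have h1 : |(if m = t then 1 else G.bellman x m) - z| ≤ |x m - y m| := by
    rw [hz]
    split_ifs
    · simp
    · exact G.abs_bellman_sub_le hm m
  have h2 : x m - y m = β * ((if m = t then 1 else G.bellman x m) - z) + (β - γ) * z := by
    rw [hx m, hy m]
    ring
  have h3 : |x m - y m| ≤ β * |x m - y m| + |β - γ| := by
    calc |x m - y m| ≤ |β * ((if m = t then 1 else G.bellman x m) - z)| + |(β - γ) * z| := by
          rw [h2]
          exact abs_add_le _ _
      _ ≤ _ := by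
          rw [abs_mul, abs_mul, abs_of_nonneg hβ0]
          exact add_le_add (mul_le_mul_of_nonneg_left h1 hβ0)
            (mul_le_of_le_one_right (abs_nonneg _) hz1)
  rw [le_div_iff₀ (by linarith)]
  linarith

/-- The vector of discounted reachability values. -/
noncomputable def discountedValue (G : SSG V) (t : V) (β : ℝ) : V → ℝ :=
  if h : 0 ≤ β ∧ β < 1 then (G.exists_isDiscountedValue t h.1 h.2).choose else 0

theorem isDiscountedValue (G : SSG V) (t : V) {β : ℝ} (h0 : 0 ≤ β) (h1 : β < 1) :
    G.IsDiscountedValue t β (G.discountedValue t β) := by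
  rw [discountedValue, dif_pos ⟨h0, h1⟩]
  exact (G.exists_isDiscountedValue t h0 h1).choose_spec

theorem continuousAt_discountedValue (G : SSG V) (t v : V) {β : ℝ} (h0 : 0 < β) (h1 : β < 1) :
    ContinuousAt (fun γ => G.discountedValue t γ v) β := by
  rw [ContinuousAt, tendsto_iff_dist_tendsto_zero]
  have hlim : Tendsto (fun γ : ℝ => |β - γ| / (1 - β)) (nhds β) (nhds 0) := by
    have : Continuous fun γ : ℝ => |β - γ| / (1 - β) := by fun_prop
    simpa using this.tendsto β
  refine squeeze_zero' (Eventually.of_forall fun _ => dist_nonneg) ?_ hlim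
  filter_upwards [Ioo_mem_nhds h0 h1] with γ hγ
  rw [dist_comm, Real.dist_eq]
  exact (G.isDiscountedValue t h0.le h1).abs_sub_le h0.le h1 hγ.1.le hγ.2
    (G.isDiscountedValue t hγ.1.le hγ.2) v

variable [MeasurableSpace V] [DiscreteMeasurableSpace V]

/-- Max moves optimally with respect to the discounted values; stopping can only hurt Max. -/
theorem discountedValue_le_value (G : SSG V) (s t : V) {β : ℝ} (h0 : 0 ≤ β) (h1 : β < 1) :
    ENNReal.ofReal (G.discountedValue t β s) ≤ G.value (reach t) s := by
  have hx := G.isDiscountedValue t h0 h1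
  obtain ⟨c, hc, hcx⟩ := G.exists_selection (G.discountedValue t β)
  refine le_iSup_of_le (G.positional Owner.max c hc) (le_iInf fun π => ?_)
  refine G.le_runMeasure_reach _ π s t (hx.nonneg h0 h1) (hx.le_one h0 h1) h0 h1 fun n h ht => ?_
  rw [hx h.last, if_neg ht]
  exact mul_le_mul_of_nonneg_left (G.bellman_le_sum_nextProb _ hc hcx π h) h0

-- Min moves optimally with respect to `y`, which makes `y (w n)` a supermartingale before `t` is
-- reached. Thus any nonnegative fixed point is an upper bound, and it need not be identified as the
-- least one.
omit [DecidableEq V] in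
theorem value_le_of_fixedPoint (G : SSG V) (s t : V) {y : V → ℝ} (hy0 : ∀ v, 0 ≤ y v)
    (hyt : 1 ≤ y t) (hy : ∀ v, v ≠ t → y v = G.bellman y v) :
    G.value (reach t) s ≤ ENNReal.ofReal (y s) := by
  obtain ⟨c, hc, hcx⟩ := G.exists_selection y
  refine iSup_le fun σ => iInf_le_of_le (G.positional Owner.min c hc) ?_
  refine G.runMeasure_reach_le σ _ s t hy0 hyt fun n h ht => ?_
  rw [hy h.last ht]
  exact G.sum_nextProb_le_bellman _ hc hcx σ h

/-- Along any sequence of discount factors that tends to `1`, a subsequence of the discounted values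
has a limit that is at least the value of the game. -/
theorem exists_subseq_discountedValue (G : SSG V) (s t : V) {β : ℕ → ℝ} (h0 : ∀ k, 0 ≤ β k)
    (h1 : ∀ k, β k < 1) (hβ : Tendsto β atTop (nhds 1)) :
    ∃ φ : ℕ → ℕ, StrictMono φ ∧ ∃ a : ℝ, G.value (reach t) s ≤ ENNReal.ofReal a ∧
      Tendsto (fun k => G.discountedValue t (β (φ k)) s) atTop (nhds a) := by
  have hx := fun k => G.isDiscountedValue t (h0 k) (h1 k)
  have hK : IsCompact (Set.pi Set.univ fun _ : V => Set.Icc (0 : ℝ) 1) :=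
    isCompact_univ_pi fun _ => isCompact_Icc
  obtain ⟨y, hyK, φ, hφ, hy⟩ := hK.tendsto_subseq (x := fun k => G.discountedValue t (β k))
    fun k v _ => ⟨(hx k).nonneg (h0 k) (h1 k) v, (hx k).le_one (h0 k) (h1 k) v⟩
  have hyv : ∀ v, Tendsto (fun k => G.discountedValue t (β (φ k)) v) atTop (nhds (y v)) :=
    fun v => tendsto_pi_nhds.1 hy v
  have hβφ : Tendsto (fun k => β (φ k)) atTop (nhds 1) := hβ.comp hφ.tendsto_atTop
  -- As the discount factors tend to `1`, the limit vector `y` satisfies the undiscounted equations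
  -- and `y t = 1`, so `y s` bounds the value from above.
  refine ⟨φ, hφ, y s, G.value_le_of_fixedPoint s t (fun v => (hyK v trivial).1) ?_ ?_, hyv s⟩
  · refine (tendsto_nhds_unique (hyv t) ?_).ge
    simp_rw [fun k => hx k t, if_true, mul_one]
    exact hβφ
  · intro v hv
    refine tendsto_nhds_unique (hyv v) ?_
    simp_rw [fun k => hx k v, if_neg hv]
    simpa using hβφ.mul (((G.continuous_bellman v).tendsto y).comp hy)

end SSG

end SSGames

namespace SSGames

/-! ### Integer polynomials of bounded length -/

open Polynomial in
/-- The sum of the absolute values of the coefficients is at most `H`. -/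
def LengthLe (p : ℤ[X]) (H : ℕ) : Prop :=
  -- A dominating polynomial `q` instead of the sum itself: since `q ↦ q.eval 1` is a ring
  -- homomorphism, the bounds for sums and products need no manipulation of coefficients.
  ∃ q : ℕ[X], (∀ i, |p.coeff i| ≤ q.coeff i) ∧ q.eval 1 ≤ H

namespace LengthLe

open Polynomial

variable {p p' : ℤ[X]} {H H' : ℕ}

theorem mono (h : LengthLe p H) (hH : H ≤ H') : LengthLe p H' :=
  let ⟨q, h1, h2⟩ := h
  ⟨q, h1, h2.trans hH⟩

theorem add (h : LengthLe p H) (h' : LengthLe p' H') : LengthLe (p + p') (H + H') := by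
  obtain ⟨q, h1, h2⟩ := h
  obtain ⟨q', h1', h2'⟩ := h'
  refine ⟨q + q', fun i => ?_, by rw [eval_add]; exact add_le_add h2 h2'⟩
  rw [coeff_add, coeff_add, Nat.cast_add]
  exact (abs_add_le _ _).trans (add_le_add (h1 i) (h1' i))

theorem neg (h : LengthLe p H) : LengthLe (-p) H := by
  obtain ⟨q, h1, h2⟩ := h
  exact ⟨q, fun i => by rw [coeff_neg, abs_neg]; exact h1 i, h2⟩

theorem sub (h : LengthLe p H) (h' : LengthLe p' H') : LengthLe (p - p') (H + H') := by
  rw [sub_eq_add_neg]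
  exact h.add h'.neg

theorem mul (h : LengthLe p H) (h' : LengthLe p' H') : LengthLe (p * p') (H * H') := by
  obtain ⟨q, h1, h2⟩ := h
  obtain ⟨q', h1', h2'⟩ := h'
  refine ⟨q * q', fun i => ?_, by rw [eval_mul]; exact Nat.mul_le_mul h2 h2'⟩
  rw [coeff_mul, coeff_mul, Nat.cast_sum]
  refine (Finset.abs_sum_le_sum_abs _ _).trans (Finset.sum_le_sum fun j _ => ?_)
  rw [abs_mul, Nat.cast_mul]
  exact mul_le_mul (h1 _) (h1' _) (abs_nonneg _) (Int.natCast_nonneg _)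

theorem C (a : ℤ) : LengthLe (C a) a.natAbs := by
  refine ⟨Polynomial.C a.natAbs, fun i => ?_, by rw [eval_C]⟩
  rw [coeff_C, coeff_C]
  split_ifs <;> simp

theorem zero : LengthLe 0 0 := ⟨0, by simp, by simp⟩

theorem one : LengthLe 1 1 := by simpa using C 1

theorem X : LengthLe X 1 := by
  refine ⟨Polynomial.X, fun i => ?_, by rw [eval_X]⟩
  rw [coeff_X, coeff_X]
  split_ifs <;> simp

theorem expand (h : LengthLe p H) : LengthLe (expand ℤ 2 p) H := by
  obtain ⟨q, h1, h2⟩ := h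
  refine ⟨Polynomial.expand ℕ 2 q, fun i => ?_, by rw [expand_eval]; simpa using h2⟩
  rw [coeff_expand two_pos, coeff_expand two_pos]
  split_ifs
  · exact h1 _
  · simp

theorem sum {ι : Type*} (s : Finset ι) {p : ι → ℤ[X]} {H : ι → ℕ}
    (h : ∀ i, LengthLe (p i) (H i)) : LengthLe (∑ i ∈ s, p i) (∑ i ∈ s, H i) := by
  classical
  induction s using Finset.induction_on with
  | empty => exact zero
  | insert i s hi ih =>
    rw [Finset.sum_insert hi, Finset.sum_insert hi]
    exact (h i).add ih

theorem prod {ι : Type*} (s : Finset ι) {p : ι → ℤ[X]} {H : ι → ℕ}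
    (h : ∀ i, LengthLe (p i) (H i)) : LengthLe (∏ i ∈ s, p i) (∏ i ∈ s, H i) := by
  classical
  induction s using Finset.induction_on with
  | empty => exact one
  | insert i s hi ih =>
    rw [Finset.prod_insert hi, Finset.prod_insert hi]
    exact (h i).mul ih

/-- Expand the determinant over permutations, enlarge the sum of the bounds to all functions `ι →
ι`, and factor it into the product of the row sums. -/
theorem det {ι : Type*} [Fintype ι] [DecidableEq ι] {M : Matrix ι ι ℤ[X]} {H : ι → ι → ℕ}
    (h : ∀ i j, LengthLe (M i j) (H i j)) : LengthLe M.det (∏ i, ∑ j, H i j) := by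
  have h1 : LengthLe M.det (∑ τ : Equiv.Perm ι, ∏ i, H i (τ i)) := by
    rw [← Matrix.det_transpose, Matrix.det_apply]
    refine sum _ fun τ => ?_
    have h2 := prod Finset.univ fun i => h i (τ i)
    rcases Int.units_eq_one_or (Equiv.Perm.sign τ) with h3 | h3 <;> rw [h3]
    · simpa using h2
    · simpa using h2.neg
  refine h1.mono ?_
  rw [Finset.prod_univ_sum, Fintype.piFinset_univ,
    ← Finset.sum_image (s := Finset.univ) (g := fun τ : Equiv.Perm ι => (τ : ι → ι))
      (f := fun τ => ∏ i, H i (τ i)) (fun _ _ _ _ h => DFunLike.coe_injective h)]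
  exact Finset.sum_le_sum_of_subset (Finset.subset_univ _)

theorem divX (h : LengthLe p H) : LengthLe p.divX H := by
  obtain ⟨q, h1, h2⟩ := h
  refine ⟨q.divX, fun i => by rw [coeff_divX, coeff_divX]; exact h1 _, le_trans ?_ h2⟩
  conv_rhs => rw [← Polynomial.divX_mul_X_add q]
  simp

theorem abs_aeval_le (h : LengthLe p H) {x : ℝ} (h0 : 0 ≤ x) (h1 : x ≤ 1) :
    |aeval x p| ≤ H := by
  obtain ⟨q, hq, hH⟩ := h
  set m := max p.natDegree q.natDegree + 1
  rw [aeval_eq_sum_range' (n := m) (by omega)]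
  rw [eval_eq_sum_range' (n := m) (by omega)] at hH
  calc |∑ i ∈ Finset.range m, p.coeff i • x ^ i| ≤ ∑ i ∈ Finset.range m, (q.coeff i : ℝ) := by
        refine (Finset.abs_sum_le_sum_abs _ _).trans (Finset.sum_le_sum fun i _ => ?_)
        rw [zsmul_eq_mul, abs_mul, abs_of_nonneg (pow_nonneg h0 i)]
        refine (mul_le_of_le_one_right (abs_nonneg _) (pow_le_one₀ h0 h1)).trans ?_
        exact_mod_cast hq i
    _ ≤ H := by
        simp only [one_pow, mul_one] at hH
        exact_mod_cast hH

/-- After division by a power of `X` the constant coefficient is a nonzero integer, so of absolute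
value at least `1`, while the remaining terms contribute at most `x * H < 1`. -/
theorem aeval_ne_zero {x : ℝ} (h0 : 0 < x) (h1 : x ≤ 1) (hx : x * H < 1) (h : LengthLe p H)
    (hp : p ≠ 0) : aeval x p ≠ 0 := by
  induction hn : p.natDegree using Nat.strong_induction_on generalizing p with
  | _ n ih =>
    have hdiv := congrArg (aeval x) (Polynomial.divX_mul_X_add p)
    simp only [map_add, map_mul, aeval_X, aeval_C] at hdiv
    rw [← hdiv]
    by_cases hc : p.coeff 0 = 0
    · rw [hc, map_zero, add_zero]
      have hne : p.divX ≠ 0 := by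
        intro h2
        have := Polynomial.divX_mul_X_add p
        rw [h2, hc] at this
        exact hp (by simpa using this.symm)
      refine mul_ne_zero (ih _ ?_ h.divX hne rfl) h0.ne'
      rw [natDegree_divX_eq_natDegree_tsub_one, ← hn]
      have : p.natDegree ≠ 0 := by
        intro h2
        rw [eq_C_of_natDegree_eq_zero h2, hc] at hp
        simp at hp
      omega
    · intro h2
      have h3 : (1 : ℝ) ≤ |((p.coeff 0 : ℤ) : ℝ)| := by
        exact_mod_cast Int.one_le_abs hc
      have h4 := h.divX.abs_aeval_le h0.le h1
      have h5 : ((p.coeff 0 : ℤ) : ℝ) = -(aeval x p.divX * x) := by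
        rw [eq_neg_iff_add_eq_zero, add_comm]
        simpa using h2
      rw [h5, abs_neg, abs_mul, abs_of_pos h0] at h3
      nlinarith

end LengthLe

/-! ### Quotients of polynomials near zero -/

open Polynomial in
theorem exists_eq_X_pow_mul {p : ℝ[X]} (hp : p ≠ 0) :
    ∃ (m : ℕ) (q : ℝ[X]), p = X ^ m * q ∧ q.eval 0 ≠ 0 := by
  obtain ⟨q, h1, h2⟩ := exists_eq_pow_rootMultiplicity_mul_and_not_dvd p hp 0
  refine ⟨_, q, by simpa using h1, fun h => h2 ?_⟩
  rw [dvd_iff_isRoot]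
  exact h

open Polynomial in
/-- If the limit of `x = N(ε²) / D(ε²)` is at least `1/2`, then `x` is not smaller than `1/2` by
more than a multiple of `ε`. -/
theorem not_forall_lt_of_tendsto {N D : ℝ[X]} (hD : D ≠ 0) {e x : ℕ → ℝ} (he0 : ∀ k, 0 < e k)
    (he : Tendsto e atTop (nhds 0)) {a : ℝ} (ha : 1 / 2 ≤ a) (hx : Tendsto x atTop (nhds a))
    (hND : ∀ k, D.eval (e k ^ 2) * x k = N.eval (e k ^ 2)) :
    ¬ ∀ k, 2 * x k - 1 < - e k := by
  intro hlt
  -- All `x k` are below `1/2`, so the limit is exactly `1/2` and `2 * x k - 1` tends to `0`.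
  have ha' : a = 1 / 2 := by
    refine le_antisymm (le_of_tendsto' hx fun k => ?_) ha
    linarith [hlt k, he0 k]
  have hx0 : Tendsto (fun k => 2 * x k - 1) atTop (nhds 0) := by
    have := (hx.const_mul 2).sub_const 1
    rw [ha'] at this
    simpa using this
  have he2 : Tendsto (fun k => e k ^ 2) atTop (nhds 0) := by simpa using he.pow 2
  have hq : ∀ q : ℝ[X], Tendsto (fun k => q.eval (e k ^ 2)) atTop (nhds (q.eval 0)) :=
    fun q => (q.continuous.tendsto 0).comp he2
  obtain ⟨b, d, hDd, hd⟩ := exists_eq_X_pow_mul hD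
  set E : ℝ[X] := 2 * N - D with hE
  have hED : ∀ k, E.eval (e k ^ 2) = (e k ^ 2) ^ b * (d.eval (e k ^ 2) * (2 * x k - 1)) := by
    intro k
    have h1 : E.eval (e k ^ 2) = D.eval (e k ^ 2) * (2 * x k - 1) := by
      rw [hE, eval_sub, eval_mul, ← hND k]
      simp
      ring
    rw [h1]
    nth_rw 1 [hDd]
    simp
    ring
  -- `E / D` takes the values `2 * x k - 1`, which tend to `0`, so `E` vanishes at `0` to a higher
  -- order than `D`.
  have hdvd : X ^ (b + 1) ∣ E := by
    by_cases hE0 : E = 0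
    · rw [hE0]
      exact dvd_zero _
    obtain ⟨m, r, hEr, hr⟩ := exists_eq_X_pow_mul hE0
    by_cases hmb : b + 1 ≤ m
    · rw [hEr]
      exact (pow_dvd_pow X hmb).trans (dvd_mul_right _ _)
    · exfalso
      have h2 : ∀ k, r.eval (e k ^ 2) =
          (e k ^ 2) ^ (b - m) * (d.eval (e k ^ 2) * (2 * x k - 1)) := by
        intro k
        have h3 := hED k
        rw [hEr, eval_mul, eval_pow, eval_X, show b = m + (b - m) by omega, pow_add,
          mul_assoc] at h3
        exact mul_left_cancel₀ (pow_ne_zero _ (pow_ne_zero _ (he0 k).ne')) h3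
      have h4 := ((he2.pow (b - m)).mul ((hq d).mul hx0))
      rw [mul_zero, mul_zero] at h4
      exact hr (tendsto_nhds_unique (hq r) (by simp_rw [h2]; exact h4))
  obtain ⟨r, hr⟩ := hdvd
  -- Now `d (e ^ 2) * (2 * x - 1) = e ^ 2 * r (e ^ 2)`, whereas `|2 * x - 1| ≥ e`. Dividing by `e`
  -- forces `d` to vanish at `0`, a contradiction.
  have h5 : ∀ k, |d.eval (e k ^ 2)| ≤ e k * |r.eval (e k ^ 2)| := by
    intro k
    have h3 := hED k
    rw [hr, eval_mul, eval_pow, eval_X, pow_succ, mul_assoc] at h3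
    have h6 := mul_left_cancel₀ (pow_ne_zero _ (pow_ne_zero _ (he0 k).ne')) h3
    have h7 := congrArg abs h6
    rw [abs_mul, abs_mul, abs_of_nonneg (sq_nonneg (e k))] at h7
    have h8 : e k ≤ |2 * x k - 1| := by
      rw [abs_of_neg (by linarith [hlt k, he0 k])]
      linarith [hlt k]
    have h9 := mul_le_mul_of_nonneg_left h8 (abs_nonneg (d.eval (e k ^ 2)))
    rw [← h7] at h9
    refine le_of_mul_le_mul_right ?_ (he0 k)
    nlinarith
  have h10 := le_of_tendsto_of_tendsto' (hq d).abs (he.mul (hq r).abs) h5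
  rw [zero_mul] at h10
  exact hd (abs_nonpos_iff.1 h10)

end SSGames

namespace SSGames

namespace SSG

variable {V : Type} [Fintype V] [DecidableEq V]

/-! ### Discounted values as quotients of determinants -/

/-- A common denominator of the probabilities at `v`. -/
def commonDen (G : SSG V) (v : V) : ℕ := ∏ u, (G.prob v u).den

omit [DecidableEq V] in
theorem commonDen_pos (G : SSG V) (v : V) : 0 < G.commonDen v :=
  Finset.prod_pos fun u _ => (G.prob v u).den_pos

/-- The transition probabilities if the players move according to `c` and the play ends in `t`. -/
def positionalProb (G : SSG V) (t : V) (c : V → V) (v u : V) : ℚ≥0 :=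
  if v = t then 0 else if G.owner v = Owner.random then G.prob v u else if u = c v then 1 else 0

theorem den_positionalProb_dvd (G : SSG V) (t : V) (c : V → V) (v u : V) :
    (G.positionalProb t c v u).den ∣ G.commonDen v := by
  unfold positionalProb
  split_ifs
  · simp
  · exact Finset.dvd_prod_of_mem _ (Finset.mem_univ u)
  · simp
  · simp

/-- The transition probabilities, multiplied by the common denominator. -/
def scaledProb (G : SSG V) (t : V) (c : V → V) (v u : V) : ℕ :=
  (G.positionalProb t c v u).num * (G.commonDen v / (G.positionalProb t c v u).den)

theorem cast_scaledProb (G : SSG V) (t : V) (c : V → V) (v u : V) :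
    (G.scaledProb t c v u : ℚ≥0) = G.commonDen v * G.positionalProb t c v u := by
  obtain ⟨k, hk⟩ := G.den_positionalProb_dvd t c v u
  have hd : ((G.positionalProb t c v u).den : ℚ≥0) ≠ 0 :=
    Nat.cast_ne_zero.2 (G.positionalProb t c v u).den_ne_zero
  rw [scaledProb, hk, Nat.mul_div_cancel_left _ (G.positionalProb t c v u).den_pos]
  have h := NNRat.num_div_den (G.positionalProb t c v u)
  rw [div_eq_iff hd] at h
  push_cast
  rw [h]
  ring

theorem cast_scaledProb_real (G : SSG V) (t : V) (c : V → V) (v u : V) :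
    (G.scaledProb t c v u : ℝ) = G.commonDen v * (G.positionalProb t c v u : ℝ) := by
  have := congrArg (fun q : ℚ≥0 => (q : ℝ)) (G.cast_scaledProb t c v u)
  simpa using this

theorem sum_scaledProb_le (G : SSG V) (t : V) (c : V → V) (v : V) :
    ∑ u, G.scaledProb t c v u ≤ G.commonDen v := by
  have h1 : ∑ u, G.positionalProb t c v u ≤ 1 := by
    unfold positionalProb
    split_ifs with h h'
    · simp
    · exact (G.prob_sum v h').le
    · simp
  have h2 : ((∑ u, G.scaledProb t c v u : ℕ) : ℚ≥0) ≤ G.commonDen v := by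
    rw [Nat.cast_sum]
    simp_rw [cast_scaledProb]
    rw [← Finset.mul_sum]
    exact mul_le_of_le_one_right zero_le h1
  exact_mod_cast h2

open Polynomial in
/-- The matrix of the linear equations for the discounted values, with the stopping probability as
an indeterminate. -/
noncomputable def valueMatrix (G : SSG V) (t : V) (c : V → V) : Matrix V V ℤ[X] :=
  Matrix.of fun v u => C ((if v = u then G.commonDen v else 0 : ℕ) : ℤ) -
    (1 - X) * C (G.scaledProb t c v u : ℤ)

open Polynomial in
/-- The right hand side of the linear equations for the discounted values. -/
noncomputable def valueVector (G : SSG V) (t : V) (v : V) : ℤ[X] :=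
  (1 - X) * C ((if v = t then G.commonDen v else 0 : ℕ) : ℤ)

open Polynomial in
/-- The determinant of the linear equations. -/
noncomputable def valueDen (G : SSG V) (t : V) (c : V → V) : ℤ[X] := (G.valueMatrix t c).det

open Polynomial in
/-- The numerator of Cramer's rule. -/
noncomputable def valueNum (G : SSG V) (t : V) (c : V → V) (s : V) : ℤ[X] :=
  ((G.valueMatrix t c).updateCol s (G.valueVector t)).det

open Polynomial in
-- For moves `c` that are optimal for `x`, the fixed point equations are linear. Multiplying by the
-- adjugate gives Cramer's rule without division, so the matrix need not be known to be invertible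
-- at `y`.
theorem valueDen_mul_eq (G : SSG V) (t s : V) {c : V → V} {y : ℝ} {x : V → ℝ}
    (hx : G.IsDiscountedValue t (1 - y) x)
    (hc : ∀ v, G.owner v ≠ Owner.random → G.bellman x v = x (c v)) :
    aeval y (G.valueDen t c) * x s = aeval y (G.valueNum t c s) := by
  set φ : ℤ[X] →+* ℝ := (aeval y : ℤ[X] →ₐ[ℤ] ℝ).toRingHom with hφ
  have hφa : ∀ p, aeval y p = φ p := fun p => rfl
  set A' := (G.valueMatrix t c).map φ with hA'
  have hsys : A'.mulVec x = fun v => φ (G.valueVector t v) := by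
    funext v
    have h1 : ∀ u, A' v u = (if v = u then (G.commonDen v : ℝ) else 0) -
        (1 - y) * (G.commonDen v * (G.positionalProb t c v u : ℝ)) := by
      intro u
      rw [hA', Matrix.map_apply, valueMatrix, Matrix.of_apply, ← hφa]
      simp only [map_sub, map_mul, map_one, aeval_X, aeval_C]
      rw [← cast_scaledProb_real]
      split_ifs <;> simp
    have h2 : φ (G.valueVector t v) = (1 - y) * (if v = t then (G.commonDen v : ℝ) else 0) := by
      rw [valueVector, ← hφa]
      simp only [map_sub, map_mul, map_one, aeval_X, aeval_C]
      split_ifs <;> simp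
    have h3 : ∑ u, (G.positionalProb t c v u : ℝ) * x u =
        if v = t then 0 else G.bellman x v := by
      unfold positionalProb
      split_ifs with h h'
      · simp
      · rw [G.bellman_of_random x h']
      · rw [hc v h', Finset.sum_eq_single (c v)] <;> simp +contextual
    rw [h2, Matrix.mulVec, dotProduct]
    simp_rw [h1, sub_mul, ite_mul, zero_mul, Finset.sum_sub_distrib, mul_assoc, ← Finset.mul_sum]
    rw [h3, Finset.sum_ite_eq, if_pos (Finset.mem_univ v)]
    nth_rw 1 [hx v]
    split_ifs <;> ring
  have hnum : φ (G.valueNum t c s) = Matrix.cramer A' (A'.mulVec x) s := by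
    rw [Matrix.cramer_apply, hsys, valueNum, RingHom.map_det, RingHom.mapMatrix_apply,
      Matrix.map_updateCol]
    rfl
  have hden : φ (G.valueDen t c) = A'.det := by
    rw [valueDen, RingHom.map_det, RingHom.mapMatrix_apply]
  rw [hφa, hφa, hnum, hden, Matrix.cramer_eq_adjugate_mulVec, Matrix.mulVec_mulVec,
    Matrix.adjugate_mul, Matrix.smul_mulVec, Matrix.one_mulVec]
  rfl

open Polynomial in
-- At stopping probability `1` no transition survives and the matrix is diagonal. This is the
-- witness that the determinant is not the zero polynomial.
theorem aeval_one_valueDen (G : SSG V) (t : V) (c : V → V) :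
    aeval (1 : ℝ) (G.valueDen t c) ≠ 0 := by
  have h1 : (G.valueMatrix t c).map (aeval (1 : ℝ) : ℤ[X] →ₐ[ℤ] ℝ).toRingHom =
      Matrix.diagonal fun v => (G.commonDen v : ℝ) := by
    ext v u
    rw [Matrix.map_apply, valueMatrix, Matrix.of_apply, Matrix.diagonal_apply]
    change aeval (1 : ℝ) _ = _
    simp only [map_sub, map_mul, map_one, aeval_X, aeval_C]
    split_ifs <;> simp
  have h2 : aeval (1 : ℝ) (G.valueDen t c) = ∏ v, (G.commonDen v : ℝ) := by
    rw [← Matrix.det_diagonal, ← h1, valueDen]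
    exact RingHom.map_det (aeval (1 : ℝ) : ℤ[X] →ₐ[ℤ] ℝ).toRingHom _
  rw [h2]
  exact (Finset.prod_pos fun v _ => Nat.cast_pos.2 (G.commonDen_pos v)).ne'

theorem lengthLe_one_sub_X : LengthLe (1 - Polynomial.X) 2 := LengthLe.one.sub LengthLe.X

theorem lengthLe_valueMatrix (G : SSG V) (t : V) (c : V → V) (v u : V) :
    LengthLe (G.valueMatrix t c v u)
      ((if v = u then G.commonDen v else 0) + 2 * G.scaledProb t c v u) := by
  rw [valueMatrix, Matrix.of_apply]
  refine LengthLe.sub ?_ (lengthLe_one_sub_X.mul ?_)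
  · simpa only [Int.natAbs_natCast] using
      LengthLe.C ((if v = u then G.commonDen v else 0 : ℕ) : ℤ)
  · simpa only [Int.natAbs_natCast] using LengthLe.C (G.scaledProb t c v u : ℤ)

theorem lengthLe_valueDen (G : SSG V) (t : V) (c : V → V) :
    LengthLe (G.valueDen t c) (5 ^ Fintype.card V * ∏ v, G.commonDen v) := by
  refine (LengthLe.det (G.lengthLe_valueMatrix t c)).mono ?_
  rw [Fintype.card, ← Finset.prod_const, ← Finset.prod_mul_distrib]
  refine Finset.prod_le_prod' fun v _ => ?_
  have := G.sum_scaledProb_le t c v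
  rw [Finset.sum_add_distrib, Finset.sum_ite_eq, if_pos (Finset.mem_univ v), ← Finset.mul_sum]
  omega

theorem lengthLe_valueNum (G : SSG V) (t : V) (c : V → V) (s : V) :
    LengthLe (G.valueNum t c s) (5 ^ Fintype.card V * ∏ v, G.commonDen v) := by
  -- The row sums are at most `3 * commonDen v` from the matrix and `2 * commonDen v` from the
  -- replaced column, whence the factor `5` per row. Adding both at column `s` avoids a case
  -- distinction.
  refine (LengthLe.det (H := fun v u => ((if v = u then G.commonDen v else 0) +
    2 * G.scaledProb t c v u) + if u = s then 2 * G.commonDen v else 0) fun v u => ?_).mono ?_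
  · rw [Matrix.updateCol_apply]
    split_ifs with hu hvu
    · refine (lengthLe_one_sub_X.mul (LengthLe.C _)).mono ?_
      rw [Int.natAbs_natCast]
      refine le_trans (Nat.mul_le_mul_left 2 ?_) (Nat.le_add_left _ _)
      split_ifs <;> simp
    · refine (lengthLe_one_sub_X.mul (LengthLe.C _)).mono ?_
      rw [Int.natAbs_natCast]
      refine le_trans (Nat.mul_le_mul_left 2 ?_) (Nat.le_add_left _ _)
      split_ifs <;> simp
    · simpa [*] using G.lengthLe_valueMatrix t c v u
    · simpa [*] using G.lengthLe_valueMatrix t c v u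
  · rw [Fintype.card, ← Finset.prod_const, ← Finset.prod_mul_distrib]
    refine Finset.prod_le_prod' fun v _ => ?_
    have := G.sum_scaledProb_le t c v
    rw [Finset.sum_add_distrib, Finset.sum_add_distrib, Finset.sum_ite_eq,
      if_pos (Finset.mem_univ v), ← Finset.mul_sum, Finset.sum_ite_eq', if_pos (Finset.mem_univ s)]
    omega

/-! ### The gap at one half -/

/-- The difference between the two sides of the test whether a biased coin that is followed by the
stopped game succeeds with probability at least `1/2`. -/
noncomputable def bias (G : SSG V) (s t : V) (e : ℝ) : ℝ :=
  2 * e + 2 * (1 - e) * G.discountedValue t (1 - e ^ 2) s - 1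

/-- A bound for the lengths of the integer polynomials that describe `bias`. -/
def gapBound (G : SSG V) : ℕ := 7 * (5 ^ Fintype.card V * ∏ v, G.commonDen v)

/-- Multiplied by the determinant at `e ^ 2`, `bias` becomes the value at `e` of an integer
polynomial of length at most `gapBound`. Such a polynomial has no zero so close to `0`. -/
theorem bias_ne_zero (G : SSG V) (s t : V) {e : ℝ} (h0 : 0 < e) (h1 : e < 1)
    (hH : e * G.gapBound < 1) : G.bias s t e ≠ 0 := by
  have hx := G.isDiscountedValue t (β := 1 - e ^ 2) (by nlinarith) (by nlinarith)
  obtain ⟨c, -, hcx⟩ := G.exists_selection (G.discountedValue t (1 - e ^ 2))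
  have hND := G.valueDen_mul_eq t s hx hcx
  set D := G.valueDen t c
  set N := G.valueNum t c s
  -- The three summands contribute the factors `2`, `4` and `1` to the length, which explains the
  -- `7` in `gapBound`. At `1` the polynomial equals the determinant, so it is not zero.
  open Polynomial in
  set f : ℤ[X] := (C 2 * X) * expand ℤ 2 D + (C 2 * (1 - X)) * expand ℤ 2 N - expand ℤ 2 D
    with hf
  have hC2 := LengthLe.C 2
  have hlen : LengthLe f G.gapBound := by
    have hD := (G.lengthLe_valueDen t c).expand
    have hN := (G.lengthLe_valueNum t c s).expand
    refine ((((hC2.mul LengthLe.X).mul hD).add ((hC2.mul lengthLe_one_sub_X).mul hN)).sub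
      hD).mono ?_
    rw [gapBound, show Int.natAbs 2 = 2 from rfl]
    omega
  have hfe : ∀ y : ℝ, Polynomial.aeval y f = 2 * y * Polynomial.aeval (y ^ 2) D +
      2 * (1 - y) * Polynomial.aeval (y ^ 2) N - Polynomial.aeval (y ^ 2) D := by
    intro y
    have h2 : Polynomial.aeval y (2 : Polynomial ℤ) = 2 := map_ofNat _ 2
    simp [hf, Polynomial.expand_aeval, h2]
  have hf0 : f ≠ 0 := by
    intro h
    have h2 := hfe 1
    rw [h, map_zero, one_pow] at h2
    exact G.aeval_one_valueDen t c (by linarith)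
  have hne := hlen.aeval_ne_zero h0 h1.le hH hf0
  intro hb
  refine hne ?_
  rw [hfe, ← hND]
  unfold bias at hb
  linear_combination (Polynomial.aeval (e ^ 2) D) * hb

theorem continuousAt_bias (G : SSG V) (s t : V) {e : ℝ} (h0 : 0 < e) (h1 : e < 1) :
    ContinuousAt (G.bias s t) e := by
  have h2 : ContinuousAt (fun e : ℝ => G.discountedValue t (1 - e ^ 2) s) e :=
    ContinuousAt.comp (f := fun e : ℝ => 1 - e ^ 2) (g := fun β => G.discountedValue t β s)
      (G.continuousAt_discountedValue t s (by nlinarith) (by nlinarith))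
      (by fun_prop)
  unfold bias
  fun_prop

/-- The sign of `bias` does not change as long as `e` is small. -/
theorem bias_pos_iff (G : SSG V) (s t : V) {e e' : ℝ} (h0 : 0 < e') (hle : e' ≤ e) (h1 : e < 1)
    (hH : e * G.gapBound < 1) : 0 < G.bias s t e' ↔ 0 < G.bias s t e := by
  have hsub : ∀ y ∈ Set.Icc e' e, 0 < y ∧ y < 1 ∧ y * G.gapBound < 1 := fun y hy =>
    ⟨h0.trans_le hy.1, hy.2.trans_lt h1,
      (mul_le_mul_of_nonneg_right hy.2 (Nat.cast_nonneg _)).trans_lt hH⟩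
  have hcont : ContinuousOn (G.bias s t) (Set.Icc e' e) := fun y hy =>
    (G.continuousAt_bias s t (hsub y hy).1 (hsub y hy).2.1).continuousWithinAt
  have hne : ∀ y ∈ Set.Icc e' e, G.bias s t y ≠ 0 := fun y hy =>
    G.bias_ne_zero s t (hsub y hy).1 (hsub y hy).2.1 (hsub y hy).2.2
  constructor
  · intro h
    by_contra hcon
    obtain ⟨y, hy, hy0⟩ := intermediate_value_Icc' hle hcont ⟨not_lt.1 hcon, h.le⟩
    exact hne y hy hy0
  · intro h
    by_contra hcon
    obtain ⟨y, hy, hy0⟩ := intermediate_value_Icc hle hcont ⟨not_lt.1 hcon, h.le⟩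
    exact hne y hy hy0

variable [MeasurableSpace V] [DiscreteMeasurableSpace V]

/-- The stopped value is at most the value `a < 1/2`, so `bias` is at most `2 * e' + 2 * (1 - e') *
a - 1`, which is not positive for small `e'`. The constancy of the sign transports this to `e`. -/
theorem bias_neg_of_value_lt (G : SSG V) (s t : V) (hv : ¬ 1 / 2 ≤ G.value (reach t) s) {e : ℝ}
    (h0 : 0 < e) (h1 : e < 1) (hH : e * G.gapBound < 1) : G.bias s t e < 0 := by
  rw [not_le] at hv
  have hval : ∃ a : ℝ, a < 1 / 2 ∧ 0 ≤ a ∧ G.value (reach t) s = ENNReal.ofReal a := by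
    refine ⟨(G.value (reach t) s).toReal, ?_, ENNReal.toReal_nonneg,
      (ENNReal.ofReal_toReal hv.ne_top).symm⟩
    have := (ENNReal.toReal_lt_toReal hv.ne_top (by simp)).2 hv
    simpa using this
  obtain ⟨a, ha, ha0, hva⟩ := hval
  set e' := min e ((1 / 2 - a) / 2) with he'
  have h0' : 0 < e' := lt_min h0 (by linarith)
  have hle : e' ≤ e := min_le_left _ _
  have hx := G.discountedValue_le_value s t (β := 1 - e' ^ 2) (by nlinarith) (by nlinarith)
  rw [hva, ENNReal.ofReal_le_ofReal_iff ha0] at hx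
  have hneg : ¬ 0 < G.bias s t e' := by
    have h2 : e' ≤ (1 / 2 - a) / 2 := min_le_right _ _
    have h3 := mul_le_mul_of_nonneg_left hx (by linarith : 0 ≤ 1 - e')
    unfold bias
    nlinarith
  rw [G.bias_pos_iff s t h0' hle h1 hH, not_lt] at hneg
  exact lt_of_le_of_ne hneg (G.bias_ne_zero s t h0 h1 hH)

/-- Otherwise `bias` is negative along a sequence of arguments tending to `0`, where the stopped
values lie below `1/2` by more than the argument itself. Their limit is at least `1/2`, and this
contradicts rationality in the square of the argument. -/
theorem bias_pos_of_le_value (G : SSG V) (s t : V) (hv : 1 / 2 ≤ G.value (reach t) s) {e : ℝ}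
    (h0 : 0 < e) (h1 : e < 1) (hH : e * G.gapBound < 1) : 0 < G.bias s t e := by
  by_contra hcon
  let ε : ℕ → ℝ := fun k => e * (1 / (k + 1))
  have hε0 : ∀ k, 0 < ε k := fun k => by positivity
  have hεe : ∀ k, ε k ≤ e := fun k => by
    refine mul_le_of_le_one_right h0.le ?_
    rw [div_le_one (by positivity)]
    linarith [(Nat.cast_nonneg k : (0 : ℝ) ≤ k)]
  have hε : Tendsto ε atTop (nhds 0) := by
    have := (tendsto_one_div_add_atTop_nhds_zero_nat (𝕜 := ℝ)).const_mul e
    rwa [mul_zero] at this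
  have hβ0 : ∀ k, 0 ≤ 1 - ε k ^ 2 := fun k => by nlinarith [hε0 k, hεe k]
  have hβ1 : ∀ k, 1 - ε k ^ 2 < 1 := fun k => by nlinarith [hε0 k, hεe k]
  obtain ⟨φ, hφ, a, hva, ha⟩ := G.exists_subseq_discountedValue s t hβ0 hβ1
    (by simpa using (hε.pow 2).const_sub 1)
  have ha2 : 1 / 2 ≤ a := by
    have h2 : ENNReal.ofReal (1 / 2) ≤ ENNReal.ofReal a := by
      refine le_trans (le_of_eq ?_) (hv.trans hva)
      rw [ENNReal.ofReal_div_of_pos two_pos]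
      simp
    by_contra h3
    exact absurd h2 (not_le.2 ((ENNReal.ofReal_lt_ofReal_iff (by norm_num)).2 (not_le.1 h3)))
  have hx := fun k => G.isDiscountedValue t (hβ0 (φ k)) (hβ1 (φ k))
  choose c _ hcx using fun k => G.exists_selection (G.discountedValue t (1 - ε (φ k) ^ 2))
  -- The optimal moves depend on `k`, but there are finitely many choices. On an infinite set of
  -- indices a single pair of polynomials describes all values.
  obtain ⟨c₀, hc₀⟩ := Finite.exists_infinite_fiber c
  rw [Set.infinite_coe_iff] at hc₀
  let ψ : ℕ → ℕ := Nat.nth (fun k => k ∈ c ⁻¹' {c₀})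
  have hψ : StrictMono ψ := Nat.nth_strictMono hc₀
  have hψc : ∀ k, c (ψ k) = c₀ := fun k => Nat.nth_mem_of_infinite hc₀ k
  have hD0 : (G.valueDen t c₀).map (Int.castRingHom ℝ) ≠ 0 := by
    intro h
    refine G.aeval_one_valueDen t c₀ ?_
    rw [Polynomial.aeval_def, ← Polynomial.eval_map]
    change Polynomial.eval 1 ((G.valueDen t c₀).map (Int.castRingHom ℝ)) = 0
    rw [h, Polynomial.eval_zero]
  refine not_forall_lt_of_tendsto (N := (G.valueNum t c₀ s).map (Int.castRingHom ℝ)) hD0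
    (e := fun k => ε (φ (ψ k))) (x := fun k => G.discountedValue t (1 - ε (φ (ψ k)) ^ 2) s)
    (fun k => hε0 _) (hε.comp (hφ.comp hψ).tendsto_atTop) ha2 (ha.comp hψ.tendsto_atTop)
    (fun k => ?_) fun k => ?_
  · have h3 := G.valueDen_mul_eq t s (c := c₀) (hx (ψ k)) (by rw [← hψc k]; exact hcx (ψ k))
    rw [Polynomial.aeval_def, Polynomial.aeval_def, ← Polynomial.eval_map,
      ← Polynomial.eval_map] at h3
    exact h3
  · have h4 : ¬ 0 < G.bias s t (ε (φ (ψ k))) := by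
      rwa [G.bias_pos_iff s t (hε0 _) (hεe _) h1 hH]
    have h5 : G.bias s t (ε (φ (ψ k))) < 0 := lt_of_le_of_ne (not_lt.1 h4)
      (G.bias_ne_zero s t (hε0 _) ((hεe _).trans_lt h1)
        ((mul_le_mul_of_nonneg_right (hεe _) (Nat.cast_nonneg _)).trans_lt hH))
    have h6 := hε0 (φ (ψ k))
    have h7 := (hεe (φ (ψ k))).trans_lt h1
    unfold bias at h5
    change 2 * G.discountedValue t (1 - ε (φ (ψ k)) ^ 2) s - 1 < - ε (φ (ψ k))
    -- Since `bias = ε + (1 - ε) * (2 * x - 1)`, a negative bias gives `2 * x - 1 < -ε / (1 - ε) <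
    -- -ε`.
    nlinarith

end SSG

end SSGames

namespace SSGames

/-! ### The reduced game -/

/-- The vertices of the reduced game: two vertices with rewards, and two copies of each vertex of
the original game. -/
inductive Vtx (V : Type)
  | good
  | bad
  | pre (v : V)
  | main (v : V)
  deriving DecidableEq, Fintype

/-- The embedding of the original vertices as the vertices `pre v`. -/
def Vtx.preEmbedding (V : Type) : V ↪ Vtx V := ⟨Vtx.pre, fun _ _ h => Vtx.pre.inj h⟩

theorem Vtx.preEmbedding_apply {V : Type} (v : V) : Vtx.preEmbedding V v = Vtx.pre v := rfl

theorem Vtx.sum_eq {V : Type} [Fintype V] {α : Type*} [AddCommMonoid α] (f : Vtx V → α) :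
    ∑ a, f a = f Vtx.good + (f Vtx.bad + ((∑ v, f (Vtx.pre v)) + ∑ v, f (Vtx.main v))) := by
  classical
  let e : Option (Option (V ⊕ V)) ≃ Vtx V :=
    { toFun := fun
        | none => Vtx.good
        | some none => Vtx.bad
        | some (some (Sum.inl v)) => Vtx.pre v
        | some (some (Sum.inr v)) => Vtx.main v
      invFun := fun
        | Vtx.good => none
        | Vtx.bad => some none
        | Vtx.pre v => some (some (Sum.inl v))
        | Vtx.main v => some (some (Sum.inr v))
      left_inv := by rintro (_ | _ | _ | _) <;> rfl
      right_inv := by rintro (_ | _ | _ | _) <;> rfl }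
  rw [← e.sum_comp, Fintype.sum_option, Fintype.sum_option, Fintype.sum_sum_type]
  rfl

namespace SSG

variable {V : Type} [Fintype V] [DecidableEq V]

/-- The complementary probabilities `1 / M` and `(M - 1) / M`. -/
theorem inv_add_pred_div {M : ℕ} (hM : 1 ≤ M) : (1 / M : ℚ≥0) + ((M - 1 : ℕ) / M : ℚ≥0) = 1 := by
  rw [← add_div, ← Nat.cast_one, ← Nat.cast_add, Nat.add_sub_cancel' hM]
  exact div_self (Nat.cast_ne_zero.2 (by omega))

/-- The edges of the reduced game together with their probabilities. -/
def reducedEdge (G : SSG V) (s t : V) (L : ℕ) : Vtx V → Vtx V → Bool × ℚ≥0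
  -- `good` and `bad` toss the coin and start the next round, `pre v` decides about stopping, and
  -- `main v` carries the original move. Powers of two make the fractions easy to write in binary.
  | Vtx.good, Vtx.good => (true, 1 / (2 ^ L : ℕ))
  | Vtx.good, Vtx.pre u => if u = s then (true, (2 ^ L - 1 : ℕ) / (2 ^ L : ℕ)) else (false, 0)
  | Vtx.bad, Vtx.good => (true, 1 / (2 ^ L : ℕ))
  | Vtx.bad, Vtx.pre u => if u = s then (true, (2 ^ L - 1 : ℕ) / (2 ^ L : ℕ)) else (false, 0)
  | Vtx.pre _, Vtx.bad => (true, 1 / (2 ^ (2 * L) : ℕ))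
  | Vtx.pre v, Vtx.good =>
      if v = t then (true, (2 ^ (2 * L) - 1 : ℕ) / (2 ^ (2 * L) : ℕ)) else (false, 0)
  | Vtx.pre v, Vtx.main u =>
      if u = v ∧ v ≠ t then (true, (2 ^ (2 * L) - 1 : ℕ) / (2 ^ (2 * L) : ℕ)) else (false, 0)
  | Vtx.main v, Vtx.pre u => (decide (u ∈ G.succ v), G.prob v u)
  | _, _ => (false, 0)

/-- The owners of the vertices of the reduced game. -/
def reducedOwner (G : SSG V) : Vtx V → Owner
  | Vtx.main v => G.owner v
  | _ => Owner.random

/-- The game in which a play of `G` that starts in `s` is repeated: after each round a reward is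
paid at `good`, if `t` was reached, or at `bad`, if the round was stopped before. -/
def reduced (G : SSG V) (s t : V) (L : ℕ) : SSG (Vtx V) where
  owner := G.reducedOwner
  succ a := Finset.univ.filter fun b => (G.reducedEdge s t L a b).1 = true
  succ_nonempty a := by
    rcases a with _ | _ | v | v
    · exact ⟨Vtx.good, by simp [reducedEdge]⟩
    · exact ⟨Vtx.good, by simp [reducedEdge]⟩
    · exact ⟨Vtx.bad, by simp [reducedEdge]⟩
    · obtain ⟨u, hu⟩ := G.succ_nonempty v
      exact ⟨Vtx.pre u, by simpa [reducedEdge] using hu⟩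
  prob a b := (G.reducedEdge s t L a b).2
  prob_sum a ha := by
    have h1 := inv_add_pred_div (Nat.one_le_two_pow (n := L))
    have h2 := inv_add_pred_div (Nat.one_le_two_pow (n := 2 * L))
    rw [Vtx.sum_eq]
    rcases a with _ | _ | v | v
    · simpa [reducedEdge, apply_ite Prod.snd] using h1
    · simpa [reducedEdge, apply_ite Prod.snd] using h1
    · by_cases hv : v = t
      · rw [add_comm] at h2
        simpa [reducedEdge, hv] using h2
      · simpa [reducedEdge, apply_ite Prod.snd, hv] using h2
    · simpa [reducedEdge] using G.prob_sum v ha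
  prob_eq_zero a b h := by
    have h' : G.reducedOwner a ≠ Owner.random ∨ ¬ (G.reducedEdge s t L a b).1 = true :=
      h.imp_right fun h1 h2 => h1 (by simpa using h2)
    rcases a with _ | _ | v | v <;> rcases b with _ | _ | u | u <;>
      simp only [reducedOwner, ne_eq, not_true_eq_false, false_or, reducedEdge] at h' ⊢ <;>
      first
        | exact G.prob_eq_zero v u (h'.imp_right fun h => by simpa using h)
        | (split_ifs at h' ⊢ <;> simp_all)

/-! ### The Bellman operator under affine maps, renaming and the reduction. -/

omit [DecidableEq V] in
theorem bellman_affine (G : SSG V) (x : V → ℝ) {a : ℝ} (ha : 0 ≤ a) (b : ℝ) (v : V) :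
    G.bellman (fun u => a * x u + b) v = a * G.bellman x v + b := by
  rcases hv : G.owner v with _ | _ | _
  · rw [G.bellman_of_max _ hv, G.bellman_of_max _ hv]
    refine le_antisymm (Finset.sup'_le _ _ fun u hu => ?_) ?_
    · have := mul_le_mul_of_nonneg_left (Finset.le_sup' x hu) ha
      linarith
    · obtain ⟨u, hu, h⟩ := Finset.exists_mem_eq_sup' (G.succ_nonempty v) x
      rw [h]
      exact Finset.le_sup' (fun u => a * x u + b) hu
  · rw [G.bellman_of_min _ hv, G.bellman_of_min _ hv]
    refine le_antisymm ?_ (Finset.le_inf' _ _ fun u hu => ?_)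
    · obtain ⟨u, hu, h⟩ := Finset.exists_mem_eq_inf' (G.succ_nonempty v) x
      rw [h]
      exact Finset.inf'_le (fun u => a * x u + b) hu
    · have := mul_le_mul_of_nonneg_left (Finset.inf'_le x hu) ha
      linarith
  · rw [G.bellman_of_random _ hv, G.bellman_of_random _ hv]
    simp only [mul_add, Finset.sum_add_distrib, ← Finset.sum_mul, G.sum_prob_real hv, one_mul,
      Finset.mul_sum]
    congr 1
    exact Finset.sum_congr rfl fun u _ => by ring

/-- A game with renamed vertices. -/
def comap {W : Type} [Fintype W] (G : SSG V) (e : W ≃ V) : SSG W where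
  owner w := G.owner (e w)
  succ w := (G.succ (e w)).map e.symm.toEmbedding
  succ_nonempty w := (G.succ_nonempty (e w)).map
  prob w w' := G.prob (e w) (e w')
  prob_sum w hw := by rw [e.sum_comp (fun v => G.prob (e w) v), G.prob_sum _ hw]
  prob_eq_zero w w' h := G.prob_eq_zero _ _ (h.imp_right fun h hs => h (by
    rw [Finset.mem_map]
    exact ⟨e w', hs, by simp⟩))

omit [DecidableEq V] in
theorem mem_succ_comap {W : Type} [Fintype W] (G : SSG V) (e : W ≃ V) (w w' : W) :
    w' ∈ (G.comap e).succ w ↔ e w' ∈ G.succ (e w) := by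
  simp only [comap, Finset.mem_map, Equiv.coe_toEmbedding]
  exact ⟨fun ⟨v, hv, h⟩ => by rw [← h]; simpa using hv, fun h => ⟨_, h, by simp⟩⟩

omit [DecidableEq V] in
theorem bellman_comap {W : Type} [Fintype W] (G : SSG V) (e : W ≃ V) (x : V → ℝ) (w : W) :
    (G.comap e).bellman (fun w => x (e w)) w = G.bellman x (e w) := by
  rcases hv : G.owner (e w) with _ | _ | _
  · rw [G.bellman_of_max _ hv, (G.comap e).bellman_of_max _ hv]
    simp only [comap, Finset.sup'_map]
    exact Finset.sup'_congr _ rfl fun u _ => by simp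
  · rw [G.bellman_of_min _ hv, (G.comap e).bellman_of_min _ hv]
    simp only [comap, Finset.inf'_map]
    exact Finset.inf'_congr _ rfl fun u _ => by simp
  · rw [G.bellman_of_random _ hv, (G.comap e).bellman_of_random _ hv]
    exact e.sum_comp fun v => (G.prob (e w) v : ℝ) * x v

theorem bellman_reduced_main (G : SSG V) (s t : V) (L : ℕ) (φ : Vtx V → ℝ) (v : V) :
    (G.reduced s t L).bellman φ (Vtx.main v) = G.bellman (fun u => φ (Vtx.pre u)) v := by
  have hs : (G.reduced s t L).succ (Vtx.main v) =
      (G.succ v).map (Vtx.preEmbedding V) := by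
    ext b
    rcases b with _ | _ | u | u <;> simp [reduced, reducedEdge, Vtx.preEmbedding_apply]
  rcases hv : G.owner v with _ | _ | _
  · rw [G.bellman_of_max _ hv, (G.reduced s t L).bellman_of_max (v := Vtx.main v) _ hv]
    simp only [hs, Finset.sup'_map]
    rfl
  · rw [G.bellman_of_min _ hv, (G.reduced s t L).bellman_of_min (v := Vtx.main v) _ hv]
    simp only [hs, Finset.inf'_map]
    rfl
  · rw [G.bellman_of_random _ hv, (G.reduced s t L).bellman_of_random (v := Vtx.main v) _ hv,
      Vtx.sum_eq]
    simp [reduced, reducedEdge]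

/-- The probability that leads from `good` and `bad` directly to `good`. -/
noncomputable def coin (L : ℕ) : ℝ := 1 / 2 ^ L

theorem coin_pos (L : ℕ) : 0 < coin L := by
  unfold coin
  positivity

theorem coin_lt_one {L : ℕ} (hL : 1 ≤ L) : coin L < 1 := by
  unfold coin
  rw [div_lt_one (by positivity)]
  exact one_lt_pow₀ one_lt_two (by omega)

theorem cast_pred_div (L : ℕ) :
    (((2 ^ L - 1 : ℕ) / (2 ^ L : ℕ) : ℚ≥0) : ℝ) = 1 - coin L := by
  rw [NNRat.cast_div, NNRat.cast_natCast, NNRat.cast_natCast, Nat.cast_sub Nat.one_le_two_pow, coin]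
  push_cast
  field_simp

theorem cast_one_div (L : ℕ) : ((1 / (2 ^ L : ℕ) : ℚ≥0) : ℝ) = coin L := by
  simp [coin]

theorem coin_two_mul (L : ℕ) : coin (2 * L) = coin L ^ 2 := by
  unfold coin
  rw [div_pow, one_pow, ← pow_mul, mul_comm]

/-- The reward at `good` and `bad`. -/
def baseReward : Vtx V → SignType
  | Vtx.good => 1
  | Vtx.bad => -1
  | _ => 0

/-- A potential for the rewards. -/
noncomputable def potential (G : SSG V) (s t : V) (L : ℕ) : Vtx V → ℝ
  | Vtx.good => 1
  | Vtx.bad => -1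
  | Vtx.pre v => 2 * G.discountedValue t (1 - coin L ^ 2) v - (G.bias s t (coin L) / 2 + 1)
  | Vtx.main v => 2 * G.bellman (G.discountedValue t (1 - coin L ^ 2)) v -
      (G.bias s t (coin L) / 2 * (1 + coin L ^ 2) + 1)

/-- From `pre v` an optimally played round has expected final reward `2 * x v - 1`, with `x` the
discounted values. With this as potential, the whole `bias` would be earned at `good` and `bad`, and
nothing in between. The additional multiples of `bias` in `potential` move part of it to the other
vertices: half of it is earned at `pre t`, and shares `coin L ^ 2 / 2` and `coin L ^ 4 / 2` at `main
v` and at the remaining `pre v`. The last share is the smallest; it arises as `1 - (1 - e ^ 2) * (1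
+ e ^ 2) = e ^ 4`. -/
theorem drift_reduced (G : SSG V) (s t : V) {L : ℕ} (hL : 1 ≤ L) (a : Vtx V) :
    ∃ m ≥ coin L ^ 4 / 2,
      ((baseReward a : SignType) : ℝ) + (G.reduced s t L).bellman (G.potential s t L) a -
        G.potential s t L a = m * G.bias s t (coin L) := by
  have h0 := coin_pos L
  have h1 := coin_lt_one hL
  have h2 : coin L ^ 2 ≤ 1 := pow_le_one₀ h0.le h1.le
  have h4 : coin L ^ 4 ≤ 1 := pow_le_one₀ h0.le h1.le
  have h42 : coin L ^ 4 ≤ coin L ^ 2 := pow_le_pow_of_le_one h0.le h1.le (by norm_num)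
  have hx := G.isDiscountedValue t (β := 1 - coin L ^ 2) (by linarith)
    (by have := pow_pos h0 2; linarith)
  have hb : G.bias s t (coin L) =
    2 * coin L + 2 * (1 - coin L) * G.discountedValue t (1 - coin L ^ 2) s - 1 := rfl
  rcases a with _ | _ | v | v
  · refine ⟨(1 + coin L) / 2, by linarith, ?_⟩
    rw [(G.reduced s t L).bellman_of_random _ rfl, Vtx.sum_eq]
    simp only [reduced, reducedEdge, apply_ite Prod.snd, apply_ite (NNRat.cast (K := ℝ)),
      cast_pred_div, cast_one_div, ite_mul, potential, baseReward]
    simp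
    rw [hb]
    ring
  · refine ⟨(1 + coin L) / 2, by linarith, ?_⟩
    rw [(G.reduced s t L).bellman_of_random _ rfl, Vtx.sum_eq]
    simp only [reduced, reducedEdge, apply_ite Prod.snd, apply_ite (NNRat.cast (K := ℝ)),
      cast_pred_div, cast_one_div, ite_mul, potential, baseReward]
    simp
    rw [hb]
    ring
  · rw [(G.reduced s t L).bellman_of_random _ rfl, Vtx.sum_eq]
    by_cases hv : v = t
    · refine ⟨1 / 2, by linarith, ?_⟩
      simp only [reduced, reducedEdge, apply_ite Prod.snd, apply_ite (NNRat.cast (K := ℝ)),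
        cast_pred_div, cast_one_div, ite_mul, potential, baseReward, coin_two_mul]
      rw [hx v]
      simp [hv]
      ring
    · refine ⟨coin L ^ 4 / 2, le_rfl, ?_⟩
      simp only [reduced, reducedEdge, apply_ite Prod.snd, apply_ite (NNRat.cast (K := ℝ)),
        cast_pred_div, cast_one_div, ite_mul, potential, baseReward, coin_two_mul]
      rw [hx v]
      simp [hv]
      ring
  · refine ⟨coin L ^ 2 / 2, by linarith, ?_⟩
    have h5 : (fun u => G.potential s t L (Vtx.pre u)) = fun u =>
        2 * G.discountedValue t (1 - coin L ^ 2) u + -(G.bias s t (coin L) / 2 + 1) :=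
      funext fun u => sub_eq_add_neg _ _
    rw [bellman_reduced_main, h5, G.bellman_affine _ two_pos.le]
    simp only [potential, baseReward]
    simp
    ring

end SSG

end SSGames

namespace SSGames

/-! ### Limit objectives on runs with linear growth -/

theorem liminf_eq_top_of_linear_growth {S : ℕ → ℝ} {a : ℝ} (ha : 0 < a)
    (h : ∀ᶠ n : ℕ in atTop, a * n ≤ S n) :
    liminf (fun n => ((S (n + 1) : ℝ) : EReal)) atTop = ⊤ := by
  have h1 : Tendsto S atTop atTop :=
    tendsto_atTop_mono' _ h (tendsto_natCast_atTop_atTop.const_mul_atTop ha)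
  exact ((EReal.tendsto_coe_atTop.comp h1).comp (tendsto_add_atTop_nat 1)).liminf_eq

theorem liminf_eq_bot_of_linear_growth {S : ℕ → ℝ} {a : ℝ} (ha : 0 < a)
    (h : ∀ᶠ n : ℕ in atTop, a * n ≤ - S n) :
    liminf (fun n => ((S (n + 1) : ℝ) : EReal)) atTop = ⊥ := by
  have h1 : Tendsto (fun n => - S n) atTop atTop :=
    tendsto_atTop_mono' _ h (tendsto_natCast_atTop_atTop.const_mul_atTop ha)
  have h2 : Tendsto S atTop atBot := tendsto_neg_atTop_iff.1 h1
  exact ((EReal.tendsto_coe_atBot.comp h2).comp (tendsto_add_atTop_nat 1)).liminf_eq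

theorem liminf_div_pos_of_linear_growth {S : ℕ → ℝ} {a : ℝ} (ha : 0 < a)
    (h : ∀ᶠ n : ℕ in atTop, a * n ≤ S n) :
    0 < liminf (fun n : ℕ => ((S n / (n : ℝ) : ℝ) : EReal)) atTop := by
  refine lt_of_lt_of_le (EReal.coe_pos.2 ha) (le_liminf_of_le (by isBoundedDefault) ?_)
  filter_upwards [h, eventually_gt_atTop 0] with n hn hn0
  rw [EReal.coe_le_coe_iff, le_div_iff₀ (by exact_mod_cast hn0)]
  exact hn

theorem liminf_div_nonpos_of_linear_growth {S : ℕ → ℝ} {a : ℝ} (ha : 0 < a)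
    (h : ∀ᶠ n : ℕ in atTop, a * n ≤ - S n) :
    ¬ 0 < liminf (fun n : ℕ => ((S n / (n : ℝ) : ℝ) : EReal)) atTop := by
  rw [not_lt]
  have h1 : ∀ᶠ n : ℕ in atTop, ((S n / (n : ℝ) : ℝ) : EReal) ≤ 0 := by
    filter_upwards [h, eventually_gt_atTop 0] with n hn hn0
    have hn0' : (0 : ℝ) < n := by exact_mod_cast hn0
    rw [EReal.coe_nonpos]
    refine div_nonpos_of_nonpos_of_nonneg ?_ hn0'.le
    nlinarith
  exact (liminf_le_liminf h1).trans (by simp)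

namespace LimitObjective

/-- The sign of the rewards that help player Max. -/
def orientation : LimitObjective → SignType
  | liminfEqBot => -1
  | _ => 1

variable {V : Type} (O : LimitObjective) (r : V → SignType) {w : ℕ → V}

theorem mem_runs_of_linear_growth (h : ∃ a > 0, ∀ᶠ n : ℕ in atTop,
      a * n ≤ ∑ i ∈ Finset.range n, ((r (w i) : SignType) : ℝ)) :
    w ∈ O.runs (fun v => O.orientation * r v) := by
  obtain ⟨a, ha, h⟩ := h
  cases O
  · have := liminf_eq_bot_of_linear_growth
      (S := fun n => ∑ i ∈ Finset.range n, ((-1 * r (w i) : SignType) : ℝ)) ha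
      (h.mono fun n hn => by simpa using hn)
    simpa only [runs, orientation, Set.mem_ofPred_eq] using this
  · have := liminf_eq_top_of_linear_growth
      (S := fun n => ∑ i ∈ Finset.range n, ((1 * r (w i) : SignType) : ℝ)) ha
      (h.mono fun n hn => by simpa using hn)
    simpa only [runs, orientation, Set.mem_ofPred_eq] using this
  · have := liminf_div_pos_of_linear_growth
      (S := fun n => ∑ i ∈ Finset.range n, ((1 * r (w i) : SignType) : ℝ)) ha
      (h.mono fun n hn => by simpa using hn)
    simpa only [runs, orientation, Set.mem_ofPred_eq] using this

theorem notMem_runs_of_linear_growth (h : ∃ a > 0, ∀ᶠ n : ℕ in atTop,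
      a * n ≤ ∑ i ∈ Finset.range n, -((r (w i) : SignType) : ℝ)) :
    w ∉ O.runs (fun v => O.orientation * r v) := by
  obtain ⟨a, ha, h⟩ := h
  cases O
  · have := liminf_eq_top_of_linear_growth ha h
    simp only [runs, orientation, Set.mem_ofPred_eq]
    intro h2
    have h3 : (⊤ : EReal) = ⊥ := by
      rw [← this, ← h2]
      simp
    exact absurd h3 top_ne_bot
  · have := liminf_eq_bot_of_linear_growth
      (S := fun n => ∑ i ∈ Finset.range n, ((r (w i) : SignType) : ℝ)) ha
      (h.mono fun n hn => by simpa using hn)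
    simp only [runs, orientation, Set.mem_ofPred_eq]
    intro h2
    have h3 : (⊤ : EReal) = ⊥ := by
      rw [← this, ← h2]
      simp
    exact absurd h3 top_ne_bot
  · have := liminf_div_nonpos_of_linear_growth
      (S := fun n => ∑ i ∈ Finset.range n, ((r (w i) : SignType) : ℝ)) ha
      (h.mono fun n hn => by simpa using hn)
    simp only [runs, orientation, Set.mem_ofPred_eq]
    simpa using this

end LimitObjective

/-! ### Values of games with drift. -/

namespace SSG

variable {V : Type} [Fintype V] [MeasurableSpace V] [DiscreteMeasurableSpace V]

/-- Max moves optimally with respect to the potential `φ`; against every strategy of Min the drift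
is then at least `c` after every history. -/
theorem value_eq_one_of_drift (G : SSG V) (O : LimitObjective) (r : V → SignType) (s : V)
    (φ : V → ℝ) {c : ℝ} (hc : 0 < c)
    (h : ∀ v, c ≤ ((r v : SignType) : ℝ) + G.bellman φ v - φ v) :
    G.value (O.runs fun v => O.orientation * r v) s = 1 := by
  obtain ⟨m, hm, hmφ⟩ := G.exists_selection φ
  refine le_antisymm (iSup_le fun σ => iInf_le_of_le (G.positional Owner.min m hm) prob_le_one)
    (le_iSup_of_le (G.positional Owner.max m hm) (le_iInf fun π => ?_))
  have hae := G.ae_linear_growth (G.positional Owner.max m hm) π s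
    (fun v => ((r v : SignType) : ℝ)) φ hc fun n h' => by
      have h1 := G.bellman_le_sum_nextProb φ hm hmφ π h'
      have h2 := h h'.last
      simp only [add_sub_right_comm, mul_add, Finset.sum_add_distrib, ← Finset.sum_mul,
        G.sum_nextProb, one_mul]
      linarith
  have h3 : (O.runs fun v => O.orientation * r v) =ᵐ[G.runMeasure (G.positional Owner.max m hm) π s]
      Set.univ :=
    eventuallyEq_univ.2 (hae.mono fun w hw => O.mem_runs_of_linear_growth r hw)
  rw [measure_congr h3, measure_univ]

/-- The mirror image: Min moves optimally for `φ`, and linear growth is applied to the negated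
rewards and potential. One strategy of Min works against all strategies of Max. -/
theorem value_eq_zero_of_drift (G : SSG V) (O : LimitObjective) (r : V → SignType) (s : V)
    (φ : V → ℝ) {c : ℝ} (hc : 0 < c)
    (h : ∀ v, ((r v : SignType) : ℝ) + G.bellman φ v - φ v ≤ -c) :
    G.value (O.runs fun v => O.orientation * r v) s = 0 := by
  obtain ⟨m, hm, hmφ⟩ := G.exists_selection φ
  refine le_antisymm (iSup_le fun σ => iInf_le_of_le (G.positional Owner.min m hm) ?_) zero_le
  have hae := G.ae_linear_growth σ (G.positional Owner.min m hm) s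
    (fun v => -((r v : SignType) : ℝ)) (fun v => - φ v) hc fun n h' => by
      have h1 := G.sum_nextProb_le_bellman φ hm hmφ σ h'
      have h2 := h h'.last
      simp only [sub_eq_add_neg, mul_add, Finset.sum_add_distrib, ← Finset.sum_mul,
        G.sum_nextProb, one_mul, mul_neg, Finset.sum_neg_distrib]
      linarith
  have h3 : (O.runs fun v => O.orientation * r v) =ᵐ[G.runMeasure σ (G.positional Owner.min m hm) s]
      (∅ : Set (ℕ → V)) :=
    eventuallyEq_empty.2 (hae.mono fun w hw => O.notMem_runs_of_linear_growth r hw)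
  rw [measure_congr h3, measure_empty]

end SSG

section values

variable {V W : Type} [Fintype V] [DecidableEq V] [Fintype W] [MeasurableSpace V]
  [DiscreteMeasurableSpace V] [MeasurableSpace W] [DiscreteMeasurableSpace W]
  (G : SSG V) (s t : V) {L : ℕ} (e : W ≃ Vtx V) (O : LimitObjective) (w₀ : W)

open SSG

theorem value_reduced_eq_one (hL : G.gapBound < 2 ^ L) (hv : 1 / 2 ≤ G.value (reach t) s) :
    ((G.reduced s t L).comap e).value
      (O.runs fun w => O.orientation * baseReward (e w)) w₀ = 1 := by
  -- `gapBound` is positive, so `L = 0` is impossible; a coin with probability `1` would never start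
  -- a round.
  have hL1 : 1 ≤ L := by
    by_contra h0
    obtain rfl : L = 0 := by omega
    have := Finset.prod_pos fun (v : V) (_ : v ∈ Finset.univ) => G.commonDen_pos v
    have h5 : 0 < 5 ^ Fintype.card V * ∏ v, G.commonDen v := by positivity
    unfold gapBound at hL
    omega
  have hH : coin L * G.gapBound < 1 := by
    rw [coin, div_mul_eq_mul_div, one_mul, div_lt_one (by positivity)]
    exact_mod_cast hL
  have hbias := G.bias_pos_of_le_value s t hv (coin_pos L) (coin_lt_one hL1) hH
  have h4 := pow_pos (coin_pos L) 4
  refine ((G.reduced s t L).comap e).value_eq_one_of_drift O (fun w => baseReward (e w)) w₀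
    (fun w => G.potential s t L (e w)) (c := coin L ^ 4 / 2 * G.bias s t (coin L))
    (by positivity) fun w => ?_
  obtain ⟨m, hm, h⟩ := G.drift_reduced s t hL1 (e w)
  rw [bellman_comap, h]
  exact mul_le_mul_of_nonneg_right hm hbias.le

theorem value_reduced_eq_zero (hL : G.gapBound < 2 ^ L) (hv : ¬ 1 / 2 ≤ G.value (reach t) s) :
    ((G.reduced s t L).comap e).value
      (O.runs fun w => O.orientation * baseReward (e w)) w₀ = 0 := by
  have hL1 : 1 ≤ L := by
    by_contra h0
    obtain rfl : L = 0 := by omega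
    have := Finset.prod_pos fun (v : V) (_ : v ∈ Finset.univ) => G.commonDen_pos v
    have h5 : 0 < 5 ^ Fintype.card V * ∏ v, G.commonDen v := by positivity
    unfold gapBound at hL
    omega
  have hH : coin L * G.gapBound < 1 := by
    rw [coin, div_mul_eq_mul_div, one_mul, div_lt_one (by positivity)]
    exact_mod_cast hL
  have hbias := G.bias_neg_of_value_lt s t hv (coin_pos L) (coin_lt_one hL1) hH
  have h4 := pow_pos (coin_pos L) 4
  refine ((G.reduced s t L).comap e).value_eq_zero_of_drift O (fun w => baseReward (e w)) w₀
    (fun w => G.potential s t L (e w)) (c := -(coin L ^ 4 / 2 * G.bias s t (coin L)))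
    (by nlinarith) fun w => ?_
  obtain ⟨m, hm, h⟩ := G.drift_reduced s t hL1 (e w)
  rw [bellman_comap, h, neg_neg]
  exact mul_le_mul_of_nonpos_right hm hbias.le

end values

end SSGames

namespace SSGames

/-! ### The Turing machine -/

namespace Machine

open Turing

/-- The stacks of the machine. -/
inductive K
  | inp
  | out
  -- The reversed input, which makes rows and cells appear last first, as suits an output built from
  -- its end.
  | rev
  -- One symbol per input symbol: the exponent `L` in unary. The contents move to `cnt₂` and back
  -- whenever a number is written.
  | cnt
  | cnt₂
  -- One symbol for each cell of the current row.
  | cells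
  -- The start flags of the rows already treated, hence of the vertices behind the current one; the
  -- height locates the diagonal cell.
  | marks
  | marks₂
  deriving DecidableEq

instance : Fintype K where
  elems := {K.inp, K.out, K.rev, K.cnt, K.cnt₂, K.cells, K.marks, K.marks₂}
  complete := by rintro (_ | _ | _ | _ | _ | _ | _ | _) <;> decide

/-- The places to which the subroutine that writes large numbers returns. -/
inductive Ret
  | diag (fs : Bool)
  | delta (ft fs : Bool)
  | hit (fs : Bool)
  | tail (g : Bool)
  | head (g : Bool)
  deriving Fintype

/-- The labels of the program. -/
inductive Label
  | read
  | row
  | cell (afterFlag : Bool)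
  | flags (ft : Bool)
  | owner (ft fs : Bool)
  | before (ft fs : Bool)
  | rest (ft fs : Bool)
  | restore (fs : Bool)
  | turn (g : Bool)
  | num (d f : Bool) (r : Ret)
  | den (d f : Bool) (r : Ret)
  | nom (d f : Bool) (r : Ret)
  | ret (r : Ret)
  | clean
  deriving Fintype

/-- The statements of the machine. -/
abbrev Stm : Type := TM2.Stmt (fun _ : K => Sym) Label (Option Sym)

/-- Write a word in front of the output. -/
def write : List Sym → Stm → Stm
  | [], q => q
  | a :: l, q => write l (TM2.Stmt.push K.out (fun _ => a) q)

/-- The code of the probability `0` of a pair of vertices without edge. -/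
def zeroCell : List Sym := [Sym.flag false, Sym.slash, Sym.bit true, Sym.endCell]

/-- Pop a symbol; continue with the first statement if there is one. -/
def popThen (k : K) (q q' : Stm) : Stm :=
  TM2.Stmt.pop k (fun _ x => x) (TM2.Stmt.branch Option.isSome q q')

/-- Push the symbol that was popped last. -/
def pushBack (k : K) (q : Stm) : Stm := TM2.Stmt.push k (fun r => r.getD Sym.slash) q

/-- Go to a fixed label. -/
def jump (l : Label) : Stm := TM2.Stmt.goto fun _ => l

/-- The program; `o` is the reward at `good`. -/
def program (o : SignType) : Label → Stm
  | Label.read => popThen K.inp (pushBack K.rev (pushBack K.cnt (jump Label.read))) (jump Label.row)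
  | Label.row => popThen K.rev (write [Sym.endRow] (jump (Label.cell false)))
      (jump (Label.turn false))
  -- A backward scan meets the flag of a cell last. A flag directly after such a flag therefore
  -- belongs to the header of the row, which is what `a` detects. Each copied cell leads to `pre u`
  -- and is followed by an empty cell for `main u`.
  | Label.cell a => TM2.Stmt.pop K.rev (fun _ x => x)
      (TM2.Stmt.branch (fun r => r = some Sym.endCell)
        (write (Sym.endCell :: zeroCell) (pushBack K.cells (jump (Label.cell false))))
        (TM2.Stmt.branch (fun r => r = some (Sym.flag true) ∨ r = some (Sym.flag false))
          (if a then TM2.Stmt.goto fun r => Label.flags (r = some (Sym.flag true))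
            else pushBack K.out (jump (Label.cell true)))
          (pushBack K.out (jump (Label.cell false)))))
  | Label.flags ft => TM2.Stmt.pop K.rev (fun _ x => x)
      (TM2.Stmt.goto fun r => Label.owner ft (r = some (Sym.flag true)))
  | Label.owner ft fs => TM2.Stmt.pop K.rev (fun _ x => x)
      (write (Sym.flag false :: Sym.reward 0 :: (zeroCell ++ zeroCell))
        (pushBack K.out (write [Sym.endRow] (jump (Label.before ft fs)))))
  -- Empty pairs of cells for the vertices behind `v`, then the pair of `v` itself; `rest` continues
  -- with the vertices in front of `v`.
  | Label.before ft fs => popThen K.marks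
      (pushBack K.marks₂ (TM2.Stmt.pop K.cells (fun _ x => x)
        (write (zeroCell ++ zeroCell) (jump (Label.before ft fs)))))
      (TM2.Stmt.pop K.cells (fun _ x => x)
        (if ft then write (zeroCell ++ zeroCell) (jump (Label.rest true fs))
          else jump (Label.num true true (Ret.diag fs))))
  | Label.rest ft fs => popThen K.cells (write (zeroCell ++ zeroCell) (jump (Label.rest ft fs)))
      (jump (Label.num true false (Ret.delta ft fs)))
  | Label.restore fs => popThen K.marks₂ (pushBack K.marks (jump (Label.restore fs)))
      (TM2.Stmt.push K.marks (fun _ => Sym.flag fs) (jump Label.row))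
  | Label.turn g => popThen K.marks (pushBack K.marks₂ (jump (Label.turn g)))
      (write [Sym.endRow] (jump (Label.ret (Ret.tail g))))
  | Label.num d f r => write [Sym.bit true, Sym.endCell] (jump (Label.den d f r))
  -- Least significant bits come first, so a power of two is a block of zeros closed by the one that
  -- `num` has already written. The numerator is a single one or, for the complement, a block of
  -- ones.
  | Label.den d f r => popThen K.cnt
      (pushBack K.cnt₂ (write (if d then [Sym.bit false, Sym.bit false] else [Sym.bit false])
        (jump (Label.den d f r))))
      (write (if f then [Sym.slash] else [Sym.bit true, Sym.slash]) (jump (Label.nom d f r)))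
  | Label.nom d f r => popThen K.cnt₂
      (pushBack K.cnt (write
        (if f then (if d then [Sym.bit true, Sym.bit true] else [Sym.bit true]) else [])
        (jump (Label.nom d f r))))
      (write [Sym.flag true] (jump (Label.ret r)))
  | Label.ret (Ret.diag fs) => write zeroCell (jump (Label.rest false fs))
  | Label.ret (Ret.delta ft fs) =>
      if ft then jump (Label.num true true (Ret.hit fs))
        else write zeroCell (jump (Label.ret (Ret.hit fs)))
  | Label.ret (Ret.hit fs) =>
      write [Sym.owner Owner.random, Sym.flag false, Sym.reward 0] (jump (Label.restore fs))
  -- The row of `bad` (`g = false`) is written before that of `good`, so only the first pass has to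
  -- restore `marks`.
  | Label.ret (Ret.tail g) => popThen K.marks₂
      ((if g then id else pushBack K.marks)
        (TM2.Stmt.branch (fun r => r = some (Sym.flag true))
          (write zeroCell (jump (Label.num false true (Ret.tail g))))
          (write (zeroCell ++ zeroCell) (jump (Label.ret (Ret.tail g))))))
      (write zeroCell (jump (Label.num false false (Ret.head g))))
  | Label.ret (Ret.head g) =>
      write [Sym.owner Owner.random, Sym.flag g, Sym.reward (if g then o else -o)]
        (jump (if g then Label.clean else Label.turn true))
  -- A halting configuration requires empty stacks apart from the output, and the initial state of
  -- the register.
  | Label.clean => popThen K.cnt (jump Label.clean)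
      (TM2.Stmt.load (fun _ => none) TM2.Stmt.halt)

/-- The contents of the stacks. -/
structure Stacks where
  inp : List Sym
  out : List Sym
  rev : List Sym
  cnt : List Sym
  cnt₂ : List Sym
  cells : List Sym
  marks : List Sym
  marks₂ : List Sym

namespace Stacks

/-- The stacks as a function of their index. -/
def get (S : Stacks) : K → List Sym
  | K.inp => S.inp
  | K.out => S.out
  | K.rev => S.rev
  | K.cnt => S.cnt
  | K.cnt₂ => S.cnt₂
  | K.cells => S.cells
  | K.marks => S.marks
  | K.marks₂ => S.marks₂

/-- Replace the contents of one stack. -/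
def set (S : Stacks) (k : K) (l : List Sym) : Stacks :=
  match k with
  | K.inp => { S with inp := l }
  | K.out => { S with out := l }
  | K.rev => { S with rev := l }
  | K.cnt => { S with cnt := l }
  | K.cnt₂ => { S with cnt₂ := l }
  | K.cells => { S with cells := l }
  | K.marks => { S with marks := l }
  | K.marks₂ => { S with marks₂ := l }

theorem update_get (S : Stacks) (k : K) (l : List Sym) :
    Function.update S.get k l = (S.set k l).get := by
  funext k'
  cases k <;> cases k' <;> rfl

end Stacks

/-- The configurations of the machine. -/
abbrev Cfg : Type := TM2.Cfg (fun _ : K => Sym) Label (Option Sym)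

/-- A configuration given by a label, the last popped symbol and the stacks. -/
def cfg (l : Option Label) (r : Option Sym) (S : Stacks) : Cfg := ⟨l, r, S.get⟩

/-! ### Symbolic execution of the statements. -/

section exec

variable {r : Option Sym} {S : Stacks} {q q' : Stm}

theorem stepAux_write (w : List Sym) : TM2.stepAux (write w q) r S.get =
    TM2.stepAux q r (S.set K.out (w ++ S.out)).get := by
  induction w generalizing S q with
  | nil => rfl
  | cons a w ih => rw [write, ih, TM2.stepAux, Stacks.update_get]; rfl

theorem stepAux_pushBack (k : K) : TM2.stepAux (pushBack k q) r S.get =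
    TM2.stepAux q r (S.set k (r.getD Sym.slash :: S.get k)).get := by
  rw [pushBack, TM2.stepAux, Stacks.update_get]

theorem stepAux_push (k : K) (a : Sym) : TM2.stepAux (TM2.Stmt.push k (fun _ => a) q) r S.get =
    TM2.stepAux q r (S.set k (a :: S.get k)).get := by
  rw [TM2.stepAux, Stacks.update_get]

theorem stepAux_pop (k : K) : TM2.stepAux (TM2.Stmt.pop k (fun _ x => x) q) r S.get =
    TM2.stepAux q (S.get k).head? (S.set k (S.get k).tail).get := by
  rw [TM2.stepAux, Stacks.update_get]

theorem stepAux_popThen_cons {k : K} {a : Sym} {l : List Sym} (h : S.get k = a :: l) :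
    TM2.stepAux (popThen k q q') r S.get = TM2.stepAux q (some a) (S.set k l).get := by
  rw [popThen, stepAux_pop, h]
  rfl

theorem stepAux_popThen_nil {k : K} (h : S.get k = []) :
    TM2.stepAux (popThen k q q') r S.get = TM2.stepAux q' none S.get := by
  rw [popThen, stepAux_pop, h]
  have : S.set k [] = S := by
    cases k <;> simp only [Stacks.set, Stacks.get] at h ⊢ <;> rw [← h]
  rw [List.tail_nil, this]
  rfl

theorem stepAux_jump (l : Label) : TM2.stepAux (jump l) r S.get = cfg (some l) r S := rfl

end exec

/-- Starting from the label `l` with the stacks `S`, the machine arrives at the label `l'` with the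
stacks `S'` after at most `m` steps.  It forgets the last popped symbol before it halts. -/
def Runs (o : SignType) (m : ℕ) (l : Label) (S : Stacks) (l' : Option Label) (S' : Stacks) : Prop :=
  ∀ r, ∃ r' k, k ≤ m ∧ (l' = none → r' = none) ∧
    (flip Bind.bind (TM2.step (program o)))^[k] (some (cfg (some l) r S)) =
    some (cfg l' r' S')

variable {o : SignType}

theorem Runs.of_step {l : Label} {S S' : Stacks} {l' : Label}
    (h : ∀ r, ∃ r', TM2.stepAux (program o l) r S.get = cfg (some l') r' S') :
    Runs o 1 l S (some l') S' := by
  intro r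
  obtain ⟨r', h⟩ := h r
  exact ⟨r', 1, le_rfl, nofun, congrArg some h⟩

theorem Runs.of_halt {l : Label} {S S' : Stacks}
    (h : ∀ r, TM2.stepAux (program o l) r S.get = cfg none none S') : Runs o 1 l S none S' :=
  fun r => ⟨none, 1, le_rfl, fun _ => rfl, congrArg some (h r)⟩

theorem Runs.refl (l : Label) (S : Stacks) : Runs o 0 l S (some l) S :=
  fun r => ⟨r, 0, le_rfl, nofun, rfl⟩

theorem Runs.trans {m m' : ℕ} {l l' : Label} {l'' : Option Label} {S S' S'' : Stacks}
    (h : Runs o m l S (some l') S') (h' : Runs o m' l' S' l'' S'') :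
    Runs o (m + m') l S l'' S'' := by
  intro r
  obtain ⟨r', k, hk, -, h⟩ := h r
  obtain ⟨r'', k', hk', hr, h'⟩ := h' r'
  refine ⟨r'', k' + k, by omega, hr, ?_⟩
  rw [Function.iterate_add_apply, h, h']

theorem Runs.congr {m : ℕ} {l : Label} {l' : Option Label} {S S' S'' : Stacks}
    (h : Runs o m l S l' S') (e : S' = S'') : Runs o m l S l' S'' := e ▸ h

theorem Runs.mono {m m' : ℕ} {l : Label} {l' : Option Label} {S S' : Stacks}
    (h : Runs o m l S l' S') (hm : m ≤ m') : Runs o m' l S l' S' := by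
  intro r
  obtain ⟨r', k, hk, h⟩ := h r
  exact ⟨r', k, hk.trans hm, h⟩

/-! #### Writing large numbers -/

/-- The words written by the subroutine for large numbers. -/
def numWord (d f : Bool) (p : ℕ) : List Sym :=
  Sym.flag true :: ((if f then List.replicate (if d then 2 * p else p) (Sym.bit true)
    else [Sym.bit true]) ++ Sym.slash :: (List.replicate (if d then 2 * p else p) (Sym.bit false) ++
      [Sym.bit true, Sym.endCell]))

variable {i w v A B C m m₂ : List Sym}

theorem replicate_append_cons (a : Sym) (n : ℕ) (l : List Sym) :
    List.replicate n a ++ a :: l = List.replicate (n + 1) a ++ l := by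
  rw [List.replicate_add, List.append_assoc]
  rfl

theorem runs_den (d f : Bool) (t : Ret) :
    Runs o (A.length + 1) (Label.den d f t) ⟨i, w, v, A, B, C, m, m₂⟩ (some (Label.nom d f t))
      ⟨i, (if f then [Sym.slash] else [Sym.bit true, Sym.slash]) ++
          (List.replicate (if d then 2 * A.length else A.length) (Sym.bit false) ++ w),
        v, [], A.reverse ++ B, C, m, m₂⟩ := by
  induction A generalizing w B with
  | nil =>
    refine Runs.of_step fun r => ⟨none, ?_⟩
    rw [program, stepAux_popThen_nil rfl, stepAux_write, stepAux_jump]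
    cases d <;> rfl
  | cons a A ih =>
    have h1 : Runs o 1 (Label.den d f t) ⟨i, w, v, a :: A, B, C, m, m₂⟩ (some (Label.den d f t))
        ⟨i, (if d then [Sym.bit false, Sym.bit false] else [Sym.bit false]) ++ w, v, A, a :: B, C,
          m, m₂⟩ := by
      refine Runs.of_step fun r => ⟨some a, ?_⟩
      rw [program, stepAux_popThen_cons (a := a) (l := A) rfl, stepAux_pushBack, stepAux_write,
        stepAux_jump]
      rfl
    refine ((h1.trans ih).mono (by simp; omega)).congr ?_
    cases d <;> simp [replicate_append_cons, mul_add]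

theorem runs_nom (d f : Bool) (t : Ret) :
    Runs o (B.length + 1) (Label.nom d f t) ⟨i, w, v, A, B, C, m, m₂⟩ (some (Label.ret t))
      ⟨i, Sym.flag true :: ((if f then List.replicate (if d then 2 * B.length else B.length)
          (Sym.bit true) else []) ++ w), v, B.reverse ++ A, [], C, m, m₂⟩ := by
  induction B generalizing w A with
  | nil =>
    refine Runs.of_step fun r => ⟨none, ?_⟩
    rw [program, stepAux_popThen_nil rfl, stepAux_write, stepAux_jump]
    cases d <;> cases f <;> rfl
  | cons a B ih =>
    have h1 : Runs o 1 (Label.nom d f t) ⟨i, w, v, A, a :: B, C, m, m₂⟩ (some (Label.nom d f t))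
        ⟨i, (if f then (if d then [Sym.bit true, Sym.bit true] else [Sym.bit true]) else []) ++ w,
          v, a :: A, B, C, m, m₂⟩ := by
      refine Runs.of_step fun r => ⟨some a, ?_⟩
      rw [program, stepAux_popThen_cons (a := a) (l := B) rfl, stepAux_pushBack, stepAux_write,
        stepAux_jump]
      rfl
    refine ((h1.trans ih).mono (by simp; omega)).congr ?_
    cases d <;> cases f <;> simp [replicate_append_cons, mul_add]

theorem runs_num (d f : Bool) (t : Ret) :
    Runs o (2 * A.length + 3) (Label.num d f t) ⟨i, w, v, A, [], C, m, m₂⟩ (some (Label.ret t))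
      ⟨i, numWord d f A.length ++ w, v, A, [], C, m, m₂⟩ := by
  have h1 : Runs o 1 (Label.num d f t) ⟨i, w, v, A, [], C, m, m₂⟩ (some (Label.den d f t))
      ⟨i, [Sym.bit true, Sym.endCell] ++ w, v, A, [], C, m, m₂⟩ := by
    refine Runs.of_step fun r => ⟨r, ?_⟩
    rw [program, stepAux_write, stepAux_jump]
    rfl
  refine (((h1.trans (runs_den d f t)).trans (runs_nom d f t)).mono (by simp; omega)).congr ?_
  cases d <;> cases f <;> simp [numWord]

/-! #### Reading a row -/

theorem runs_read (I : List Sym) :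
    Runs o (I.length + 1) Label.read ⟨I, w, v, A, B, C, m, m₂⟩ (some Label.row)
      ⟨[], w, I.reverse ++ v, I.reverse ++ A, B, C, m, m₂⟩ := by
  induction I generalizing v A with
  | nil =>
    refine Runs.of_step fun r => ⟨none, ?_⟩
    rw [program, stepAux_popThen_nil rfl, stepAux_jump]
    rfl
  | cons a I ih =>
    have h1 : Runs o 1 Label.read ⟨a :: I, w, v, A, B, C, m, m₂⟩ (some Label.read)
        ⟨I, w, a :: v, a :: A, B, C, m, m₂⟩ := by
      refine Runs.of_step fun r => ⟨some a, ?_⟩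
      rw [program, stepAux_popThen_cons (a := a) (l := I) rfl, stepAux_pushBack, stepAux_pushBack,
        stepAux_jump]
      rfl
    refine ((h1.trans ih).mono (by simp; omega)).congr ?_
    simp

theorem runs_copy (l : List Sym)
    (hl : ∀ x ∈ l, x ≠ Sym.endCell ∧ x ≠ Sym.flag true ∧ x ≠ Sym.flag false) :
    Runs o l.length (Label.cell false) ⟨i, w, l ++ v, A, B, C, m, m₂⟩ (some (Label.cell false))
      ⟨i, l.reverse ++ w, v, A, B, C, m, m₂⟩ := by
  induction l generalizing w with
  | nil => exact Runs.refl _ _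
  | cons a l ih =>
    have h1 : Runs o 1 (Label.cell false) ⟨i, w, a :: l ++ v, A, B, C, m, m₂⟩
        (some (Label.cell false)) ⟨i, a :: w, l ++ v, A, B, C, m, m₂⟩ := by
      refine Runs.of_step fun r => ⟨some a, ?_⟩
      obtain ⟨h2, h3, h4⟩ := hl a (by simp)
      rw [program, stepAux_pop, TM2.stepAux, TM2.stepAux]
      simp only [Stacks.get, List.cons_append, List.head?_cons, Option.some.injEq, h2, h3, h4,
        or_false, decide_false, cond_false]
      exact (stepAux_pushBack K.out).trans rfl
    refine ((h1.trans (ih fun x hx => hl x (by simp [hx]))).mono (by simp; omega)).congr ?_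
    simp

/-- The result is again at `cell true` whatever `a` was, because a cell begins, when read backwards,
with `endCell`; so the lemma iterates over a row. -/
theorem runs_cell (a : Bool) (c : Bool × ℚ≥0) :
    Runs o (encodeCell c).length (Label.cell a) ⟨i, w, (encodeCell c).reverse ++ v, A, B, C, m, m₂⟩
      (some (Label.cell true))
      ⟨i, encodeCell c ++ (zeroCell ++ w), v, A, B, Sym.endCell :: C, m, m₂⟩ := by
  obtain ⟨b, q⟩ := c
  set l : List Sym := q.num.bits.map Sym.bit ++ Sym.slash :: q.den.bits.map Sym.bit with hl
  have hq : encodeCell (b, q) = Sym.flag b :: (l ++ [Sym.endCell]) := by simp [encodeCell, hl]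
  have h1 : Runs o 1 (Label.cell a) ⟨i, w, (encodeCell (b, q)).reverse ++ v, A, B, C, m, m₂⟩
      (some (Label.cell false))
      ⟨i, Sym.endCell :: zeroCell ++ w, l.reverse ++ (Sym.flag b :: v), A, B, Sym.endCell :: C, m,
        m₂⟩ := by
    refine Runs.of_step fun r => ⟨some Sym.endCell, ?_⟩
    rw [hq, program, stepAux_pop, TM2.stepAux]
    simp only [Stacks.get, List.reverse_cons, List.reverse_append, List.reverse_nil,
      List.nil_append, List.cons_append, List.append_assoc, List.head?_cons, decide_true, cond_true]
    rw [stepAux_write, stepAux_pushBack, stepAux_jump]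
    rfl
  have h2 := runs_copy (o := o) (i := i) (w := Sym.endCell :: zeroCell ++ w) (v := Sym.flag b :: v)
    (A := A) (B := B) (C := Sym.endCell :: C) (m := m) (m₂ := m₂) l.reverse (by simp [hl]; grind)
  have h3 : Runs o 1 (Label.cell false)
      ⟨i, l.reverse.reverse ++ (Sym.endCell :: zeroCell ++ w), Sym.flag b :: v, A, B,
        Sym.endCell :: C, m, m₂⟩ (some (Label.cell true))
      ⟨i, encodeCell (b, q) ++ (zeroCell ++ w), v, A, B, Sym.endCell :: C, m, m₂⟩ := by
    refine Runs.of_step fun r => ⟨some (Sym.flag b), ?_⟩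
    rw [hq, program, stepAux_pop, TM2.stepAux, TM2.stepAux]
    cases b <;> simp [Stacks.set, Stacks.get, stepAux_pushBack, stepAux_jump]
  refine ((h1.trans h2).trans h3).mono ?_
  rw [hq]
  simp
  omega

end Machine

end SSGames

namespace SSGames

namespace Machine

open Turing

variable {o : SignType} {i w v A B C m m₂ : List Sym}

theorem runs_cells (cs : List (Bool × ℚ≥0)) (hcs : cs ≠ []) (a : Bool) :
    Runs o (cs.flatMap encodeCell).length (Label.cell a)
      ⟨i, w, (cs.flatMap encodeCell).reverse ++ v, A, B, C, m, m₂⟩ (some (Label.cell true))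
      ⟨i, cs.flatMap (fun c => encodeCell c ++ zeroCell) ++ w, v, A, B,
        List.replicate cs.length Sym.endCell ++ C, m, m₂⟩ := by
  induction cs using List.reverseRecOn generalizing w C a with
  | nil => exact absurd rfl hcs
  | append_singleton cs c ih =>
    have h1 := runs_cell (o := o) (i := i) (w := w) (v := (cs.flatMap encodeCell).reverse ++ v)
      (A := A) (B := B) (C := C) (m := m) (m₂ := m₂) a c
    by_cases h : cs = []
    · subst h
      simpa using h1
    · have h2 := h1.trans (ih h true)
      refine Runs.congr (Runs.mono (by simpa using h2) (by simp; omega)) ?_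
      simp [replicate_append_cons]

theorem runs_header (ow : Owner) (ft fs : Bool) :
    Runs o 3 (Label.cell true)
      ⟨i, w, Sym.flag ft :: Sym.flag fs :: Sym.owner ow :: v, A, B, C, m, m₂⟩
      (some (Label.before ft fs))
      ⟨i, Sym.endRow :: Sym.owner ow :: Sym.flag false :: Sym.reward 0 ::
        (zeroCell ++ (zeroCell ++ w)), v, A, B, C, m, m₂⟩ := by
  have h1 : Runs o 1 (Label.cell true)
      ⟨i, w, Sym.flag ft :: Sym.flag fs :: Sym.owner ow :: v, A, B, C, m, m₂⟩
      (some (Label.flags ft)) ⟨i, w, Sym.flag fs :: Sym.owner ow :: v, A, B, C, m, m₂⟩ := by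
    refine Runs.of_step fun r => ⟨some (Sym.flag ft), ?_⟩
    rw [program, stepAux_pop, TM2.stepAux, TM2.stepAux]
    cases ft <;> simp [Stacks.set, Stacks.get, cfg]
  have h2 : Runs o 1 (Label.flags ft) ⟨i, w, Sym.flag fs :: Sym.owner ow :: v, A, B, C, m, m₂⟩
      (some (Label.owner ft fs)) ⟨i, w, Sym.owner ow :: v, A, B, C, m, m₂⟩ := by
    refine Runs.of_step fun r => ⟨some (Sym.flag fs), ?_⟩
    rw [program, stepAux_pop]
    cases fs <;> simp [Stacks.set, Stacks.get, cfg]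
  have h3 : Runs o 1 (Label.owner ft fs) ⟨i, w, Sym.owner ow :: v, A, B, C, m, m₂⟩
      (some (Label.before ft fs))
      ⟨i, Sym.endRow :: Sym.owner ow :: Sym.flag false :: Sym.reward 0 ::
        (zeroCell ++ (zeroCell ++ w)), v, A, B, C, m, m₂⟩ := by
    refine Runs.of_step fun r => ⟨some (Sym.owner ow), ?_⟩
    rw [program, stepAux_pop, stepAux_write, stepAux_pushBack, stepAux_write, stepAux_jump]
    rfl
  exact (h1.trans h2).trans h3

/-! #### Writing the rows of the vertices in front -/

/-- The code of a sequence of pairs of vertices without edge. -/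
def zeroCells (k : ℕ) : List Sym := (List.replicate k (zeroCell ++ zeroCell)).flatten

theorem zeroCells_append_cons (k : ℕ) (l : List Sym) :
    zeroCells k ++ (zeroCell ++ (zeroCell ++ l)) = zeroCells (k + 1) ++ l := by
  simp [zeroCells, List.replicate_succ']

/-- The edge from a vertex in front to its main vertex or to `good`. -/
def frontCell (b : Bool) (p : ℕ) : List Sym := if b then numWord true true p else zeroCell

/-- `cells` holds one symbol for each vertex of the row: `m.length` for those behind the current
vertex, one for the vertex itself and `k` for those in front of it. -/
theorem runs_before (ft fs : Bool) (k : ℕ) :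
    Runs o (m.length + 2 * A.length + 5) (Label.before ft fs)
      ⟨i, w, v, A, [], List.replicate (m.length + (k + 1)) Sym.endCell, m, m₂⟩
      (some (Label.rest ft fs))
      ⟨i, zeroCell ++ (frontCell (!ft) A.length ++ (zeroCells m.length ++ w)), v, A, [],
        List.replicate k Sym.endCell, [], m.reverse ++ m₂⟩ := by
  induction m generalizing w m₂ with
  | nil =>
    cases ft with
    | true =>
      refine Runs.mono (Runs.of_step (S' := ⟨i, _, v, A, [], List.replicate k Sym.endCell, [], m₂⟩)
        fun r => ⟨some Sym.endCell, ?_⟩) (by omega)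
      rw [program, stepAux_popThen_nil rfl, stepAux_pop, if_pos rfl, stepAux_write, stepAux_jump]
      simp [List.replicate_succ, Stacks.set, Stacks.get, frontCell, zeroCells]
    | false =>
      have h1 : Runs o 1 (Label.before false fs)
          ⟨i, w, v, A, [], List.replicate (0 + (k + 1)) Sym.endCell, [], m₂⟩
          (some (Label.num true true (Ret.diag fs)))
          ⟨i, w, v, A, [], List.replicate k Sym.endCell, [], m₂⟩ := by
        refine Runs.of_step fun r => ⟨some Sym.endCell, ?_⟩
        rw [program, stepAux_popThen_nil rfl, stepAux_pop]
        simp [List.replicate_succ, Stacks.set, Stacks.get, stepAux_jump]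
      have h2 : Runs o 1 (Label.ret (Ret.diag fs))
          ⟨i, numWord true true A.length ++ w, v, A, [], List.replicate k Sym.endCell, [], m₂⟩
          (some (Label.rest false fs))
          ⟨i, zeroCell ++ (numWord true true A.length ++ w), v, A, [],
            List.replicate k Sym.endCell, [], m₂⟩ := by
        refine Runs.of_step fun r => ⟨r, ?_⟩
        rw [program, stepAux_write, stepAux_jump]
        rfl
      refine (((h1.trans (runs_num _ _ _)).trans h2).mono (by simp; omega)).congr ?_
      simp [frontCell, zeroCells]
  | cons a m ih =>
    have h1 : Runs o 1 (Label.before ft fs)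
        ⟨i, w, v, A, [], List.replicate ((a :: m).length + (k + 1)) Sym.endCell, a :: m, m₂⟩
        (some (Label.before ft fs))
        ⟨i, zeroCell ++ (zeroCell ++ w), v, A, [],
          List.replicate (m.length + (k + 1)) Sym.endCell, m, a :: m₂⟩ := by
      refine Runs.of_step fun r => ⟨some Sym.endCell, ?_⟩
      rw [program, stepAux_popThen_cons (a := a) (l := m) rfl, stepAux_pushBack, stepAux_pop,
        stepAux_write, stepAux_jump, List.length_cons,
        show m.length + 1 + (k + 1) = m.length + (k + 1) + 1 by omega, List.replicate_succ]
      rfl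
    refine ((h1.trans ih).mono (by simp; omega)).congr ?_
    simp [zeroCells_append_cons]

theorem runs_rest (ft fs : Bool) (k : ℕ) (x : Sym) :
    Runs o (k + 1) (Label.rest ft fs) ⟨i, w, v, A, B, List.replicate k x, m, m₂⟩
      (some (Label.num true false (Ret.delta ft fs)))
      ⟨i, zeroCells k ++ w, v, A, B, [], m, m₂⟩ := by
  induction k generalizing w with
  | zero =>
    refine Runs.of_step fun r => ⟨none, ?_⟩
    rw [program, stepAux_popThen_nil rfl, stepAux_jump]
    rfl
  | succ k ih =>
    have h1 : Runs o 1 (Label.rest ft fs) ⟨i, w, v, A, B, List.replicate (k + 1) x, m, m₂⟩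
        (some (Label.rest ft fs))
        ⟨i, zeroCell ++ (zeroCell ++ w), v, A, B, List.replicate k x, m, m₂⟩ := by
      refine Runs.of_step fun r => ⟨some x, ?_⟩
      rw [program, stepAux_popThen_cons (a := x) (l := List.replicate k x) rfl, stepAux_write,
        stepAux_jump]
      rfl
    refine ((h1.trans ih).mono (by omega)).congr ?_
    rw [zeroCells_append_cons]

theorem runs_delta (ft fs : Bool) :
    Runs o (4 * A.length + 8) (Label.num true false (Ret.delta ft fs))
      ⟨i, w, v, A, [], C, m, m₂⟩ (some (Label.restore fs))
      ⟨i, Sym.owner Owner.random :: Sym.flag false :: Sym.reward 0 ::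
        (frontCell ft A.length ++ (numWord true false A.length ++ w)), v, A, [], C, m, m₂⟩ := by
  have h1 := runs_num (o := o) (i := i) (w := w) (v := v) (A := A) (C := C) (m := m) (m₂ := m₂)
    true false (Ret.delta ft fs)
  have h2 : Runs o (2 * A.length + 4) (Label.ret (Ret.delta ft fs))
      ⟨i, numWord true false A.length ++ w, v, A, [], C, m, m₂⟩ (some (Label.ret (Ret.hit fs)))
      ⟨i, frontCell ft A.length ++ (numWord true false A.length ++ w), v, A, [], C, m, m₂⟩ := by
    cases ft with
    | true =>
      have h3 : Runs o 1 (Label.ret (Ret.delta true fs))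
          ⟨i, numWord true false A.length ++ w, v, A, [], C, m, m₂⟩
          (some (Label.num true true (Ret.hit fs)))
          ⟨i, numWord true false A.length ++ w, v, A, [], C, m, m₂⟩ :=
        Runs.of_step fun r => ⟨r, rfl⟩
      exact (h3.trans (runs_num _ _ _)).mono (by omega)
    | false =>
      refine Runs.mono (Runs.of_step fun r => ⟨r, ?_⟩) (by omega : 1 ≤ _)
      rw [program, if_neg (by simp), stepAux_write, stepAux_jump]
      rfl
  have h4 : Runs o 1 (Label.ret (Ret.hit fs))
      ⟨i, frontCell ft A.length ++ (numWord true false A.length ++ w), v, A, [], C, m, m₂⟩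
      (some (Label.restore fs))
      ⟨i, Sym.owner Owner.random :: Sym.flag false :: Sym.reward 0 ::
        (frontCell ft A.length ++ (numWord true false A.length ++ w)), v, A, [], C, m, m₂⟩ := by
    refine Runs.of_step fun r => ⟨r, ?_⟩
    rw [program, stepAux_write, stepAux_jump]
    rfl
  exact ((h1.trans h2).trans h4).mono (by omega)

theorem runs_restore (fs : Bool) :
    Runs o (m₂.length + 1) (Label.restore fs) ⟨i, w, v, A, B, C, m, m₂⟩ (some Label.row)
      ⟨i, w, v, A, B, C, Sym.flag fs :: (m₂.reverse ++ m), []⟩ := by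
  induction m₂ generalizing m with
  | nil =>
    refine Runs.of_step fun r => ⟨none, ?_⟩
    rw [program, stepAux_popThen_nil rfl, stepAux_push, stepAux_jump]
    rfl
  | cons a m₂ ih =>
    have h1 : Runs o 1 (Label.restore fs) ⟨i, w, v, A, B, C, m, a :: m₂⟩
        (some (Label.restore fs)) ⟨i, w, v, A, B, C, a :: m, m₂⟩ := by
      refine Runs.of_step fun r => ⟨some a, ?_⟩
      rw [program, stepAux_popThen_cons (a := a) (l := m₂) rfl, stepAux_pushBack, stepAux_jump]
      rfl
    refine ((h1.trans ih).mono (by simp; omega)).congr ?_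
    simp

/-- The two rows that are written for a vertex: the row of the vertex in front and the row of the
main vertex. -/
def rowPair (ow : Owner) (ft : Bool) (cs : List (Bool × ℚ≥0)) (k l p : ℕ) : List Sym :=
  (Sym.owner Owner.random :: Sym.flag false :: Sym.reward 0 ::
    (frontCell ft p ++ (numWord true false p ++ (zeroCells k ++
      (zeroCell ++ (frontCell (!ft) p ++ (zeroCells l ++ [Sym.endRow]))))))) ++
  (Sym.owner ow :: Sym.flag false :: Sym.reward 0 :: (zeroCell ++ (zeroCell ++
    (cs.flatMap (fun c => encodeCell c ++ zeroCell) ++ [Sym.endRow]))))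

/-- A row of the input. -/
def inputRow (ow : Owner) (fs ft : Bool) (cs : List (Bool × ℚ≥0)) : List Sym :=
  Sym.owner ow :: Sym.flag fs :: Sym.flag ft :: (cs.flatMap encodeCell ++ [Sym.endRow])

/-- The invariant between rows: auxiliary stacks are empty, the counter is intact, and `marks` has
grown by the start flag of the row. -/
theorem runs_row (ow : Owner) (fs ft : Bool) (cs : List (Bool × ℚ≥0)) (k : ℕ)
    (hk : cs.length = m.length + (k + 1)) :
    Runs o ((inputRow ow fs ft cs).length + 2 * cs.length + 6 * A.length + 15) Label.row
      ⟨i, w, (inputRow ow fs ft cs).reverse ++ v, A, [], [], m, []⟩ (some Label.row)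
      ⟨i, rowPair ow ft cs k m.length A.length ++ w, v, A, [], [], Sym.flag fs :: m, []⟩ := by
  have hcs : cs ≠ [] := by
    rintro rfl
    simp at hk
  have h1 : Runs o 1 Label.row
      ⟨i, w, (inputRow ow fs ft cs).reverse ++ v, A, [], [], m, []⟩ (some (Label.cell false))
      ⟨i, Sym.endRow :: w, (cs.flatMap encodeCell).reverse ++
        (Sym.flag ft :: Sym.flag fs :: Sym.owner ow :: v), A, [], [], m, []⟩ := by
    refine Runs.of_step fun r => ⟨some Sym.endRow, ?_⟩
    rw [program, stepAux_popThen_cons (a := Sym.endRow) (l := (cs.flatMap encodeCell).reverse ++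
        (Sym.flag ft :: Sym.flag fs :: Sym.owner ow :: v)) (by simp [Stacks.get, inputRow]),
      stepAux_write, stepAux_jump]
    rfl
  have h2 := (h1.trans (runs_cells cs hcs false)).trans (runs_header ow ft fs)
  rw [List.append_nil, hk] at h2
  have h3 := (((h2.trans (runs_before ft fs k)).trans (runs_rest ft fs k _)).trans
    (runs_delta ft fs)).trans (runs_restore fs)
  refine (h3.mono ?_).congr ?_
  · simp [inputRow]
    omega
  · simp [rowPair]

/-! #### Writing the first two rows -/

/-- The cells of the two vertices with rewards: the marked vertex is reached by the coin. -/
def coinCells (l : List Sym) (p : ℕ) : List Sym :=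
  l.flatMap fun x => (if x = Sym.flag true then numWord false true p else zeroCell) ++ zeroCell

theorem runs_turn (g : Bool) :
    Runs o (m.length + 1) (Label.turn g) ⟨i, w, v, A, B, C, m, m₂⟩
      (some (Label.ret (Ret.tail g)))
      ⟨i, Sym.endRow :: w, v, A, B, C, [], m.reverse ++ m₂⟩ := by
  induction m generalizing m₂ with
  | nil =>
    refine Runs.of_step fun r => ⟨none, ?_⟩
    rw [program, stepAux_popThen_nil rfl, stepAux_write, stepAux_jump]
    rfl
  | cons a m ih =>
    have h1 : Runs o 1 (Label.turn g) ⟨i, w, v, A, B, C, a :: m, m₂⟩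
        (some (Label.turn g)) ⟨i, w, v, A, B, C, m, a :: m₂⟩ := by
      refine Runs.of_step fun r => ⟨some a, ?_⟩
      rw [program, stepAux_popThen_cons (a := a) (l := m) rfl, stepAux_pushBack, stepAux_jump]
      rfl
    refine ((h1.trans ih).mono (by simp; omega)).congr ?_
    simp

theorem runs_tail (g : Bool) :
    Runs o (m₂.length * (2 * A.length + 4) + 1) (Label.ret (Ret.tail g))
      ⟨i, w, v, A, [], C, m, m₂⟩ (some (Label.num false false (Ret.head g)))
      ⟨i, zeroCell ++ (coinCells m₂.reverse A.length ++ w), v, A, [], C,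
        if g then m else m₂.reverse ++ m, []⟩ := by
  induction m₂ generalizing w m with
  | nil =>
    refine Runs.mono (Runs.of_step fun r => ⟨none, ?_⟩) (by omega : 1 ≤ _)
    rw [program, stepAux_popThen_nil rfl, stepAux_write, stepAux_jump]
    cases g <;> rfl
  | cons a m₂ ih =>
    have h1 : Runs o (2 * A.length + 4) (Label.ret (Ret.tail g))
        ⟨i, w, v, A, [], C, m, a :: m₂⟩ (some (Label.ret (Ret.tail g)))
        ⟨i, coinCells [a] A.length ++ w, v, A, [], C, if g then m else a :: m, m₂⟩ := by
      by_cases ha : a = Sym.flag true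
      · have h2 : Runs o 1 (Label.ret (Ret.tail g)) ⟨i, w, v, A, [], C, m, a :: m₂⟩
            (some (Label.num false true (Ret.tail g)))
            ⟨i, zeroCell ++ w, v, A, [], C, if g then m else a :: m, m₂⟩ := by
          refine Runs.of_step fun r => ⟨some a, ?_⟩
          rw [program, stepAux_popThen_cons (a := a) (l := m₂) rfl]
          cases g <;> simp [ha, Stacks.set, Stacks.get, stepAux_pushBack, stepAux_write,
            stepAux_jump]
        refine ((h2.trans (runs_num _ _ _)).mono (by omega)).congr ?_
        simp [coinCells, ha]
      · refine Runs.mono (Runs.of_step fun r => ⟨some a, ?_⟩) (by omega : 1 ≤ _)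
        rw [program, stepAux_popThen_cons (a := a) (l := m₂) rfl]
        cases g <;> simp [ha, Stacks.set, Stacks.get, stepAux_pushBack, stepAux_write,
          stepAux_jump, coinCells]
    refine ((h1.trans ih).mono (by simp; ring_nf; omega)).congr ?_
    cases g <;> simp [coinCells]

/-- The row of a vertex with a reward. -/
def rewardRow (g : Bool) (z : SignType) (l : List Sym) (p : ℕ) : List Sym :=
  Sym.owner Owner.random :: Sym.flag g :: Sym.reward z ::
    (numWord false false p ++ (zeroCell ++ (coinCells l p ++ [Sym.endRow])))

theorem runs_head (g : Bool) :
    Runs o (2 * A.length + 4) (Label.num false false (Ret.head g)) ⟨i, w, v, A, [], C, m, m₂⟩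
      (some (if g then Label.clean else Label.turn true))
      ⟨i, Sym.owner Owner.random :: Sym.flag g :: Sym.reward (if g then o else -o) ::
        (numWord false false A.length ++ w), v, A, [], C, m, m₂⟩ := by
  refine (runs_num _ _ _).trans (m' := 1) (Runs.of_step fun r => ⟨r, ?_⟩)
  rw [program, stepAux_write, stepAux_jump]
  rfl

theorem runs_clean :
    Runs o (A.length + 1) Label.clean ⟨i, w, v, A, B, C, m, m₂⟩ none
      ⟨i, w, v, [], B, C, m, m₂⟩ := by
  induction A with
  | nil =>
    refine Runs.of_halt fun r => ?_
    rw [program, stepAux_popThen_nil rfl]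
    rfl
  | cons a A ih =>
    have h1 : Runs o 1 Label.clean ⟨i, w, v, a :: A, B, C, m, m₂⟩
        (some Label.clean) ⟨i, w, v, A, B, C, m, m₂⟩ := by
      refine Runs.of_step fun r => ⟨some a, ?_⟩
      rw [program, stepAux_popThen_cons (a := a) (l := A) rfl, stepAux_jump]
      rfl
    exact (h1.trans ih).mono (by simp; omega)

theorem runs_reward_rows :
    Runs o (2 * (m.length * (2 * A.length + 5)) + 5 * A.length + 14) Label.row
      ⟨i, w, [], A, [], C, m, []⟩ none
      ⟨i, rewardRow true o m A.length ++ (rewardRow false (-o) m A.length ++ w), [], [], [], C, [],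
        []⟩ := by
  have h1 : Runs o 1 Label.row ⟨i, w, [], A, [], C, m, []⟩ (some (Label.turn false))
      ⟨i, w, [], A, [], C, m, []⟩ := by
    refine Runs.of_step fun r => ⟨none, ?_⟩
    rw [program, stepAux_popThen_nil rfl, stepAux_jump]
  have h2 := ((h1.trans (runs_turn false)).trans (runs_tail false)).trans (runs_head false)
  have h3 := ((h2.trans (runs_turn true)).trans (runs_tail true)).trans (runs_head true)
  refine ((h3.trans runs_clean).mono ?_).congr ?_
  · simp
    ring_nf
    omega
  · simp [rewardRow]

end Machine

end SSGames

namespace SSGames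

/-! ### The code of the reduced game -/

open Machine

theorem bits_two_pow (p : ℕ) : (2 ^ p).bits = List.replicate p false ++ [true] := by
  induction p with
  | zero => exact Nat.one_bits
  | succ p ih => rw [pow_succ', Nat.bit0_bits _ (by positivity), ih]; rfl

theorem bits_two_pow_sub_one (p : ℕ) : (2 ^ p - 1).bits = List.replicate p true := by
  induction p with
  | zero => rfl
  | succ p ih =>
    rw [show 2 ^ (p + 1) - 1 = 2 * (2 ^ p - 1) + 1 by
      have := Nat.one_le_two_pow (n := p); rw [pow_succ']; omega, Nat.bit1_bits, ih]
    rfl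

/-- The encoding uses numerator and denominator in lowest terms, so the words of the machine match
only because its fractions are reduced. -/
theorem num_div_of_coprime {a b : ℕ} (hb : 0 < b) (h : a.Coprime b) :
    (a / b : ℚ≥0).num = a ∧ (a / b : ℚ≥0).den = b := by
  have h1 : (((a / b : ℚ≥0)) : ℚ) = ((a : ℤ) : ℚ) / ((b : ℤ) : ℚ) := by push_cast; rfl
  constructor
  · have := Rat.num_div_eq_of_coprime (a := a) (b := b) (by exact_mod_cast hb) h
    rw [← h1, NNRat.num_coe] at this
    exact_mod_cast this
  · have := Rat.den_div_eq_of_coprime (a := a) (b := b) (by exact_mod_cast hb) h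
    rw [← h1, NNRat.den_coe] at this
    exact_mod_cast this

theorem encodeCell_zero : encodeCell (false, 0) = zeroCell := by
  simp [encodeCell, zeroCell]

theorem encodeCell_inv (p : ℕ) :
    encodeCell (true, 1 / (2 ^ p : ℕ)) =
      Sym.flag true :: Sym.bit true :: Sym.slash :: (List.replicate p (Sym.bit false) ++
        [Sym.bit true, Sym.endCell]) := by
  obtain ⟨h1, h2⟩ := num_div_of_coprime (a := 1) (b := 2 ^ p) (by positivity)
    (Nat.coprime_one_left _)
  rw [Nat.cast_one] at h1 h2
  simp only [encodeCell, h1, h2, bits_two_pow, Nat.one_bits]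
  simp

theorem encodeCell_compl (p : ℕ) :
    encodeCell (true, (2 ^ p - 1 : ℕ) / (2 ^ p : ℕ)) =
      Sym.flag true :: (List.replicate p (Sym.bit true) ++
        Sym.slash :: (List.replicate p (Sym.bit false) ++ [Sym.bit true, Sym.endCell])) := by
  have hp := Nat.one_le_two_pow (n := p)
  obtain ⟨h1, h2⟩ := num_div_of_coprime (a := 2 ^ p - 1) (b := 2 ^ p) (by positivity) (by
    conv_rhs => rw [← Nat.sub_add_cancel hp]
    simp)
  simp only [encodeCell, h1, h2, bits_two_pow, bits_two_pow_sub_one]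
  simp

theorem numWord_inv (d : Bool) (p : ℕ) :
    numWord d false p = encodeCell (true, 1 / (2 ^ (if d then 2 * p else p) : ℕ)) := by
  rw [encodeCell_inv, numWord]
  rfl

theorem numWord_compl (d : Bool) (p : ℕ) :
    numWord d true p = encodeCell (true,
      (2 ^ (if d then 2 * p else p) - 1 : ℕ) / (2 ^ (if d then 2 * p else p) : ℕ)) := by
  rw [encodeCell_compl, numWord]
  rfl

/-- The vertices of the reduced game in the order of their encoding. -/
def vertexList (n : ℕ) : List (Vtx (Fin n)) :=
  -- Interleaving the two copies lets the machine produce both rows of a vertex while reading its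
  -- one input row.
  Vtx.good :: Vtx.bad :: (List.finRange n).flatMap fun v => [Vtx.pre v, Vtx.main v]

theorem mem_vertexList {n : ℕ} (a : Vtx (Fin n)) : a ∈ vertexList n := by
  rcases a with _ | _ | v | v <;> simp [vertexList]

theorem nodup_vertexList (n : ℕ) : (vertexList n).Nodup := by
  simp only [vertexList, List.nodup_cons, List.mem_cons, List.mem_flatMap]
  refine ⟨by simp, by simp, List.nodup_flatMap.2 ⟨by simp, ?_⟩⟩
  refine (List.nodup_finRange n).imp ?_
  intro a b hab
  simp [Function.onFun, hab.symm]

/-- The numbering of the vertices of the reduced game. -/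
def vertexEquiv (n : ℕ) : Fin (vertexList n).length ≃ Vtx (Fin n) :=
  (nodup_vertexList n).getEquivOfForallMemList _ mem_vertexList

theorem flatMap_vertexEquiv {n : ℕ} {β : Type*} (f : Vtx (Fin n) → List β) :
    (List.finRange (vertexList n).length).flatMap (fun i => f (vertexEquiv n i)) =
      (vertexList n).flatMap f := by
  conv_rhs => rw [← List.map_get_finRange (vertexList n), List.flatMap_map]
  rfl

theorem flatMap_vertexList {n : ℕ} {β : Type*} (f : Vtx (Fin n) → List β) :
    (vertexList n).flatMap f = f Vtx.good ++ (f Vtx.bad ++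
      (List.finRange n).flatMap fun v => f (Vtx.pre v) ++ f (Vtx.main v)) := by
  simp [vertexList, List.flatMap_assoc]

/-- The instance of the problem for limit objectives that belongs to an instance of the reachability
problem. -/
noncomputable def reducedInstance (O : LimitObjective) (x : ReachInstance) : RewardInstance where
  n := (vertexList x.n).length
  game := (x.game.reduced x.start x.target x.encode.length).comap (vertexEquiv x.n)
  start := (vertexEquiv x.n).symm Vtx.good
  reward i := O.orientation * SSG.baseReward (vertexEquiv x.n i)

/-- The row of a vertex in the code of the reduced game. -/
def reducedRow {n : ℕ} (G : SSG (Fin n)) (s t : Fin n) (L : ℕ) (o : SignType) (a : Vtx (Fin n)) :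
    List Sym :=
  Sym.owner (G.reducedOwner a) :: Sym.flag (decide (a = Vtx.good)) ::
    Sym.reward (o * SSG.baseReward a) ::
      ((vertexList n).flatMap (fun b => encodeCell (G.reducedEdge s t L a b)) ++ [Sym.endRow])

theorem encode_reducedInstance (O : LimitObjective) (x : ReachInstance) :
    (reducedInstance O x).encode = (vertexList x.n).flatMap
      (reducedRow x.game x.start x.target x.encode.length O.orientation) := by
  rw [← flatMap_vertexEquiv, RewardInstance.encode, encodeGame]
  refine List.flatMap_congr fun i _ => ?_
  have h1 : ∀ j, (decide (j ∈ (reducedInstance O x).game.succ i),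
      (reducedInstance O x).game.prob i j) = x.game.reducedEdge x.start x.target x.encode.length
        (vertexEquiv x.n i) (vertexEquiv x.n j) := by
    intro j
    refine Prod.ext ?_ rfl
    have : j ∈ (reducedInstance O x).game.succ i ↔ _ := SSG.mem_succ_comap _ _ i j
    rw [Bool.eq_iff_iff, decide_eq_true_iff, this]
    simp [SSG.reduced]
    rfl
  have h2 : decide (i = (reducedInstance O x).start) = decide (vertexEquiv x.n i = Vtx.good) := by
    rw [decide_eq_decide]
    exact Equiv.eq_symm_apply _
  unfold encodeRow reducedRow
  simp only [h1, h2]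
  congr 4
  exact flatMap_vertexEquiv fun b => encodeCell (x.game.reducedEdge x.start x.target
    x.encode.length (vertexEquiv x.n i) b)

section rows

variable {n : ℕ} (G : SSG (Fin n)) (s t : Fin n) (L : ℕ) (o : SignType)

theorem reducedRow_good : reducedRow G s t L o Vtx.good =
    rewardRow true o ((List.finRange n).map fun v => Sym.flag (decide (v = s))) L := by
  rw [reducedRow, rewardRow, flatMap_vertexList, numWord_inv, coinCells, List.flatMap_map]
  simp only [SSG.reducedEdge, SSG.reducedOwner, SSG.baseReward, numWord_compl, Sym.flag.injEq,
    decide_eq_true_eq, encodeCell_zero, apply_ite encodeCell, decide_true, mul_one]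
  simp

theorem reducedRow_bad : reducedRow G s t L o Vtx.bad =
    rewardRow false (-o) ((List.finRange n).map fun v => Sym.flag (decide (v = s))) L := by
  rw [reducedRow, rewardRow, flatMap_vertexList, numWord_inv, coinCells, List.flatMap_map]
  simp only [SSG.reducedEdge, SSG.reducedOwner, SSG.baseReward, numWord_compl, Sym.flag.injEq,
    decide_eq_true_eq, encodeCell_zero, apply_ite encodeCell, mul_neg, mul_one]
  simp

theorem flatMap_eq_zeroCells (l : List (Fin n)) (f : Fin n → List Sym)
    (h : ∀ u ∈ l, f u = zeroCell ++ zeroCell) : l.flatMap f = zeroCells l.length := by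
  induction l with
  | nil => rfl
  | cons a l ih =>
    rw [List.flatMap_cons, h a (by simp), ih fun u hu => h u (by simp [hu])]
    simp [zeroCells, List.replicate_succ]

theorem reducedRow_pair {l₁ l₂ : List (Fin n)} {v : Fin n}
    (h : l₁ ++ v :: l₂ = List.finRange n) :
    reducedRow G s t L o (Vtx.pre v) ++ reducedRow G s t L o (Vtx.main v) =
      rowPair (G.owner v) (decide (v = t))
        ((List.finRange n).map fun u => (decide (u ∈ G.succ v), G.prob v u))
        l₁.length l₂.length L := by
  have hnd := List.nodup_finRange n
  rw [← h, List.nodup_append, List.nodup_cons] at hnd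
  obtain ⟨-, ⟨hv2, -⟩, hv1⟩ := hnd
  have key : (List.finRange n).flatMap (fun u =>
      encodeCell (G.reducedEdge s t L (Vtx.pre v) (Vtx.pre u)) ++
        encodeCell (G.reducedEdge s t L (Vtx.pre v) (Vtx.main u))) =
      zeroCells l₁.length ++ (zeroCell ++ (frontCell (!decide (v = t)) L ++
        zeroCells l₂.length)) := by
    have hne : ∀ u, u ≠ v → encodeCell (G.reducedEdge s t L (Vtx.pre v) (Vtx.pre u)) ++
        encodeCell (G.reducedEdge s t L (Vtx.pre v) (Vtx.main u)) = zeroCell ++ zeroCell := by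
      intro u hu
      simp [SSG.reducedEdge, hu, encodeCell_zero]
    rw [← h, List.flatMap_append, List.flatMap_cons,
      flatMap_eq_zeroCells l₁ _ fun u hu => hne u fun e => hv1 u hu v (by simp) e,
      flatMap_eq_zeroCells l₂ _ fun u hu => hne u fun e => hv2 (e ▸ hu)]
    by_cases hvt : v = t
    · simp [SSG.reducedEdge, hvt, encodeCell_zero, frontCell]
    · simp only [SSG.reducedEdge, hvt, encodeCell_zero, frontCell, numWord_compl]
      simp [hvt]
  have h1 : encodeCell (G.reducedEdge s t L (Vtx.pre v) Vtx.good) =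
      frontCell (decide (v = t)) L := by
    simp only [SSG.reducedEdge, frontCell, apply_ite encodeCell, encodeCell_zero, numWord_compl,
      decide_eq_true_eq, if_true]
  have h2 : encodeCell (G.reducedEdge s t L (Vtx.pre v) Vtx.bad) = numWord true false L := by
    simp only [SSG.reducedEdge, numWord_inv, if_true]
  rw [reducedRow, reducedRow, rowPair, flatMap_vertexList, flatMap_vertexList, key, h1, h2,
    List.flatMap_map]
  simp only [SSG.reducedEdge, SSG.reducedOwner, SSG.baseReward, encodeCell_zero]
  simp

end rows

/-! ### The running time of the machine -/

theorem inputRow_eq (x : ReachInstance) : x.encode = (List.finRange x.n).flatMap fun v =>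
    inputRow (x.game.owner v) (decide (v = x.start)) (decide (v = x.target))
      ((List.finRange x.n).map fun u => (decide (u ∈ x.game.succ v), x.game.prob v u)) := by
  simp [ReachInstance.encode, encodeGame, encodeRow, inputRow, List.flatMap_map]

/-- Induction from the end of `l₁`, following the backward reading: `l₂` consists of the vertices
already treated, whose flags are on `marks`. -/
theorem runs_rows (x : ReachInstance) (L : ℕ) (o : SignType) {A w : List Sym} (hA : A.length = L)
    (l₁ l₂ : List (Fin x.n)) (h : l₁ ++ l₂ = List.finRange x.n) :
    Runs o ((l₁.flatMap fun v =>
        inputRow (x.game.owner v) (decide (v = x.start)) (decide (v = x.target))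
        ((List.finRange x.n).map fun u => (decide (u ∈ x.game.succ v), x.game.prob v u))).length +
          l₁.length * (2 * x.n + 6 * L + 15)) Label.row
      ⟨[], w, (l₁.flatMap fun v =>
        inputRow (x.game.owner v) (decide (v = x.start)) (decide (v = x.target))
        ((List.finRange x.n).map fun u => (decide (u ∈ x.game.succ v), x.game.prob v u))).reverse,
        A, [], [], l₂.map fun v => Sym.flag (decide (v = x.start)), []⟩ (some Label.row)
      ⟨[], (l₁.flatMap fun v => reducedRow x.game x.start x.target L o (Vtx.pre v) ++
        reducedRow x.game x.start x.target L o (Vtx.main v)) ++ w, [], A, [], [],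
        (List.finRange x.n).map fun v => Sym.flag (decide (v = x.start)), []⟩ := by
  induction l₁ using List.reverseRecOn generalizing w l₂ with
  | nil =>
    rw [List.nil_append] at h
    subst h
    exact (Runs.refl _ _).mono (by omega)
  | append_singleton l v ih =>
    have h' : l ++ v :: l₂ = List.finRange x.n := by rw [← h]; simp
    have hlen := congrArg List.length h'
    rw [List.length_append, List.length_cons, List.length_finRange] at hlen
    have h1 := (runs_row (o := o) (i := []) (w := w) (A := A)
      (v := (l.flatMap fun v =>
        inputRow (x.game.owner v) (decide (v = x.start)) (decide (v = x.target))
        ((List.finRange x.n).map fun u => (decide (u ∈ x.game.succ v), x.game.prob v u))).reverse)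
      (m := l₂.map fun v => Sym.flag (decide (v = x.start)))
      (x.game.owner v) (decide (v = x.start)) (decide (v = x.target))
      ((List.finRange x.n).map fun u => (decide (u ∈ x.game.succ v), x.game.prob v u)) l.length
      (by simp; omega)).trans (ih (v :: l₂) h')
    rw [← List.reverse_append] at h1
    simp only [List.flatMap_append, List.flatMap_singleton]
    refine (h1.mono ?_).congr ?_
    · simp only [List.length_append, List.length_map, List.length_finRange, hA,
        List.length_singleton, add_mul]
      omega
    · rw [reducedRow_pair _ _ _ _ _ h']
      simp [hA]

theorem runs_encode (x : ReachInstance) (O : LimitObjective) :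
    Runs O.orientation (12 * x.encode.length ^ 2 + 32 * x.encode.length + 15) Label.read
      ⟨x.encode, [], [], [], [], [], [], []⟩ none
      ⟨[], (reducedInstance O x).encode, [], [], [], [], [], []⟩ := by
  set L := x.encode.length with hL
  have hn : x.n ≤ L := by
    have := count_encodeGame x.game (fun v =>
      (Sym.flag (decide (v = x.start)), Sym.flag (decide (v = x.target)))) (by simp)
    rw [← this]
    exact List.count_le_length
  have h1 := runs_read (o := O.orientation) (w := []) (v := []) (A := []) (B := []) (C := [])
    (m := []) (m₂ := []) x.encode
  have h2 := runs_rows x L O.orientation (A := x.encode.reverse) (w := []) (by simp [hL])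
    (List.finRange x.n) [] (by simp)
  have h3 := runs_reward_rows (o := O.orientation) (i := []) (A := x.encode.reverse) (C := [])
    (w := ((List.finRange x.n).flatMap fun v =>
        reducedRow x.game x.start x.target L O.orientation (Vtx.pre v) ++
        reducedRow x.game x.start x.target L O.orientation (Vtx.main v)) ++ [])
    (m := (List.finRange x.n).map fun v => Sym.flag (decide (v = x.start)))
  rw [← inputRow_eq] at h2
  rw [List.append_nil] at h1
  refine (((h1.trans h2).trans h3).mono ?_).congr ?_
  · simp only [List.length_reverse, List.length_map, List.length_finRange, ← hL]
    -- The number of vertices is at most `L`, since each row of the encoding ends with its own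
    -- `endRow`.
    nlinarith [Nat.mul_le_mul hn hn, Nat.mul_le_mul_right L hn]
  · rw [encode_reducedInstance, flatMap_vertexList, reducedRow_good, reducedRow_bad]
    simp [← hL]

/-- The machine that computes the reduction. -/
def machine (o : SignType) : Turing.FinTM2 where
  K := K
  k₀ := K.inp
  k₁ := K.out
  Γ := fun _ => Sym
  Λ := Label
  main := Label.read
  σ := Option Sym
  initialState := none
  m := program o

theorem initList_machine (o : SignType) (l : List Sym) :
    Turing.initList (machine o) l = cfg (some Label.read) none ⟨l, [], [], [], [], [], [], []⟩ := by
  unfold Turing.initList cfg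
  congr 1
  funext k
  cases k <;> rfl

theorem haltList_machine (o : SignType) (l : List Sym) :
    Turing.haltList (machine o) l = cfg none none ⟨[], l, [], [], [], [], [], []⟩ := by
  unfold Turing.haltList cfg
  congr 1
  funext k
  cases k <;> rfl

theorem nonempty_computable (O : LimitObjective) :
    Nonempty (Turing.TM2ComputableInPolyTime ReachInstance.encode RewardInstance.encode
      (reducedInstance O)) := by
  refine ⟨{ tm := machine O.orientation
            inputAlphabet := Equiv.refl Sym
            outputAlphabet := Equiv.refl Sym
            time := 12 * Polynomial.X ^ 2 + 32 * Polynomial.X + 15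
            outputsFun := fun x => Classical.choice ?_ }⟩
  -- The machine starts with the register `none`, and `hr` says that it also halts with it.
  obtain ⟨r', k, hk, hr, h⟩ := runs_encode x O none
  rw [hr rfl] at h
  refine ⟨{ steps := k, evals_in_steps := ?_, steps_le_m := by simpa using hk }⟩
  change (flip Bind.bind (machine O.orientation).step)^[k]
    (some (Turing.initList (machine O.orientation) (List.map id x.encode))) =
    some (Turing.haltList (machine O.orientation) (List.map id (reducedInstance O x).encode))
  erw [List.map_id, List.map_id, initList_machine, haltList_machine]
  exact h

/-! ### Correctness of the reduction -/

theorem length_encode (x : ReachInstance) : x.encode.length =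
    ∑ v, (4 + ∑ u, (3 + (x.game.prob v u).num.bits.length + (x.game.prob v u).den.bits.length)) := by
  rw [inputRow_eq, List.length_flatMap, Fin.sum_univ_def]
  congr 1
  refine List.map_congr_left fun v _ => ?_
  simp only [inputRow, List.length_cons, List.length_append, List.length_flatMap, List.map_map,
    Fin.sum_univ_def, List.length_nil]
  have : ∀ u, (List.length ∘ encodeCell) (decide (u ∈ x.game.succ v), x.game.prob v u) =
      3 + (x.game.prob v u).num.bits.length + (x.game.prob v u).den.bits.length := by
    intro u
    simp [encodeCell]
    omega
  have h2 : ((fun c => (encodeCell c).length) ∘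
      fun u => (decide (u ∈ x.game.succ v), x.game.prob v u)) =
      fun u => 3 + (x.game.prob v u).num.bits.length + (x.game.prob v u).den.bits.length :=
    funext this
  rw [h2]
  omega

/-- Each denominator is below two to the number of its bits, and these bits are part of the
encoding; the delimiters and labels, at least `7` per vertex, pay for `7 * 5 ^ n`. This justifies
the length of the input as exponent `L`. -/
theorem gapBound_lt (x : ReachInstance) : x.game.gapBound < 2 ^ x.encode.length := by
  have hn : 1 ≤ x.n := Nat.one_le_iff_ne_zero.2 fun h => (h ▸ x.start).elim0
  have hD : ∏ v, x.game.commonDen v ≤ 2 ^ ∑ v, ∑ u, (x.game.prob v u).den.bits.length := by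
    rw [← Finset.prod_pow_eq_pow_sum]
    refine Finset.prod_le_prod' fun v _ => ?_
    rw [← Finset.prod_pow_eq_pow_sum]
    refine Finset.prod_le_prod' fun u _ => ?_
    rw [Nat.size_eq_bits_len]
    exact (Nat.lt_size_self _).le
  have hL : 7 * x.n + ∑ v, ∑ u, (x.game.prob v u).den.bits.length ≤ x.encode.length := by
    rw [length_encode]
    simp only [Finset.sum_add_distrib, Finset.sum_const, Finset.card_univ, Fintype.card_fin,
      smul_eq_mul]
    -- Apart from the bits the encoding has `4 * n + 3 * n ^ 2` symbols, which is at least `7 * n`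
    -- because the start vertex forces `n ≥ 1`.
    have := Nat.mul_le_mul_left x.n (Nat.mul_le_mul_right 3 hn)
    omega
  have h5 : 7 * 5 ^ x.n < 2 ^ (7 * x.n) := by
    calc 7 * 5 ^ x.n < 8 * 8 ^ x.n := by
          have := Nat.pow_le_pow_left (show 5 ≤ 8 by norm_num) x.n
          have := Nat.pow_pos (n := x.n) (show 0 < 8 by norm_num)
          omega
      _ ≤ 8 ^ x.n * 8 ^ x.n := Nat.mul_le_mul_right _ (Nat.le_self_pow (by omega) 8)
      _ = 2 ^ (6 * x.n) := by
          rw [show 8 = 2 ^ 3 by norm_num, ← pow_mul, ← pow_add]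
          congr 1
          ring
      _ ≤ _ := Nat.pow_le_pow_right (by norm_num) (by omega)
  calc x.game.gapBound = 7 * 5 ^ x.n * ∏ v, x.game.commonDen v := by
        rw [SSG.gapBound, Fintype.card_fin, mul_assoc]
    _ ≤ 7 * 5 ^ x.n * 2 ^ ∑ v, ∑ u, (x.game.prob v u).den.bits.length := Nat.mul_le_mul_left _ hD
    _ < 2 ^ (7 * x.n) * 2 ^ ∑ v, ∑ u, (x.game.prob v u).den.bits.length :=
        Nat.mul_lt_mul_of_pos_right h5 (by positivity)
    _ ≤ _ := by
        rw [← pow_add]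
        exact Nat.pow_le_pow_right (by norm_num) hL

end SSGames

theorem mainTheorem7 (O : SSGames.LimitObjective) :
    SSGames.PolyTimeReducible SSGames.condonProblem (SSGames.zeroOneProblem O) := by
  refine ⟨SSGames.reducedInstance O, SSGames.nonempty_computable O, fun x hx => ?_, fun x hx => ?_⟩
  · exact SSGames.value_reduced_eq_one _ _ _ _ _ _ (SSGames.gapBound_lt x) hx
  · exact SSGames.value_reduced_eq_zero _ _ _ _ _ _ (SSGames.gapBound_lt x) hx
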